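/- **Setting.** Let $I_1=\{(\mu,\gamma)\in\mathbb R^2:\ \mu>-\tfrac12,\ \gamma>-1-\sqrt{1+2\mu}\}$. For $(\mu,\gamma)\in I_1$ put $b=\sqrt{1+2\mu}$ and $U^{\mu,\gamma}=(U^{\mu,\gamma}_\theta,0)$ with $$U^{\mu,\gamma}_\theta(x)=(1-x)\Big(1-b-\frac{2b(\gamma+1-b)}{(\gamma+1+b)\left(\frac{1+x}{2}\right)^{-b}-\gamma-1+b}\Big),\qquad -1<x\le 1,$$ and $U^{\mu,\gamma}_\theta(-1)=\lim_{x\to-1^+}U^{\mu,\gamma}_\theta(x)$. Let $$a_{\mu,\gamma}(x)=\int_0^x\frac{2s+U^{\mu,\gamma}_\theta(s)}{1-s^2}\,ds,\quad b_{\mu,\gamma}(x)=\int_0^x\frac{U^{\mu,\gamma}_\theta(s)}{1-s^2}\,ds,\quad V^1_{\mu,\gamma}=\big(e^{-a_{\mu,\gamma}},\,0\big),\quad V^2_{\mu,\gamma}=\Big(0,\ \int_x^1e^{-b_{\mu,\gamma}(t)}\,dt\Big),$$ where $e^{-a_{\mu,\gamma}}$ is given the value $0$, its limit, at $x=1$.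 For a function $f$ on $(-1,1]$ let $$\psi[f](x)=\int_x^1\int_l^1\int_t^1\frac{2f(s)f'(s)}{1-s^2}\,ds\,dt\,dl .$$ The *reduced system* for $U=(U_\theta,U_\phi)$, $U_\theta\in C^1(-1,1)$, $U_\phi\in C^2(-1,1)$, with constant $\hat\mu\in\mathbb R$, is, for $-1<x<1$, $$(1-x^2)U_\theta'+2xU_\theta+\tfrac12U_\theta^2-\psi[U_\phi](x)=\hat\mu(1-x)^2,\qquad (1-x^2)U_\phi''+U_\theta U_\phi'=0. \qquad (*)$$ For $0<\epsilon<1$ let $\mathbf M_1$ be the space of $f\in C([-1,1])\cap C^1((-1,1])\cap C^2((0,1))$ with $f(1)=f(-1)=0$ and finite norm $$\|f\|_{\mathbf M_1}=\|(1+x)^{-1+\epsilon}f\|_{L^\infty(-1,1)}+\|(1+x)^{\epsilon}f'\|_{L^\infty(-1,1)}+\|f''\|_{L^\infty(0,1)},$$ let $\mathbf M_2$ be the space of $g\in C^1((-1,1])\cap C^2((-1,1))$ with $g(1)=0$ and finite norm $$\|g\|_{\mathbf M_2}=\|g\|_{L^\infty(-1,1)}+\|(1+x)^{\epsilon}g'\|_{L^\infty(-1,1)}+\|(1+x)^{1+\epsilon}g''\|_{L^\infty(-1,1)},$$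 let $\mathbf X=\mathbf M_1\times\mathbf M_2$ with $\|(f,g)\|_{\mathbf X}=\|f\|_{\mathbf M_1}+\|g\|_{\mathbf M_2}$, and let $\mathbf X_1=\{(f,g)\in\mathbf X: f(0)=g(0)=0\}$. $B_\delta(0)$ is the open Euclidean disc of radius $\delta$ in $\mathbb R^2$. **Theorem.** Let $K\subset I_1$ be compact and let $0<\epsilon<1$ satisfy $U^{\mu,\gamma}_\theta(-1)<2\epsilon$ for every $(\mu,\gamma)\in K$. Then there exist $\delta>0$ and a map $V\in C^\infty(K\times B_\delta(0),\mathbf X_1)$ (that is, $V$ extends to a $C^\infty$ map on $O\times B_\delta(0)$ for some open $O\supset K$) with $V(\mu,\gamma,0,0)=0$ and $\frac{\partial V}{\partial\beta_i}(\mu,\gamma,0,0)=0$, $i=1,2$, for all $(\mu,\gamma)\in K$, such that for all $(\mu,\gamma)\in K$ and $\beta=(\beta_1,\beta_2)\in B_\delta(0)$ the function $$U=U^{\mu,\gamma}+\beta_1V^1_{\mu,\gamma}+\beta_2V^2_{\mu,\gamma}+V(\mu,\gamma,\beta_1,\beta_2)\qquad(**)$$ satisfies $(*)$ with $\hat\mu=\mu-\frac14\psi[U_\phi](-1)$,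 where the integrals defining $\psi[U_\phi]$ on $[-1,1]$ converge. Moreover, there exists $\delta'>0$ such that if $(\mu,\gamma)\in K$, $U-U^{\mu,\gamma}\in\mathbf X$, $\|U-U^{\mu,\gamma}\|_{\mathbf X}<\delta'$ and $U$ satisfies $(*)$ with some constant $\hat\mu\in\mathbb R$, then $(**)$ holds on $(-1,1]$ for some $\beta$ with $|\beta|<\delta$. -/

import Mathlib

open Set Filter Topology MeasureTheory
open scoped ContDiff

noncomputable section

namespace SwirlNS

/-! ### Sup norms of functions on a set -/

/-- `g` is bounded on `s`. -/
def BddOn (s : Set ℝ) (g : ℝ → ℝ) : Prop := ∃ C : ℝ, ∀ x ∈ s, |g x| ≤ C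

/-- The supremum of `|g|` on `s`. For a continuous function on an open interval this is
its `L^∞` norm on that interval. -/
def supOn (s : Set ℝ) (g : ℝ → ℝ) : ℝ := ⨆ x : s, |g x|

theorem supOn_nonneg (s : Set ℝ) (g : ℝ → ℝ) : 0 ≤ supOn s g :=
  Real.iSup_nonneg fun _ => abs_nonneg _

theorem le_supOn {s : Set ℝ} {g : ℝ → ℝ} (h : BddOn s g) {x : ℝ} (hx : x ∈ s) :
    |g x| ≤ supOn s g := by
  obtain ⟨C, hC⟩ := h
  exact le_ciSup (f := fun x : s => |g x|) ⟨C, by rintro _ ⟨y, rfl⟩; exact hC y y.2⟩ ⟨x, hx⟩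

theorem supOn_le {s : Set ℝ} {g : ℝ → ℝ} {C : ℝ} (hC : 0 ≤ C) (h : ∀ x ∈ s, |g x| ≤ C) :
    supOn s g ≤ C :=
  Real.iSup_le (fun x => h x x.2) hC

theorem BddOn.add {s : Set ℝ} {f g h : ℝ → ℝ} (hf : BddOn s f) (hg : BddOn s g)
    (e : ∀ x ∈ s, h x = f x + g x) : BddOn s h := by
  obtain ⟨C, hC⟩ := hf
  obtain ⟨D, hD⟩ := hg
  refine ⟨C + D, fun x hx => ?_⟩
  rw [e x hx]
  exact (abs_add_le _ _).trans (add_le_add (hC x hx) (hD x hx))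

theorem BddOn.smul {s : Set ℝ} {f h : ℝ → ℝ} (c : ℝ) (hf : BddOn s f)
    (e : ∀ x ∈ s, h x = c * f x) : BddOn s h := by
  obtain ⟨C, hC⟩ := hf
  refine ⟨|c| * C, fun x hx => ?_⟩
  rw [e x hx, abs_mul]
  exact mul_le_mul_of_nonneg_left (hC x hx) (abs_nonneg c)

theorem supOn_add_le {s : Set ℝ} {f g h : ℝ → ℝ} (hf : BddOn s f) (hg : BddOn s g)
    (e : ∀ x ∈ s, h x = f x + g x) : supOn s h ≤ supOn s f + supOn s g := by
  refine supOn_le (add_nonneg (supOn_nonneg _ _) (supOn_nonneg _ _)) fun x hx => ?_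
  rw [e x hx]
  exact (abs_add_le _ _).trans (add_le_add (le_supOn hf hx) (le_supOn hg hx))

theorem supOn_smul {s : Set ℝ} {f h : ℝ → ℝ} (c : ℝ)
    (e : ∀ x ∈ s, h x = c * f x) : supOn s h = |c| * supOn s f := by
  unfold supOn
  rw [Real.mul_iSup_of_nonneg (abs_nonneg c)]
  exact iSup_congr fun x => by rw [e x x.2, abs_mul]

/-! ### The spaces `M₁(ε)`, `M₂(ε)`, `X(ε)` and `X₁(ε)`

A function on `[-1,1]`, respectively on `(-1,1]`, is represented by its extension by zero to `ℝ`,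
so that equality of elements is equality of functions on the interval. -/

/-- Membership in `M₁(ε)`. -/
structure MemM1 (ε : ℝ) (f : ℝ → ℝ) : Prop where
  zero_off : ∀ x, x ∉ Icc (-1 : ℝ) 1 → f x = 0
  cont : ContinuousOn f (Icc (-1) 1)
  c1 : ContDiffOn ℝ 1 f (Ioc (-1) 1)
  c2 : ContDiffOn ℝ 2 f (Ioo 0 1)
  right : f 1 = 0
  left : f (-1) = 0
  bdd0 : BddOn (Ioo (-1) 1) fun x => (1 + x) ^ (-1 + ε) * f x
  bdd1 : BddOn (Ioo (-1) 1) fun x => (1 + x) ^ ε * deriv f x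
  bdd2 : BddOn (Ioo 0 1) fun x => deriv (deriv f) x

/-- Membership in `M₂(ε)`. -/
structure MemM2 (ε : ℝ) (f : ℝ → ℝ) : Prop where
  zero_off : ∀ x, x ∉ Ioc (-1 : ℝ) 1 → f x = 0
  c1 : ContDiffOn ℝ 1 f (Ioc (-1) 1)
  c2 : ContDiffOn ℝ 2 f (Ioo (-1) 1)
  right : f 1 = 0
  bdd0 : BddOn (Ioo (-1) 1) f
  bdd1 : BddOn (Ioo (-1) 1) fun x => (1 + x) ^ ε * deriv f x
  bdd2 : BddOn (Ioo (-1) 1) fun x => (1 + x) ^ (1 + ε) * deriv (deriv f) x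

theorem diffAt_of_c1 {f : ℝ → ℝ} (h : ContDiffOn ℝ 1 f (Ioc (-1) 1)) {x : ℝ}
    (hx : x ∈ Ioo (-1 : ℝ) 1) : DifferentiableAt ℝ f x :=
  (h.differentiableOn one_ne_zero).differentiableAt (Ioc_mem_nhds hx.1 hx.2)

theorem diffAt_deriv_of_c2 {f : ℝ → ℝ} {u v : ℝ} (h : ContDiffOn ℝ 2 f (Ioo u v)) {x : ℝ}
    (hx : x ∈ Ioo u v) : DifferentiableAt ℝ (deriv f) x := by
  have h2 : ContDiffOn ℝ 1 (deriv f) (Ioo u v) :=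
    h.deriv_of_isOpen isOpen_Ioo (by norm_num)
  exact (h2.differentiableOn one_ne_zero).differentiableAt (isOpen_Ioo.mem_nhds hx)

theorem deriv_add_c1 {f g : ℝ → ℝ} (hf : ContDiffOn ℝ 1 f (Ioc (-1) 1))
    (hg : ContDiffOn ℝ 1 g (Ioc (-1) 1)) {x : ℝ} (hx : x ∈ Ioo (-1 : ℝ) 1) :
    deriv (f + g) x = deriv f x + deriv g x :=
  deriv_add (diffAt_of_c1 hf hx) (diffAt_of_c1 hg hx)

theorem deriv2_add {f g : ℝ → ℝ} {u v : ℝ} (hu : -1 ≤ u) (hv : v ≤ 1)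
    (hf : ContDiffOn ℝ 1 f (Ioc (-1) 1)) (hg : ContDiffOn ℝ 1 g (Ioc (-1) 1))
    (hf2 : ContDiffOn ℝ 2 f (Ioo u v)) (hg2 : ContDiffOn ℝ 2 g (Ioo u v)) {x : ℝ}
    (hx : x ∈ Ioo u v) :
    deriv (deriv (f + g)) x = deriv (deriv f) x + deriv (deriv g) x := by
  have e : deriv (f + g) =ᶠ[𝓝 x] deriv f + deriv g := by
    filter_upwards [isOpen_Ioo.mem_nhds hx] with y hy
    exact deriv_add_c1 hf hg ⟨hu.trans_lt hy.1, hy.2.trans_le hv⟩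
  rw [e.deriv_eq]
  exact deriv_add (diffAt_deriv_of_c2 hf2 hx) (diffAt_deriv_of_c2 hg2 hx)

theorem deriv_smul_fun (c : ℝ) (f : ℝ → ℝ) : deriv (c • f) = c • deriv f := by
  funext x
  exact deriv_const_smul_field (f := f) c

/-- `M₁(ε)` as a linear subspace of the functions on `ℝ`. -/
def M1Sub (ε : ℝ) : Submodule ℝ (ℝ → ℝ) where
  carrier := {f | MemM1 ε f}
  zero_mem' :=
    { zero_off := fun _ _ => rfl
      cont := continuousOn_const
      c1 := contDiffOn_const
      c2 := contDiffOn_const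
      right := rfl
      left := rfl
      bdd0 := ⟨0, fun x _ => by simp⟩
      bdd1 := ⟨0, fun x _ => by simp⟩
      bdd2 := ⟨0, fun x _ => by simp⟩ }
  add_mem' := fun {f g} hf hg =>
    { zero_off := fun x hx => by simp [hf.zero_off x hx, hg.zero_off x hx]
      cont := hf.cont.add hg.cont
      c1 := hf.c1.add hg.c1
      c2 := hf.c2.add hg.c2
      right := by simp [hf.right, hg.right]
      left := by simp [hf.left, hg.left]
      bdd0 := hf.bdd0.add hg.bdd0 fun x _ => by simp [mul_add]
      bdd1 := hf.bdd1.add hg.bdd1 fun x hx => by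
        simp only [deriv_add_c1 hf.c1 hg.c1 hx, mul_add]
      bdd2 := hf.bdd2.add hg.bdd2 fun x hx =>
        deriv2_add (by norm_num) le_rfl hf.c1 hg.c1 hf.c2 hg.c2 hx }
  smul_mem' := fun c f hf =>
    { zero_off := fun x hx => by simp [hf.zero_off x hx]
      cont := hf.cont.const_smul c
      c1 := hf.c1.const_smul c
      c2 := hf.c2.const_smul c
      right := by simp [hf.right]
      left := by simp [hf.left]
      bdd0 := hf.bdd0.smul c fun x _ => by simp [mul_left_comm]
      bdd1 := hf.bdd1.smul c fun x _ => by simp [deriv_smul_fun, mul_left_comm]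
      bdd2 := hf.bdd2.smul c fun x _ => by simp [deriv_smul_fun] }

/-- `M₂(ε)` as a linear subspace of the functions on `ℝ`. -/
def M2Sub (ε : ℝ) : Submodule ℝ (ℝ → ℝ) where
  carrier := {f | MemM2 ε f}
  zero_mem' :=
    { zero_off := fun _ _ => rfl
      c1 := contDiffOn_const
      c2 := contDiffOn_const
      right := rfl
      bdd0 := ⟨0, fun x _ => by simp⟩
      bdd1 := ⟨0, fun x _ => by simp⟩
      bdd2 := ⟨0, fun x _ => by simp⟩ }
  add_mem' := fun {f g} hf hg =>
    { zero_off := fun x hx => by simp [hf.zero_off x hx, hg.zero_off x hx]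
      c1 := hf.c1.add hg.c1
      c2 := hf.c2.add hg.c2
      right := by simp [hf.right, hg.right]
      bdd0 := hf.bdd0.add hg.bdd0 fun x _ => rfl
      bdd1 := hf.bdd1.add hg.bdd1 fun x hx => by
        simp only [deriv_add_c1 hf.c1 hg.c1 hx, mul_add]
      bdd2 := hf.bdd2.add hg.bdd2 fun x hx => by
        simp only [deriv2_add le_rfl le_rfl hf.c1 hg.c1 hf.c2 hg.c2 hx, mul_add] }
  smul_mem' := fun c f hf =>
    { zero_off := fun x hx => by simp [hf.zero_off x hx]
      c1 := hf.c1.const_smul c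
      c2 := hf.c2.const_smul c
      right := by simp [hf.right]
      bdd0 := hf.bdd0.smul c fun x _ => rfl
      bdd1 := hf.bdd1.smul c fun x _ => by simp [deriv_smul_fun, mul_left_comm]
      bdd2 := hf.bdd2.smul c fun x _ => by simp [deriv_smul_fun, mul_left_comm] }

/-- The space `M₁(ε)`; a type of its own, so that its only topology is the one of its norm. -/
def M1 (ε : ℝ) : Type := M1Sub ε

/-- The space `M₂(ε)`. -/
def M2 (ε : ℝ) : Type := M2Sub ε

instance (ε : ℝ) : AddCommGroup (M1 ε) := inferInstanceAs (AddCommGroup (M1Sub ε))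
instance (ε : ℝ) : Module ℝ (M1 ε) := inferInstanceAs (Module ℝ (M1Sub ε))
instance (ε : ℝ) : AddCommGroup (M2 ε) := inferInstanceAs (AddCommGroup (M2Sub ε))
instance (ε : ℝ) : Module ℝ (M2 ε) := inferInstanceAs (Module ℝ (M2Sub ε))

/-- The function underlying an element of `M₁(ε)`. -/
def M1.toFun {ε : ℝ} (f : M1 ε) : ℝ → ℝ := Subtype.val f

/-- The function underlying an element of `M₂(ε)`. -/
def M2.toFun {ε : ℝ} (f : M2 ε) : ℝ → ℝ := Subtype.val f

theorem M1.mem {ε : ℝ} (f : M1 ε) : MemM1 ε f.toFun := Subtype.property f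

theorem M2.mem {ε : ℝ} (f : M2 ε) : MemM2 ε f.toFun := Subtype.property f

instance (ε : ℝ) : Norm (M1 ε) where
  norm f := supOn (Ioo (-1) 1) (fun x => (1 + x) ^ (-1 + ε) * f.toFun x)
    + supOn (Ioo (-1) 1) (fun x => (1 + x) ^ ε * deriv f.toFun x)
    + supOn (Ioo 0 1) (fun x => deriv (deriv f.toFun) x)

instance (ε : ℝ) : Norm (M2 ε) where
  norm f := supOn (Ioo (-1) 1) f.toFun
    + supOn (Ioo (-1) 1) (fun x => (1 + x) ^ ε * deriv f.toFun x)
    + supOn (Ioo (-1) 1) (fun x => (1 + x) ^ (1 + ε) * deriv (deriv f.toFun) x)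

theorem M1.norm_def {ε : ℝ} (f : M1 ε) :
    ‖f‖ = supOn (Ioo (-1) 1) (fun x => (1 + x) ^ (-1 + ε) * f.toFun x)
      + supOn (Ioo (-1) 1) (fun x => (1 + x) ^ ε * deriv f.toFun x)
      + supOn (Ioo 0 1) (fun x => deriv (deriv f.toFun) x) := rfl

theorem M2.norm_def {ε : ℝ} (f : M2 ε) :
    ‖f‖ = supOn (Ioo (-1) 1) f.toFun
      + supOn (Ioo (-1) 1) (fun x => (1 + x) ^ ε * deriv f.toFun x)
      + supOn (Ioo (-1) 1) (fun x => (1 + x) ^ (1 + ε) * deriv (deriv f.toFun) x) := rfl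

theorem M1.toFun_add {ε : ℝ} (f g : M1 ε) : (f + g).toFun = f.toFun + g.toFun := rfl
theorem M1.toFun_smul {ε : ℝ} (c : ℝ) (f : M1 ε) : (c • f).toFun = c • f.toFun := rfl
theorem M2.toFun_add {ε : ℝ} (f g : M2 ε) : (f + g).toFun = f.toFun + g.toFun := rfl
theorem M2.toFun_smul {ε : ℝ} (c : ℝ) (f : M2 ε) : (c • f).toFun = c • f.toFun := rfl

theorem M1.core (ε : ℝ) : NormedSpace.Core ℝ (M1 ε) where
  norm_nonneg f := by
    rw [M1.norm_def]
    exact add_nonneg (add_nonneg (supOn_nonneg _ _) (supOn_nonneg _ _)) (supOn_nonneg _ _)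
  norm_smul c f := by
    simp only [M1.norm_def, M1.toFun_smul, Real.norm_eq_abs]
    rw [supOn_smul (f := fun x => (1 + x) ^ (-1 + ε) * f.toFun x)
        (h := fun x => (1 + x) ^ (-1 + ε) * (c • f.toFun) x) c
        (fun x _ => by simp [mul_left_comm]),
      supOn_smul (f := fun x => (1 + x) ^ ε * deriv f.toFun x)
        (h := fun x => (1 + x) ^ ε * deriv (c • f.toFun) x) c
        (fun x _ => by simp [deriv_smul_fun, mul_left_comm]),
      supOn_smul (f := fun x => deriv (deriv f.toFun) x)
        (h := fun x => deriv (deriv (c • f.toFun)) x) c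
        (fun x _ => by simp [deriv_smul_fun])]
    ring
  norm_triangle f g := by
    simp only [M1.norm_def, M1.toFun_add]
    have hf := f.mem
    have hg := g.mem
    have h0 := supOn_add_le (h := fun x => (1 + x) ^ (-1 + ε) * (f.toFun + g.toFun) x)
      hf.bdd0 hg.bdd0 (fun x _ => by simp [mul_add])
    have h1 := supOn_add_le (h := fun x => (1 + x) ^ ε * deriv (f.toFun + g.toFun) x)
      hf.bdd1 hg.bdd1 (fun x hx => by simp only [deriv_add_c1 hf.c1 hg.c1 hx, mul_add])
    have h2 := supOn_add_le (h := fun x => deriv (deriv (f.toFun + g.toFun)) x)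
      hf.bdd2 hg.bdd2
      (fun x hx => deriv2_add (by norm_num) le_rfl hf.c1 hg.c1 hf.c2 hg.c2 hx)
    linarith
  norm_eq_zero_iff f := by
    constructor
    · intro h
      rw [M1.norm_def] at h
      have h0 : supOn (Ioo (-1) 1) (fun x => (1 + x) ^ (-1 + ε) * f.toFun x) = 0 := by
        linarith [supOn_nonneg (Ioo (-1) 1) (fun x => (1 + x) ^ (-1 + ε) * f.toFun x),
          supOn_nonneg (Ioo (-1) 1) (fun x => (1 + x) ^ ε * deriv f.toFun x),
          supOn_nonneg (Ioo 0 1) (fun x => deriv (deriv f.toFun) x)]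
      apply Subtype.ext
      funext x
      change f.toFun x = 0
      by_cases hx : x ∈ Ioo (-1 : ℝ) 1
      · have := le_supOn f.mem.bdd0 hx
        rw [h0] at this
        have h3 := abs_nonpos_iff.mp this
        have h4 : (1 + x) ^ (-1 + ε) ≠ 0 :=
          (Real.rpow_pos_of_pos (by linarith [hx.1]) _).ne'
        exact (mul_eq_zero.mp h3).resolve_left h4
      · by_cases hx' : x ∈ Icc (-1 : ℝ) 1
        · rcases eq_or_lt_of_le hx'.1 with h1 | h1
          · rw [← h1]
            exact f.mem.left
          · rcases eq_or_lt_of_le hx'.2 with h2 | h2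
            · rw [h2]
              exact f.mem.right
            · exact absurd ⟨h1, h2⟩ hx
        · exact f.mem.zero_off x hx'
    · rintro rfl
      have h := fun x : ℝ => (rfl : (0 : M1 ε).toFun x = 0)
      have e : (0 : M1 ε).toFun = fun _ => 0 := funext h
      simp [M1.norm_def, e, supOn]

theorem M2.core (ε : ℝ) : NormedSpace.Core ℝ (M2 ε) where
  norm_nonneg f := by
    rw [M2.norm_def]
    exact add_nonneg (add_nonneg (supOn_nonneg _ _) (supOn_nonneg _ _)) (supOn_nonneg _ _)
  norm_smul c f := by
    simp only [M2.norm_def, M2.toFun_smul, Real.norm_eq_abs]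
    rw [supOn_smul (f := f.toFun) (h := c • f.toFun) c (fun x _ => by simp),
      supOn_smul (f := fun x => (1 + x) ^ ε * deriv f.toFun x)
        (h := fun x => (1 + x) ^ ε * deriv (c • f.toFun) x) c
        (fun x _ => by simp [deriv_smul_fun, mul_left_comm]),
      supOn_smul (f := fun x => (1 + x) ^ (1 + ε) * deriv (deriv f.toFun) x)
        (h := fun x => (1 + x) ^ (1 + ε) * deriv (deriv (c • f.toFun)) x) c
        (fun x _ => by simp [deriv_smul_fun, mul_left_comm])]
    ring
  norm_triangle f g := by
    simp only [M2.norm_def, M2.toFun_add]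
    have hf := f.mem
    have hg := g.mem
    have h0 := supOn_add_le (h := f.toFun + g.toFun) hf.bdd0 hg.bdd0 (fun x _ => rfl)
    have h1 := supOn_add_le (h := fun x => (1 + x) ^ ε * deriv (f.toFun + g.toFun) x)
      hf.bdd1 hg.bdd1 (fun x hx => by simp only [deriv_add_c1 hf.c1 hg.c1 hx, mul_add])
    have h2 := supOn_add_le
      (h := fun x => (1 + x) ^ (1 + ε) * deriv (deriv (f.toFun + g.toFun)) x)
      hf.bdd2 hg.bdd2
      (fun x hx => by simp only [deriv2_add le_rfl le_rfl hf.c1 hg.c1 hf.c2 hg.c2 hx, mul_add])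
    linarith
  norm_eq_zero_iff f := by
    constructor
    · intro h
      rw [M2.norm_def] at h
      have h0 : supOn (Ioo (-1) 1) f.toFun = 0 := by
        linarith [supOn_nonneg (Ioo (-1) 1) f.toFun,
          supOn_nonneg (Ioo (-1) 1) (fun x => (1 + x) ^ ε * deriv f.toFun x),
          supOn_nonneg (Ioo (-1) 1) (fun x => (1 + x) ^ (1 + ε) * deriv (deriv f.toFun) x)]
      apply Subtype.ext
      funext x
      change f.toFun x = 0
      by_cases hx : x ∈ Ioo (-1 : ℝ) 1
      · have := le_supOn f.mem.bdd0 hx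
        rw [h0] at this
        exact abs_nonpos_iff.mp this
      · by_cases hx' : x ∈ Ioc (-1 : ℝ) 1
        · rcases eq_or_lt_of_le hx'.2 with h2 | h2
          · rw [h2]
            exact f.mem.right
          · exact absurd ⟨hx'.1, h2⟩ hx
        · exact f.mem.zero_off x hx'
    · rintro rfl
      have h := fun x : ℝ => (rfl : (0 : M2 ε).toFun x = 0)
      have e : (0 : M2 ε).toFun = fun _ => 0 := funext h
      simp [M2.norm_def, e, supOn]

instance (ε : ℝ) : NormedAddCommGroup (M1 ε) := NormedAddCommGroup.ofCore (M1.core ε)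
instance (ε : ℝ) : NormedSpace ℝ (M1 ε) := NormedSpace.ofCore (M1.core ε)
instance (ε : ℝ) : NormedAddCommGroup (M2 ε) := NormedAddCommGroup.ofCore (M2.core ε)
instance (ε : ℝ) : NormedSpace ℝ (M2 ε) := NormedSpace.ofCore (M2.core ε)

/-- `X(ε) = M₁(ε) × M₂(ε)` with the norm `‖(f, g)‖ = ‖f‖ + ‖g‖`. -/
abbrev X (ε : ℝ) : Type := WithLp 1 (M1 ε × M2 ε)

/-- The vector function `x ↦ (V_θ(x), V_φ(x))` of an element of `X(ε)`. -/
def X.toFun {ε : ℝ} (v : X ε) (x : ℝ) : ℝ × ℝ := (v.fst.toFun x, v.snd.toFun x)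

/-- The functional `l₁(V) = V_θ(0)`. -/
def l1 (ε : ℝ) : X ε →ₗ[ℝ] ℝ where
  toFun v := (v.toFun 0).1
  map_add' _ _ := rfl
  map_smul' _ _ := rfl

/-- The functional `l₂(V) = V_φ(0)`. -/
def l2 (ε : ℝ) : X ε →ₗ[ℝ] ℝ where
  toFun v := (v.toFun 0).2
  map_add' _ _ := rfl
  map_smul' _ _ := rfl

/-- `X₁(ε) = ker l₁ ∩ ker l₂`, with the norm of `X(ε)`. -/
def X1 (ε : ℝ) : Submodule ℝ (X ε) := LinearMap.ker (l1 ε) ⊓ LinearMap.ker (l2 ε)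

/-! ### The no-swirl solutions and the kernel of the linearization -/

/-- `I₁`, the interior of the parameter set of the no-swirl solutions. -/
def I1 : Set (ℝ × ℝ) :=
  {p | -(1 / 2) < p.1 ∧ -1 - √(1 + 2 * p.1) < p.2}

/-- `U_θ^{μ,γ}` on `(-1,1]`, for `p = (μ,γ)` in `I₁`. -/
def noSwirl (p : ℝ × ℝ) (x : ℝ) : ℝ :=
  let b := √(1 + 2 * p.1)
  (1 - x) * (1 - b - 2 * b * (p.2 + 1 - b)
    / ((p.2 + 1 + b) * ((1 + x) / 2) ^ (-b) - p.2 - 1 + b))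

/-- `U_θ^{μ,γ}(-1)`, the limit as `x → -1⁺` (the formula itself has a negative power of
`0` at `x = -1`). -/
def noSwirlSouth (p : ℝ × ℝ) : ℝ := limUnder (𝓝[>] (-1 : ℝ)) (noSwirl p)

/-- `U^{μ,γ} = (U_θ^{μ,γ}, 0)`. -/
def baseFlow (p : ℝ × ℝ) (x : ℝ) : ℝ × ℝ := (noSwirl p x, 0)

/-- `a_{μ,γ}` on `(-1,1)`. -/
def aFun (p : ℝ × ℝ) (x : ℝ) : ℝ := ∫ s in (0 : ℝ)..x, (2 * s + noSwirl p s) / (1 - s ^ 2)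

/-- `b_{μ,γ}` on `(-1,1]`. -/
def bFun (p : ℝ × ℝ) (x : ℝ) : ℝ := ∫ s in (0 : ℝ)..x, noSwirl p s / (1 - s ^ 2)

open Classical in
/-- `V¹_{μ,γ} = (e^{-a}, 0)` on `(-1,1)`, with its limit `0` at `x = 1`, where `a = +∞`. -/
def V1 (p : ℝ × ℝ) (x : ℝ) : ℝ × ℝ :=
  (if x ∈ Ioo (-1 : ℝ) 1 then Real.exp (-aFun p x) else 0, 0)

/-- `V²_{μ,γ} = (0, ∫_x^1 e^{-b})` on `(-1,1]`. -/
def V2 (p : ℝ × ℝ) (x : ℝ) : ℝ × ℝ := (0, ∫ t in x..1, Real.exp (-bFun p t))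

/-! ### The reduced system -/

/-- `s ↦ 2 f(s) f'(s) / (1 - s²)`. -/
def psiIntegrand (f : ℝ → ℝ) (s : ℝ) : ℝ := 2 * f s * deriv f s / (1 - s ^ 2)

/-- `ψ[f](x) = ∫_x^1 ∫_l^1 ∫_t^1 2 f f' / (1 - s²) ds dt dl`. -/
def psi (f : ℝ → ℝ) (x : ℝ) : ℝ :=
  ∫ l in x..1, ∫ t in l..1, ∫ s in t..1, psiIntegrand f s

/-- The iterated integrals defining `ψ[f]` on `[-1,1]` converge. -/
def PsiConverges (f : ℝ → ℝ) : Prop :=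
  (∀ t ∈ Ioo (-1 : ℝ) 1, IntervalIntegrable (psiIntegrand f) volume t 1) ∧
    IntervalIntegrable (fun t => ∫ s in t..1, psiIntegrand f s) volume (-1) 1

/-- `U = (U_θ, U_φ)` is a classical solution on `(-1,1)` of the reduced system with constant
`m`. The triple integral is required to make sense. -/
structure IsSolution (U : ℝ → ℝ × ℝ) (m : ℝ) : Prop where
  c1 : ContDiffOn ℝ 1 (fun x => (U x).1) (Ioo (-1) 1)
  c2 : ContDiffOn ℝ 2 (fun x => (U x).2) (Ioo (-1) 1)
  integrable : ∀ t ∈ Ioo (-1 : ℝ) 1,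
    IntervalIntegrable (psiIntegrand fun x => (U x).2) volume t 1
  eq_theta : ∀ x ∈ Ioo (-1 : ℝ) 1,
    (1 - x ^ 2) * deriv (fun y => (U y).1) x + 2 * x * (U x).1 + (1 / 2) * (U x).1 ^ 2
      - psi (fun y => (U y).2) x = m * (1 - x) ^ 2
  eq_phi : ∀ x ∈ Ioo (-1 : ℝ) 1,
    (1 - x ^ 2) * deriv (deriv fun y => (U y).2) x + (U x).1 * deriv (fun y => (U y).2) x = 0

/-- `U^{μ,γ} + β₁ V¹_{μ,γ} + β₂ V²_{μ,γ} + v`. -/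
def ansatz {ε : ℝ} (p : ℝ × ℝ) (β : EuclideanSpace ℝ (Fin 2)) (v : X ε) (x : ℝ) : ℝ × ℝ :=
  baseFlow p x + β 0 • V1 p x + β 1 • V2 p x + v.toFun x

end SwirlNS

end

/-! The polar component is written as `U_θ = U^{μ,γ}_θ + (1-x)(1+x)^{1-ε} y`, where `y` is a bounded
continuous function on `(-1,1)`. The equation for `U_φ` is linear of first order in `U_φ'`, so with
`U_φ(1) = 0` it gives `U_φ = k ∫_x^1 exp(-b - ∫_0^t (1+s)^{-ε} y ds) dt`. The swirl is thus an
explicit function of `y` and of a scalar `k`, and `ψ[U_φ]` is `k²` times a smooth function of `y`.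

Write `w = U^{μ,γ}_θ/(1-x)`. The no-swirl equation is a Riccati equation for `w`. Subtracting it
from the polar equation and dividing by `(1-x)²(1+x)^{1-ε}` leaves `(1+x) y' = (ε - w) y + src`,
with `src` quadratic in `(k, y)` (`theta_identity`). The division by a power of `1+x` is possible
because `μ̂ = μ - ψ(-1)/4` cancels the value of the integral term at `-1`. Conversely, the decay of
the perturbation at `-1` forces this value of `μ̂` (`const_eq`).

The homogeneous equation has the solution `fund = (1+x)^ε e^{-b}`, of size `(1+x)^{ε+κ-1}` with `κ =
√(1+2μ)`. The hypothesis `U_θ(-1) < 2ε` says `1 - κ < ε`, so this exponent is positive and variation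
of constants based at `0` is a bounded operator (`IsEulerWeight.exists_solver`). The reduced system
becomes the fixed point equation `y = β₁ fund + S(src)` in a Banach algebra, with `β₁ = y(0)` and
with `k` normalised so that `U_φ(0)` is the value at `0` of `β₂ V²`.

All terms are analytic in `(μ, γ, β, y)`. For the solution operators this is a Neumann series
argument (`contDiffAt_euler_family`). At `β = 0` the derivative in `y` is the identity, so an
implicit function theorem with radii uniform over `K` (`exists_implicit_of_compact`) gives `y` as a
function of the parameters, together with local uniqueness.

It remains to return to the norm of `X`, which involves derivatives. The differential equation
expresses `y'` through `y`, so the second derivatives of the correction are again analytic in `y`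
(`corrData`). A fixed bounded linear map (`toX1`) integrates them twice. Every piece of these data
is of second order at `β = 0` (`flat_corrData`), so `V` and its first derivative vanish there. -/

open Set Filter Topology MeasureTheory
open scoped ContDiff

noncomputable section

namespace SwirlNS

/-! ### Implicit functions with radii uniform over a compact set of parameters. -/

section

/-- A parametrised implicit function theorem with a radius that is uniform over a compact set of
parameters. -/
theorem exists_implicit_of_compact {P B Y : Type*}
    [NormedAddCommGroup P] [NormedSpace ℝ P] [CompleteSpace P]
    [NormedAddCommGroup B] [NormedSpace ℝ B] [CompleteSpace B]
    [NormedAddCommGroup Y] [NormedSpace ℝ Y] [CompleteSpace Y]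
    {K : Set P} (hK : IsCompact K) (Φ : (P × B) × Y → Y)
    (hΦ : ∀ p ∈ K, ContDiffAt ℝ ω Φ ((p, 0), 0))
    (h0 : ∀ p ∈ K, Φ ((p, 0), 0) = 0)
    (hd : ∀ p ∈ K, HasFDerivAt (fun y => Φ ((p, 0), y)) (ContinuousLinearMap.id ℝ Y) 0) :
    ∃ δ > (0 : ℝ), ∃ r > (0 : ℝ), ∃ O : Set P, IsOpen O ∧ K ⊆ O ∧ ∃ F : P × B → Y,
      ContDiffOn ℝ ω F (O ×ˢ Metric.ball 0 δ) ∧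
      (∀ p ∈ O, ∀ β ∈ Metric.ball (0 : B) δ, Φ ((p, β), F (p, β)) = 0) ∧
      (∀ p ∈ O, ∀ β ∈ Metric.ball (0 : B) δ, ∀ y, ‖y‖ < r → Φ ((p, β), y) = 0 →
        y = F (p, β)) := by
  have hinv : ∀ p ∈ K, (fderiv ℝ Φ ((p, 0), 0) ∘L .inr ℝ (P × B) Y).IsInvertible := by
    intro p hp
    have hf : HasFDerivAt Φ (fderiv ℝ Φ ((p, 0), 0)) ((p, 0), 0) :=
      ((hΦ p hp).differentiableAt (by simp)).hasFDerivAt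
    have h2 : HasFDerivAt (fun y : Y => Φ ((p, 0), y))
        (fderiv ℝ Φ ((p, 0), 0) ∘L .inr ℝ (P × B) Y) 0 :=
      HasFDerivAt.comp (0 : Y) (g := Φ) (f := fun y => ((p, (0 : B)), y)) hf
        (hasFDerivAt_prodMk_right (p, (0 : B)) (0 : Y))
    rw [h2.unique (hd p hp)]
    exact ⟨ContinuousLinearEquiv.refl ℝ Y, rfl⟩
  have hloc : ∀ p ∈ K, ∃ φ : P × B → Y, (∀ᶠ q in 𝓝 (p, (0 : B)), ContDiffAt ℝ ω φ q) ∧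
      φ (p, 0) = 0 ∧ (∀ᶠ q in 𝓝 (p, (0 : B)), Φ (q, φ q) = 0) ∧
      ∀ᶠ v in 𝓝 ((p, (0 : B)), (0 : Y)), Φ v = 0 → v.2 = φ v.1 := by
    intro p hp
    have hn : (ω : WithTop ℕ∞) ≠ 0 := by simp
    refine ⟨(hΦ p hp).implicitFunction hn (hinv p hp), ?_, ?_, ?_, ?_⟩
    -- Regularity of order `ω` at a point passes to a neighbourhood, which fails in general for
    -- order `∞`; hence the use of `ω` throughout.
    · exact ((hΦ p hp).contDiffAt_implicitFunction hn (hinv p hp)).eventually (by simp)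
    · exact (hΦ p hp).implicitFunction_apply_self hn (hinv p hp)
    · have := (hΦ p hp).eventually_apply_implicitFunction hn (hinv p hp)
      simpa only [h0 p hp] using this
    · have := (hΦ p hp).eventually_apply_eq_iff_implicitFunction hn (hinv p hp)
      rw [h0 p hp] at this
      filter_upwards [this] with v hv h
      exact (hv.1 h).symm
  -- Two small zeros over the same parameters lie on the same local branch. Treating the pair `(y,
  -- y')` as a variable near `0`, the tube lemma along `K × {0}` yields one radius for all of `K`.
  have huniq : ∃ r > (0 : ℝ), ∃ O : Set P, IsOpen O ∧ K ⊆ O ∧ ∀ p ∈ O, ∀ β : B, ‖β‖ < r →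
      ∀ y y' : Y, ‖y‖ < r → ‖y'‖ < r → Φ ((p, β), y) = 0 → Φ ((p, β), y') = 0 → y = y' := by
    let Q : P × (B × Y × Y) → Prop := fun v =>
      Φ ((v.1, v.2.1), v.2.2.1) = 0 → Φ ((v.1, v.2.1), v.2.2.2) = 0 → v.2.2.1 = v.2.2.2
    have hQ : ∀ p ∈ K, ∀ᶠ v in 𝓝 (p, (0 : B × Y × Y)), Q v := by
      intro p hp
      obtain ⟨φ, -, -, -, h⟩ := hloc p hp
      have t1 : Tendsto (fun v : P × (B × Y × Y) => ((v.1, v.2.1), v.2.2.1))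
          (𝓝 (p, 0)) (𝓝 ((p, 0), 0)) :=
        (Continuous.tendsto (by fun_prop) _)
      have t2 : Tendsto (fun v : P × (B × Y × Y) => ((v.1, v.2.1), v.2.2.2))
          (𝓝 (p, 0)) (𝓝 ((p, 0), 0)) :=
        (Continuous.tendsto (by fun_prop) _)
      filter_upwards [t1.eventually h, t2.eventually h] with v h1 h2 e1 e2
      exact (h1 e1).trans (h2 e2).symm
    obtain ⟨u, v, hu, hv, hKu, h0v, huv⟩ := generalized_tube_lemma hK
      (t := {(0 : B × Y × Y)}) isCompact_singleton (n := interior {v | Q v}) isOpen_interior (by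
        rintro ⟨p, q⟩ ⟨hp, hq⟩
        obtain rfl : q = 0 := hq
        exact mem_interior_iff_mem_nhds.2 (hQ p hp))
    obtain ⟨r, hr, hb⟩ := Metric.isOpen_iff.1 hv 0 (h0v rfl)
    refine ⟨r, hr, u, hu, hKu, fun p hp β hβ y y' hy hy' e1 e2 => ?_⟩
    have : (p, (β, y, y')) ∈ u ×ˢ v := ⟨hp, hb (by
      simp only [mem_ball_zero_iff, Prod.norm_def, sup_lt_iff]
      exact ⟨hβ, hy, hy'⟩)⟩
    exact interior_subset (huv this) e1 e2
  obtain ⟨r, hr, O₁, hO₁, hKO₁, huniq⟩ := huniq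
  -- The bound `r` is recorded with each branch so that the uniqueness above makes different
  -- branches agree.
  let R : P × B → Prop := fun q => ∃ φ : P × B → Y, ContDiffAt ℝ ω φ q ∧
    ∀ᶠ q' in 𝓝 q, Φ (q', φ q') = 0 ∧ ‖φ q'‖ < r
  have hR : ∀ p ∈ K, ∀ᶠ q in 𝓝 (p, (0 : B)), R q := by
    intro p hp
    obtain ⟨φ, h1, h2, h3, -⟩ := hloc p hp
    have hc : ContinuousAt φ (p, 0) := h1.self_of_nhds.continuousAt
    have h4 : ∀ᶠ q in 𝓝 (p, (0 : B)), ‖φ q‖ < r :=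
      hc.norm.eventually_lt continuousAt_const (by simpa [h2] using hr)
    filter_upwards [h1, (h3.and h4).eventually_nhds] with q hq1 hq2
    exact ⟨φ, hq1, hq2⟩
  obtain ⟨u, v, hu, hv, hKu, h0v, huv⟩ := generalized_tube_lemma hK
    (t := {(0 : B)}) isCompact_singleton (n := interior {v | R v}) isOpen_interior (by
      rintro ⟨p, q⟩ ⟨hp, hq⟩
      obtain rfl : q = 0 := hq
      exact mem_interior_iff_mem_nhds.2 (hR p hp))
  obtain ⟨δ, hδ, hb⟩ := Metric.isOpen_iff.1 hv 0 (h0v rfl)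
  have key : ∀ q ∈ (u ∩ O₁) ×ˢ Metric.ball (0 : B) (min δ r), R q := by
    rintro ⟨p, β⟩ ⟨hp, hβ⟩
    have : (p, β) ∈ {v | R v} := interior_subset (huv ⟨hp.1, hb (Metric.ball_subset_ball (min_le_left _ _) hβ)⟩)
    exact this
  have hex : ∀ q : P × B, ∃ y : Y, q ∈ (u ∩ O₁) ×ˢ Metric.ball (0 : B) (min δ r) →
      Φ (q, y) = 0 ∧ ‖y‖ < r := by
    intro q
    by_cases hq : q ∈ (u ∩ O₁) ×ˢ Metric.ball (0 : B) (min δ r)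
    · obtain ⟨φ, -, h⟩ := key q hq
      exact ⟨φ q, fun _ => h.self_of_nhds⟩
    · exact ⟨0, fun h => absurd h hq⟩
  -- The choice is made pointwise with no regularity. Uniqueness then identifies `F` near each point
  -- with an analytic branch.
  choose F hF using hex
  have hun : ∀ q ∈ (u ∩ O₁) ×ˢ Metric.ball (0 : B) (min δ r), ∀ y, ‖y‖ < r → Φ (q, y) = 0 →
      y = F q := by
    rintro ⟨p, β⟩ hq y hy e
    exact huniq p hq.1.2 β ((mem_ball_zero_iff.1 hq.2).trans_le (min_le_right _ _)) _ _ hy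
      (hF _ hq).2 e (hF _ hq).1
  have hopen : IsOpen ((u ∩ O₁) ×ˢ Metric.ball (0 : B) (min δ r)) :=
    (hu.inter hO₁).prod Metric.isOpen_ball
  refine ⟨min δ r, lt_min hδ hr, r, hr, u ∩ O₁, hu.inter hO₁, subset_inter hKu hKO₁, F, ?_,
    fun p hp β hβ => (hF (p, β) ⟨hp, hβ⟩).1, fun p hp β hβ y hy e => hun (p, β) ⟨hp, hβ⟩ y hy e⟩
  intro q hq
  obtain ⟨φ, h1, h2⟩ := key q hq
  refine (h1.congr_of_eventuallyEq ?_).contDiffWithinAt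
  filter_upwards [h2, hopen.mem_nhds hq] with q' h h'
  exact (hun q' h' _ h.2 h.1).symm

end

/-! ### Weighted calculus on the interval `(-1,1)`. -/

section

/-! ### Bounded continuous functions on `(-1,1)` -/

/-- The Banach algebra of bounded continuous functions on `(-1,1)`; a type of its own, so that
its linear structure is always the one that comes from the algebra. -/
def BC : Type := BoundedContinuousFunction (Ioo (-1 : ℝ) 1) ℝ

instance : NormedCommRing BC :=
  inferInstanceAs (NormedCommRing (BoundedContinuousFunction (Ioo (-1 : ℝ) 1) ℝ))

instance : NormedAlgebra ℝ BC :=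
  inferInstanceAs (NormedAlgebra ℝ (BoundedContinuousFunction (Ioo (-1 : ℝ) 1) ℝ))

instance : CompleteSpace BC :=
  inferInstanceAs (CompleteSpace (BoundedContinuousFunction (Ioo (-1 : ℝ) 1) ℝ))

/-- The function underlying an element of `BC`. -/
def BC.toBCF (u : BC) : BoundedContinuousFunction (Ioo (-1 : ℝ) 1) ℝ := u

open Classical in
/-- Extension by zero of an element of `BC` to the real line. -/
def BC.ext (u : BC) (x : ℝ) : ℝ := if h : x ∈ Ioo (-1 : ℝ) 1 then u.toBCF ⟨x, h⟩ else 0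

namespace BC

theorem ext_of_mem (u : BC) {x : ℝ} (h : x ∈ Ioo (-1 : ℝ) 1) : u.ext x = u.toBCF ⟨x, h⟩ :=
  dif_pos h

theorem ext_of_notMem (u : BC) {x : ℝ} (h : x ∉ Ioo (-1 : ℝ) 1) : u.ext x = 0 := dif_neg h

theorem continuousOn_ext (u : BC) : ContinuousOn u.ext (Ioo (-1) 1) := by
  rw [continuousOn_iff_continuous_domRestrict]
  convert u.toBCF.continuous using 1
  funext x
  exact u.ext_of_mem x.2

theorem abs_ext_le (u : BC) (x : ℝ) : |u.ext x| ≤ ‖u‖ := by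
  by_cases h : x ∈ Ioo (-1 : ℝ) 1
  · rw [u.ext_of_mem h]
    exact u.toBCF.norm_coe_le_norm _
  · rw [u.ext_of_notMem h, abs_zero]
    exact norm_nonneg u

theorem norm_le_of {u : BC} {C : ℝ} (hC : 0 ≤ C) (h : ∀ x ∈ Ioo (-1 : ℝ) 1, |u.ext x| ≤ C) :
    ‖u‖ ≤ C :=
  (BoundedContinuousFunction.norm_le (f := u.toBCF) hC).2 fun x => by
    have := h x x.2
    rwa [u.ext_of_mem x.2] at this

theorem ext_inj {u v : BC} (h : ∀ x ∈ Ioo (-1 : ℝ) 1, u.ext x = v.ext x) : u = v := by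
  refine BoundedContinuousFunction.ext (f := u.toBCF) (g := v.toBCF) fun x => ?_
  have := h x x.2
  rwa [u.ext_of_mem x.2, v.ext_of_mem x.2] at this

theorem ext_add (u v : BC) (x : ℝ) : (u + v).ext x = u.ext x + v.ext x := by
  unfold ext; split_ifs
  · rfl
  · simp

theorem ext_sub (u v : BC) (x : ℝ) : (u - v).ext x = u.ext x - v.ext x := by
  unfold ext; split_ifs
  · rfl
  · simp

theorem ext_neg (u : BC) (x : ℝ) : (-u).ext x = -u.ext x := by
  unfold ext; split_ifs
  · rfl
  · simp

theorem ext_mul (u v : BC) (x : ℝ) : (u * v).ext x = u.ext x * v.ext x := by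
  unfold ext; split_ifs
  · rfl
  · simp

theorem ext_smul (c : ℝ) (u : BC) (x : ℝ) : (c • u).ext x = c * u.ext x := by
  unfold ext; split_ifs
  · rfl
  · simp

theorem ext_zero (x : ℝ) : (0 : BC).ext x = 0 := by
  unfold ext; split_ifs
  · rfl
  · rfl

theorem ext_one {x : ℝ} (h : x ∈ Ioo (-1 : ℝ) 1) : (1 : BC).ext x = 1 := by
  rw [ext_of_mem _ h]; rfl

/-- Evaluation at a point of `(-1,1)` as a continuous algebra homomorphism. -/
def evalAlgHom (x : Ioo (-1 : ℝ) 1) : BC →A[ℝ] ℝ where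
  toFun u := u.toBCF x
  map_one' := rfl
  map_mul' _ _ := rfl
  map_zero' := rfl
  map_add' _ _ := rfl
  commutes' _ := rfl
  cont := (BoundedContinuousFunction.evalCLM ℝ x).continuous

/-- Evaluation at a point is a continuous algebra homomorphism, hence commutes with the exponential
series. -/
theorem ext_exp (u : BC) {x : ℝ} (h : x ∈ Ioo (-1 : ℝ) 1) :
    (NormedSpace.exp u).ext x = Real.exp (u.ext x) := by
  rw [ext_of_mem _ h, ext_of_mem _ h, Real.exp_eq_exp_ℝ]
  let := NormedAlgebra.restrictScalars ℚ ℝ BC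
  exact NormedSpace.map_exp (evalAlgHom ⟨x, h⟩) (evalAlgHom ⟨x, h⟩).cont u

/-- Evaluation at the origin as a continuous linear functional. -/
def evalZero : BC →L[ℝ] ℝ where
  toLinearMap := (evalAlgHom ⟨0, by norm_num⟩).toAlgHom.toLinearMap
  cont := (evalAlgHom ⟨0, by norm_num⟩).cont

theorem evalZero_apply (u : BC) : evalZero u = u.ext 0 :=
  (ext_of_mem u (by norm_num : (0 : ℝ) ∈ Ioo (-1 : ℝ) 1)).symm

open Classical in
/-- The restriction to `(-1,1)` of a function that is continuous and bounded there (and `0` for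
other functions). -/
def ofFun (f : ℝ → ℝ) : BC :=
  if h : ∃ u : BC, ∀ x ∈ Ioo (-1 : ℝ) 1, u.ext x = f x then h.choose else 0

theorem ext_ofFun {f : ℝ → ℝ} (hc : ContinuousOn f (Ioo (-1) 1)) (hb : BddOn (Ioo (-1) 1) f)
    {x : ℝ} (hx : x ∈ Ioo (-1 : ℝ) 1) : (ofFun f).ext x = f x := by
  have h : ∃ u : BC, ∀ x ∈ Ioo (-1 : ℝ) 1, u.ext x = f x := by
    obtain ⟨C, hC⟩ := hb
    refine ⟨BoundedContinuousFunction.ofNormedAddCommGroup ((Ioo (-1 : ℝ) 1).domRestrict f)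
      (continuousOn_iff_continuous_domRestrict.1 hc) C fun x => hC x x.2, fun y hy => ?_⟩
    exact (ext_of_mem _ hy).trans rfl
  rw [ofFun, dif_pos h]
  exact h.choose_spec x hx

/-- A linear operator on `BC` given by its values. -/
theorem exists_clm (T : BC → ℝ → ℝ) (C : ℝ)
    (hadd : ∀ u v, ∀ x ∈ Ioo (-1 : ℝ) 1, T (u + v) x = T u x + T v x)
    (hsmul : ∀ (c : ℝ) u, ∀ x ∈ Ioo (-1 : ℝ) 1, T (c • u) x = c * T u x)
    (hcont : ∀ u, ContinuousOn (T u) (Ioo (-1) 1))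
    (hb : ∀ u, ∀ x ∈ Ioo (-1 : ℝ) 1, |T u x| ≤ C * ‖u‖) :
    ∃ L : BC →L[ℝ] BC, ∀ u, ∀ x ∈ Ioo (-1 : ℝ) 1, (L u).ext x = T u x := by
  have e : ∀ u, ∀ x ∈ Ioo (-1 : ℝ) 1, (ofFun (T u)).ext x = T u x := fun u x hx =>
    ext_ofFun (hcont u) ⟨_, hb u⟩ hx
  let L : BC →ₗ[ℝ] BC :=
    { toFun := fun u => ofFun (T u)
      map_add' := fun u v => ext_inj fun x hx => by
        rw [ext_add, e _ x hx, e _ x hx, e _ x hx, hadd u v x hx]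
      map_smul' := fun c u => ext_inj fun x hx => by
        rw [RingHom.id_apply, ext_smul, e _ x hx, e _ x hx, hsmul c u x hx] }
  refine ⟨L.mkContinuous C fun u => ?_, fun u x hx => e u x hx⟩
  refine norm_le_of ((abs_nonneg _).trans (hb u 0 (by norm_num))) fun x hx => ?_
  rw [show (L u).ext x = T u x from e u x hx]
  exact hb u x hx

open Classical in
/-- The continuous linear operator on `BC` with the given values, if it exists. -/
def opOf (T : BC → ℝ → ℝ) : BC →L[ℝ] BC :=
  if h : ∃ L : BC →L[ℝ] BC, ∀ u, ∀ x ∈ Ioo (-1 : ℝ) 1, (L u).ext x = T u x then h.choose else 0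

theorem opOf_ext {T : BC → ℝ → ℝ}
    (h : ∃ L : BC →L[ℝ] BC, ∀ u, ∀ x ∈ Ioo (-1 : ℝ) 1, (L u).ext x = T u x) (u : BC) {x : ℝ}
    (hx : x ∈ Ioo (-1 : ℝ) 1) : (opOf T u).ext x = T u x := by
  rw [opOf, dif_pos h]
  exact h.choose_spec u x hx

end BC

/-! ### The Euler derivative `(1 + x) d/dx` -/

/-- `v = (1 + x) u'` on `(-1,1)`. -/
def HasEuler (u v : BC) : Prop :=
  ∀ x ∈ Ioo (-1 : ℝ) 1, HasDerivAt u.ext (v.ext x / (1 + x)) x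

namespace HasEuler

theorem add {u v u' v' : BC} (hu : HasEuler u u') (hv : HasEuler v v') :
    HasEuler (u + v) (u' + v') := fun x hx => by
  have := (hu x hx).add (hv x hx)
  rw [BC.ext_add, add_div]
  exact this.congr_of_eventuallyEq (Eventually.of_forall fun y => BC.ext_add u v y)

theorem smul {u u' : BC} (c : ℝ) (hu : HasEuler u u') : HasEuler (c • u) (c • u') := fun x hx => by
  have := (hu x hx).const_mul c
  rw [BC.ext_smul, mul_div_assoc]
  exact this.congr_of_eventuallyEq (Eventually.of_forall fun y => BC.ext_smul c u y)

theorem neg {u u' : BC} (hu : HasEuler u u') : HasEuler (-u) (-u') := fun x hx => by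
  have := (hu x hx).neg
  rw [BC.ext_neg, neg_div]
  exact this.congr_of_eventuallyEq (Eventually.of_forall fun y => BC.ext_neg u y)

theorem sub {u v u' v' : BC} (hu : HasEuler u u') (hv : HasEuler v v') :
    HasEuler (u - v) (u' - v') := by
  simpa [sub_eq_add_neg] using hu.add hv.neg

theorem mul {u v u' v' : BC} (hu : HasEuler u u') (hv : HasEuler v v') :
    HasEuler (u * v) (u' * v + u * v') := fun x hx => by
  have := (hu x hx).mul (hv x hx)
  refine (this.congr_of_eventuallyEq (Eventually.of_forall fun y => BC.ext_mul u v y)).congr_deriv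
    ?_
  rw [BC.ext_add, BC.ext_mul, BC.ext_mul]
  ring

theorem congr {u v v' : BC} (hu : HasEuler u v) (h : v = v') : HasEuler u v' := h ▸ hu

theorem of_hasDerivAt {f f' : ℝ → ℝ} {u u' : BC} (hf : ∀ x ∈ Ioo (-1 : ℝ) 1, u.ext x = f x)
    (hf' : ∀ x ∈ Ioo (-1 : ℝ) 1, u'.ext x = (1 + x) * f' x)
    (h : ∀ x ∈ Ioo (-1 : ℝ) 1, HasDerivAt f (f' x) x) : HasEuler u u' := fun x hx => by
  have h1 : 1 + x ≠ 0 := by linarith [hx.1]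
  rw [hf' x hx, mul_div_cancel_left₀ _ h1]
  refine (h x hx).congr_of_eventuallyEq ?_
  filter_upwards [isOpen_Ioo.mem_nhds hx] with y hy using hf y hy

end HasEuler

/-! ### Integrals of functions with an integrable singularity at `-1` -/

theorem intervalIntegrable_of_le {f g : ℝ → ℝ} {a b : ℝ} (hab : a ≤ b) (ha : -1 ≤ a) (hb : b ≤ 1)
    (hf : ContinuousOn f (Ioo (-1) 1)) (hg : IntervalIntegrable g volume a b)
    (h : ∀ x ∈ Ioo a b, |f x| ≤ g x) : IntervalIntegrable f volume a b := by
  rw [intervalIntegrable_iff_integrableOn_Ioo_of_le hab] at hg ⊢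
  have hs : Ioo a b ⊆ Ioo (-1 : ℝ) 1 := Ioo_subset_Ioo ha hb
  refine Integrable.mono' hg ((hf.mono hs).aestronglyMeasurable measurableSet_Ioo) ?_
  filter_upwards [ae_restrict_mem measurableSet_Ioo] with x hx using h x hx

theorem abs_integral_le_of_le {f g : ℝ → ℝ} {a b : ℝ} (hab : a ≤ b)
    (hg : IntervalIntegrable g volume a b)
    (h : ∀ x ∈ Ioo a b, |f x| ≤ g x) : |∫ x in a..b, f x| ≤ ∫ x in a..b, g x := by
  rw [← Real.norm_eq_abs]
  refine intervalIntegral.norm_integral_le_of_norm_le hab ?_ hg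
  have h1 : ∀ᵐ x : ℝ, x ≠ b := by simp [ae_iff]
  filter_upwards [h1] with x hx1 hx
  exact h x ⟨hx.1, lt_of_le_of_ne hx.2 hx1⟩

theorem integral_congr_Ioo {f g : ℝ → ℝ} {a b : ℝ} (hab : a ≤ b)
    (h : ∀ x ∈ Ioo a b, f x = g x) : ∫ x in a..b, f x = ∫ x in a..b, g x := by
  refine intervalIntegral.integral_congr_ae ?_
  have h1 : ∀ᵐ x : ℝ, x ≠ b := by simp [ae_iff]
  filter_upwards [h1] with x hx1 hx
  rw [uIoc_of_le hab] at hx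
  exact h x ⟨hx.1, lt_of_le_of_ne hx.2 hx1⟩

theorem hasDerivAt_integral_right {f : ℝ → ℝ} (hf : ContinuousOn f (Ioo (-1) 1)) {a x : ℝ}
    (hx : x ∈ Ioo (-1 : ℝ) 1) (hi : IntervalIntegrable f volume a x) :
    HasDerivAt (fun y => ∫ s in a..y, f s) (f x) x :=
  intervalIntegral.integral_hasDerivAt_right hi
    (hf.stronglyMeasurableAtFilter isOpen_Ioo x hx) (hf.continuousAt (isOpen_Ioo.mem_nhds hx))

theorem hasDerivAt_integral_left {f : ℝ → ℝ} (hf : ContinuousOn f (Ioo (-1) 1)) {b x : ℝ}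
    (hx : x ∈ Ioo (-1 : ℝ) 1) (hi : IntervalIntegrable f volume x b) :
    HasDerivAt (fun y => ∫ s in y..b, f s) (-f x) x :=
  intervalIntegral.integral_hasDerivAt_left hi
    (hf.stronglyMeasurableAtFilter isOpen_Ioo x hx) (hf.continuousAt (isOpen_Ioo.mem_nhds hx))

theorem intervalIntegrable_of_Ioo {f : ℝ → ℝ} (hf : ContinuousOn f (Ioo (-1) 1)) {a b : ℝ}
    (ha : a ∈ Ioo (-1 : ℝ) 1) (hb : b ∈ Ioo (-1 : ℝ) 1) : IntervalIntegrable f volume a b :=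
  (hf.mono (Set.OrdConnected.uIcc_subset ordConnected_Ioo ha hb)).intervalIntegrable

theorem continuousOn_one_add_rpow (a : ℝ) : ContinuousOn (fun x : ℝ => (1 + x) ^ a) (Ioi (-1)) :=
  ContinuousOn.rpow_const (by fun_prop) fun x hx => Or.inl (by
    have : -1 < x := hx
    linarith)

theorem hasDerivAt_one_add_rpow (a : ℝ) {x : ℝ} (hx : -1 < x) :
    HasDerivAt (fun x : ℝ => (1 + x) ^ a) (a * (1 + x) ^ (a - 1)) x := by
  have h := ((hasDerivAt_id x).const_add 1).rpow_const (p := a) (Or.inl (by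
    have : (1 : ℝ) + x ≠ 0 := by linarith
    exact this))
  simpa using h

theorem intervalIntegrable_one_add_rpow {a : ℝ} (ha : -1 < a) (u v : ℝ) :
    IntervalIntegrable (fun x : ℝ => (1 + x) ^ a) volume u v := by
  have h := (intervalIntegral.intervalIntegrable_rpow' (a := 1 + u) (b := 1 + v) ha).comp_add_left 1
  simpa using h

theorem integral_one_add_rpow {a : ℝ} (ha : -1 < a) (u v : ℝ) :
    ∫ x in u..v, (1 + x) ^ a = ((1 + v) ^ (a + 1) - (1 + u) ^ (a + 1)) / (a + 1) := by
  rw [intervalIntegral.integral_comp_add_left (fun y => y ^ a) 1, integral_rpow (Or.inl ha)]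

theorem integral_one_add_rpow_of_ne {a u v : ℝ} (ha : a ≠ -1) (hu : -1 < u) (hv : -1 < v) :
    ∫ x in u..v, (1 + x) ^ a = ((1 + v) ^ (a + 1) - (1 + u) ^ (a + 1)) / (a + 1) := by
  rw [intervalIntegral.integral_comp_add_left (fun y => y ^ a) 1, integral_rpow (Or.inr ⟨ha, ?_⟩)]
  intro h
  have h1 := h.1
  have : 0 < min (1 + u) (1 + v) := lt_min (by linarith) (by linarith)
  linarith

end

/-! ### Linear equations of Euler type and analytic dependence on their coefficients. -/

section

theorem eq_apply_zero_of_hasDerivAt_zero {f : ℝ → ℝ}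
    (h : ∀ x ∈ Ioo (-1 : ℝ) 1, HasDerivAt f 0 x) {x : ℝ} (hx : x ∈ Ioo (-1 : ℝ) 1) :
    f x = f 0 :=
  isOpen_Ioo.is_const_of_deriv_eq_zero isPreconnected_Ioo
    (fun y hy => (h y hy).differentiableAt.differentiableWithinAt) (fun y hy => (h y hy).deriv) hx
    (by norm_num)

theorem zero_mem_Ioo : (0 : ℝ) ∈ Ioo (-1 : ℝ) 1 := by norm_num

/-- The integral of `(1+s)^{-1-a}` from `0` to `x` has absolute value `|1 - (1+x)^{-a}| / a`; the
sum in the bound serves both signs of `x`. -/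
theorem abs_integral_zero_le {f : ℝ → ℝ} {a C : ℝ} (ha : 0 < a)
    (h : ∀ s ∈ Ioo (-1 : ℝ) 1, |f s| ≤ C * (1 + s) ^ (-1 - a)) {x : ℝ}
    (hx : x ∈ Ioo (-1 : ℝ) 1) :
    |∫ s in (0 : ℝ)..x, f s| ≤ C / a * (1 + (1 + x) ^ (-a)) := by
  have hx1 : 0 < 1 + x := by linarith [hx.1]
  have hC : 0 ≤ C := by simpa using (abs_nonneg _).trans (h 0 zero_mem_Ioo)
  have hi : IntervalIntegrable (fun s : ℝ => C * (1 + s) ^ (-1 - a)) volume 0 x :=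
    intervalIntegrable_of_Ioo (continuousOn_const.mul
      ((continuousOn_one_add_rpow _).mono Ioo_subset_Ioi_self)) zero_mem_Ioo hx
  have h1 := intervalIntegral.norm_integral_le_abs_of_norm_le (f := f) (μ := volume)
    (g := fun s : ℝ => C * (1 + s) ^ (-1 - a)) (a := 0) (b := x) (by
      filter_upwards [ae_restrict_mem measurableSet_uIoc] with s hs
      exact h s (Set.OrdConnected.uIcc_subset ordConnected_Ioo zero_mem_Ioo hx
        (uIoc_subset_uIcc hs))) hi
  rw [Real.norm_eq_abs, intervalIntegral.integral_const_mul,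
    integral_one_add_rpow_of_ne (by linarith) (by norm_num) hx.1] at h1
  refine h1.trans ?_
  have e : (-1 - a + 1) = -a := by ring
  rw [e, add_zero, Real.one_rpow, abs_mul, abs_of_nonneg hC, abs_div, abs_neg, abs_of_pos ha,
    div_mul_eq_mul_div, mul_div_assoc]
  gcongr
  have hp := Real.rpow_pos_of_pos hx1 (-a)
  rw [abs_le]
  constructor <;> linarith

/-! ### First order linear equations of Euler type -/

/-- `W` is comparable to a positive power of `1 + x`. -/
def IsEulerWeight (W : BC) : Prop :=
  ∃ σ m M : ℝ, 0 < σ ∧ 0 < m ∧ ∀ x ∈ Ioo (-1 : ℝ) 1,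
    m * (1 + x) ^ σ ≤ W.ext x ∧ W.ext x ≤ M * (1 + x) ^ σ

theorem IsEulerWeight.pos {W : BC} (h : IsEulerWeight W) {x : ℝ} (hx : x ∈ Ioo (-1 : ℝ) 1) :
    0 < W.ext x := by
  obtain ⟨σ, m, M, -, hm, h⟩ := h
  exact (mul_pos hm (Real.rpow_pos_of_pos (by linarith [hx.1]) _)).trans_le (h x hx).1

theorem IsEulerWeight.continuousOn {W : BC} (h : IsEulerWeight W) (z : BC) :
    ContinuousOn (fun s => z.ext s / (W.ext s * (1 + s))) (Ioo (-1) 1) :=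
  z.continuousOn_ext.div (W.continuousOn_ext.mul (by fun_prop)) fun s hs =>
    (mul_pos (h.pos hs) (by linarith [hs.1])).ne'

/-- The integral may grow like `(1+x)^{-σ}` at `-1`, and the factor `W`, of size `(1+x)^σ`,
compensates this exactly. Since `σ > 0`, the base point can be the interior point `0`, and no
condition on `z` at `-1` is needed. -/
theorem IsEulerWeight.exists_solver {W : BC} (h : IsEulerWeight W) :
    ∃ S : BC →L[ℝ] BC, ∀ z, ∀ x ∈ Ioo (-1 : ℝ) 1,
      (S z).ext x = W.ext x * ∫ s in (0 : ℝ)..x, z.ext s / (W.ext s * (1 + s)) := by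
  obtain ⟨σ, m, M, hσ, hm, hW⟩ := id h
  have hint : ∀ z : BC, ∀ x ∈ Ioo (-1 : ℝ) 1,
      IntervalIntegrable (fun s => z.ext s / (W.ext s * (1 + s))) volume 0 x := fun z x hx =>
    intervalIntegrable_of_Ioo (h.continuousOn z) zero_mem_Ioo hx
  refine BC.exists_clm _ (M / m / σ * (2 ^ σ + 1)) ?_ ?_ ?_ ?_
  · intro u v x hx
    rw [← mul_add, ← intervalIntegral.integral_add (hint u x hx) (hint v x hx)]
    simp only [BC.ext_add, add_div]
  · intro c u x hx
    rw [mul_left_comm]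
    simp only [BC.ext_smul, mul_div_assoc, intervalIntegral.integral_const_mul]
  · intro u
    refine W.continuousOn_ext.mul fun x hx => ?_
    exact (hasDerivAt_integral_right (h.continuousOn u) hx
      (hint u x hx)).continuousAt.continuousWithinAt
  · intro u x hx
    have hx1 : 0 < 1 + x := by linarith [hx.1]
    have hp := Real.rpow_pos_of_pos hx1 σ
    have hMpos : 0 < M := by
      have := (h.pos hx).trans_le (hW x hx).2
      exact (pos_iff_pos_of_mul_pos this).2 hp
    have h1 := abs_integral_zero_le (f := fun s => u.ext s / (W.ext s * (1 + s))) (C := ‖u‖ / m)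
      hσ (fun s hs => by
        have hs1 : 0 < 1 + s := by linarith [hs.1]
        have hps := Real.rpow_pos_of_pos hs1 σ
        rw [abs_div, abs_of_pos (mul_pos (h.pos hs) hs1),
          show -1 - σ = -(σ + 1) by ring, Real.rpow_neg hs1.le, Real.rpow_add hs1, Real.rpow_one,
          ← div_eq_mul_inv, div_div]
        have := (hW s hs).1
        rw [← mul_assoc]
        gcongr
        exact u.abs_ext_le s) hx
    rw [abs_mul, abs_of_pos (h.pos hx)]
    calc _ ≤ M * (1 + x) ^ σ * (‖u‖ / m / σ * (1 + (1 + x) ^ (-σ))) := by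
          have h2 := (hW x hx).2
          gcongr
      _ = M / m / σ * ‖u‖ * ((1 + x) ^ σ + 1) := by
          rw [Real.rpow_neg hx1.le]
          field_simp
      _ ≤ M / m / σ * ‖u‖ * (2 ^ σ + 1) := by
          gcongr
          linarith [hx.2]
      _ = _ := by ring

/-- The solution operator of `(1 + x) y' = a y + z`, `y(0) = 0`, if `W` is an Euler weight with
`(1 + x) W' = a W`. -/
def eulerSolver (W : BC) : BC →L[ℝ] BC :=
  BC.opOf fun z x => W.ext x * ∫ s in (0 : ℝ)..x, z.ext s / (W.ext s * (1 + s))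

theorem eulerSolver_ext {W : BC} (h : IsEulerWeight W) (z : BC) {x : ℝ}
    (hx : x ∈ Ioo (-1 : ℝ) 1) :
    (eulerSolver W z).ext x = W.ext x * ∫ s in (0 : ℝ)..x, z.ext s / (W.ext s * (1 + s)) :=
  BC.opOf_ext h.exists_solver z hx

theorem eulerSolver_ext_zero {W : BC} (h : IsEulerWeight W) (z : BC) :
    (eulerSolver W z).ext 0 = 0 := by
  rw [eulerSolver_ext h z zero_mem_Ioo, intervalIntegral.integral_same, mul_zero]

theorem eulerSolver_hasEuler {a W : BC} (h : IsEulerWeight W) (hW : HasEuler W (a * W)) (z : BC) :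
    HasEuler (eulerSolver W z) (a * eulerSolver W z + z) := fun x hx => by
  have hx1 : 0 < 1 + x := by linarith [hx.1]
  have h1 := (hW x hx).mul (hasDerivAt_integral_right (h.continuousOn z) hx
    (intervalIntegrable_of_Ioo (h.continuousOn z) zero_mem_Ioo hx))
  refine (h1.congr_of_eventuallyEq ?_).congr_deriv ?_
  · filter_upwards [isOpen_Ioo.mem_nhds hx] with y hy using eulerSolver_ext h z hy
  · have := (h.pos hx).ne'
    rw [BC.ext_add, BC.ext_mul, BC.ext_mul, eulerSolver_ext h z hx]
    field_simp

/-- Uniqueness in variation of constants: the difference of two solutions divided by `W` has zero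
derivative, so a solution is fixed by its value at `0`. -/
theorem eq_eulerSolver {a W y z : BC} (h : IsEulerWeight W) (hW : HasEuler W (a * W))
    (h0 : W.ext 0 = 1) (hy : HasEuler y (a * y + z)) :
    y = y.ext 0 • W + eulerSolver W z := by
  have h1 := hy.sub (eulerSolver_hasEuler h hW z)
  set v := y - eulerSolver W z with hv
  have h2 : HasEuler v (a * v) := h1.congr (by rw [hv]; ring)
  have h3 : ∀ x ∈ Ioo (-1 : ℝ) 1, HasDerivAt (fun x => v.ext x / W.ext x) 0 x := fun x hx => by
    have hx1 : 0 < 1 + x := by linarith [hx.1]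
    have hp := (h.pos hx).ne'
    refine ((h2 x hx).div (hW x hx) hp).congr_deriv ?_
    rw [BC.ext_mul, BC.ext_mul]
    field_simp
    ring
  refine BC.ext_inj fun x hx => ?_
  have h4 := eq_apply_zero_of_hasDerivAt_zero h3 hx
  simp only [h0, div_one] at h4
  rw [div_eq_iff (h.pos hx).ne', hv, BC.ext_sub, BC.ext_sub, eulerSolver_ext_zero h] at h4
  rw [BC.ext_add, BC.ext_smul]
  linarith

section Family

variable {P : Type*} [NormedAddCommGroup P] [NormedSpace ℝ P] {O : Set P} {a W : P → BC}

/-- Multiplication operators on `BC`. -/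
def mulOp : BC →L[ℝ] BC →L[ℝ] BC := ContinuousLinearMap.mul ℝ BC

theorem mulOp_apply (u v : BC) : mulOp u v = u * v := rfl

/-- A resolvent argument. The equation at `q` is the equation at `p` with the extra source `(a q - a
p) W q`, so `W q = W p + S((a q - a p) W q)` with `S` the solver at `p`. Hence `W q` and the solver
at `q` arise by applying the inverse of `T q = 1 - S ∘ (a q - a p)`. This operator is close to `1`,
and inversion is analytic at units. Only analyticity of the coefficient `a` is needed. -/
theorem contDiffAt_euler_family (hO : IsOpen O) (hw : ∀ p ∈ O, IsEulerWeight (W p))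
    (h0 : ∀ p ∈ O, (W p).ext 0 = 1) (he : ∀ p ∈ O, HasEuler (W p) (a p * W p))
    (ha : ∀ p ∈ O, ContDiffAt ℝ ω a p) {p : P} (hp : p ∈ O) :
    ContDiffAt ℝ ω W p ∧ ContDiffAt ℝ ω (fun q => eulerSolver (W q)) p := by
  let S := eulerSolver (W p)
  let T : P → BC →L[ℝ] BC := fun q => 1 - S * mulOp (a q - a p)
  have hT1 : T p = 1 := by
    simp only [T, sub_self, map_zero, mul_zero, sub_zero]
  have hT : ContDiffAt ℝ ω T p := by
    have h1 : ContDiffAt ℝ ω (fun q => mulOp (a q - a p)) p :=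
      mulOp.contDiff.contDiffAt.comp p ((ha p hp).sub contDiffAt_const)
    exact contDiffAt_const.sub (contDiffAt_const.mul h1)
  have hI : ContDiffAt ℝ ω (fun q => Ring.inverse (T q)) p := by
    have h1 : ContDiffAt ℝ ω Ring.inverse (T p) := by
      rw [hT1]
      exact contDiffAt_ringInverse ℝ (1 : (BC →L[ℝ] BC)ˣ)
    exact h1.comp p hT
  have hu : ∀ᶠ q in 𝓝 p, IsUnit (T q) :=
    hT.continuousAt.eventually (hT1 ▸ Units.isOpen.mem_nhds isUnit_one)
  have hev : ∀ᶠ q in 𝓝 p, W q = Ring.inverse (T q) (W p) ∧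
      eulerSolver (W q) = Ring.inverse (T q) * S := by
    filter_upwards [hu, hO.mem_nhds hp] with q hq hqO
    have e1 : T q (W q) = W p := by
      have h1 : HasEuler (W q) (a p * W q + (a q - a p) * W q) := (he q hqO).congr (by ring)
      have h2 := eq_eulerSolver (hw p hp) (he p hp) (h0 p hp) h1
      rw [h0 q hqO] at h2
      change W q - S ((a q - a p) * W q) = W p
      rw [one_smul] at h2
      exact sub_eq_of_eq_add h2
    have e2 : T q * eulerSolver (W q) = S := by
      ext1 z
      have h1 : HasEuler (eulerSolver (W q) z)
          (a p * eulerSolver (W q) z + ((a q - a p) * eulerSolver (W q) z + z)) :=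
        (eulerSolver_hasEuler (hw q hqO) (he q hqO) z).congr (by ring)
      have h2 := eq_eulerSolver (hw p hp) (he p hp) (h0 p hp) h1
      rw [eulerSolver_ext_zero (hw q hqO), map_add] at h2
      rw [zero_smul, zero_add] at h2
      change eulerSolver (W q) z - S ((a q - a p) * eulerSolver (W q) z) = S z
      rw [sub_eq_iff_eq_add, add_comm]
      exact h2
    have e3 : Ring.inverse (T q) * T q = 1 := Ring.inverse_mul_cancel _ hq
    constructor
    · rw [← e1, ← mul_apply_eq_comp, e3]
      rfl
    · rw [← e2, ← mul_assoc, e3, one_mul]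
  constructor
  · refine ContDiffAt.congr_of_eventuallyEq ?_ (hev.mono fun q h => h.1)
    exact hI.clm_apply contDiffAt_const
  · refine ContDiffAt.congr_of_eventuallyEq ?_ (hev.mono fun q h => h.2)
    exact hI.mul contDiffAt_const

end Family

/-! ### Powers of `1 + x` -/

/-- `(1 + x)^a` as an element of `BC`, for `a ≥ 0`. -/
def pw (a : ℝ) : BC := BC.ofFun fun x => (1 + x) ^ a

theorem pw_ext {a : ℝ} (ha : 0 ≤ a) {x : ℝ} (hx : x ∈ Ioo (-1 : ℝ) 1) :
    (pw a).ext x = (1 + x) ^ a := by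
  refine BC.ext_ofFun ((continuousOn_one_add_rpow a).mono Ioo_subset_Ioi_self) ⟨2 ^ a, ?_⟩ hx
  intro y hy
  have hy1 : 0 ≤ 1 + y := by linarith [hy.1]
  rw [abs_of_nonneg (Real.rpow_nonneg hy1 a)]
  exact Real.rpow_le_rpow hy1 (by linarith [hy.2]) ha

theorem pw_hasEuler {a : ℝ} (ha : 0 ≤ a) : HasEuler (pw a) (a • pw a) := by
  refine HasEuler.of_hasDerivAt (f := fun x => (1 + x) ^ a) (f' := fun x => a * (1 + x) ^ (a - 1))
    (fun x hx => pw_ext ha hx) (fun x hx => ?_) fun x hx => hasDerivAt_one_add_rpow a hx.1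
  have hx1 : 0 < 1 + x := by linarith [hx.1]
  rw [BC.ext_smul, pw_ext ha hx, Real.rpow_sub_one hx1.ne']
  field_simp

theorem pw_isEulerWeight {a : ℝ} (ha : 0 < a) : IsEulerWeight (pw a) :=
  ⟨a, 1, 1, ha, one_pos, fun x hx => by rw [pw_ext ha.le hx]; simp⟩

/-- The powers of `1 + x` form an Euler family whose coefficient is the constant function equal to
the exponent; this avoids estimating derivatives in the exponent, which involve logarithms. -/
theorem contDiffAt_pw {a : ℝ} (ha : 0 < a) : ContDiffAt ℝ ω pw a := by
  refine (contDiffAt_euler_family (O := Ioi (0 : ℝ)) (W := pw) (a := fun b : ℝ => b • (1 : BC))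
    isOpen_Ioi (fun b hb => pw_isEulerWeight hb) (fun b hb => ?_) (fun b hb => ?_)
    (fun b _ => ?_) (mem_Ioi.2 ha)).1
  · rw [pw_ext (le_of_lt hb) zero_mem_Ioo, add_zero, Real.one_rpow]
  · refine (pw_hasEuler (le_of_lt hb)).congr ?_
    rw [smul_mul_assoc, one_mul]
  · exact contDiffAt_id.smul contDiffAt_const

end

/-! ### Weighted integral operators and the algebra of the nonlocal term. -/

section

/-! ### Integral operators -/

/-- `(1 + x)^a u(x)`. -/
def wt (a : ℝ) (u : BC) (x : ℝ) : ℝ := (1 + x) ^ a * u.ext x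

theorem wt_continuousOn (a : ℝ) (u : BC) : ContinuousOn (wt a u) (Ioo (-1) 1) :=
  ((continuousOn_one_add_rpow a).mono Ioo_subset_Ioi_self).mul u.continuousOn_ext

theorem abs_wt_le (a : ℝ) (u : BC) {x : ℝ} (hx : x ∈ Ioo (-1 : ℝ) 1) :
    |wt a u x| ≤ ‖u‖ * (1 + x) ^ a := by
  have h : 0 < (1 + x) ^ a := Real.rpow_pos_of_pos (by linarith [hx.1]) _
  rw [wt, abs_mul, abs_of_pos h, mul_comm]
  exact mul_le_mul_of_nonneg_right (u.abs_ext_le x) h.le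

theorem wt_add (a : ℝ) (u v : BC) : wt a (u + v) = fun x => wt a u x + wt a v x := by
  funext x; simp only [wt, BC.ext_add]; ring

theorem wt_smul (a c : ℝ) (u : BC) : wt a (c • u) = fun x => c * wt a u x := by
  funext x; simp only [wt, BC.ext_smul]; ring

theorem wt_integrable {a : ℝ} (ha : -1 < a) (u : BC) {x y : ℝ} (hx : x ∈ Icc (-1 : ℝ) 1)
    (hy : y ∈ Icc (-1 : ℝ) 1) : IntervalIntegrable (wt a u) volume x y := by
  have h : IntervalIntegrable (wt a u) volume (-1) 1 :=
    intervalIntegrable_of_le (by norm_num) le_rfl le_rfl (wt_continuousOn a u)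
      ((intervalIntegrable_one_add_rpow ha _ _).const_mul ‖u‖) fun s hs => abs_wt_le a u hs
  refine h.mono_set ?_
  rw [uIcc_of_le (by norm_num : (-1 : ℝ) ≤ 1)]
  exact Set.OrdConnected.uIcc_subset ordConnected_Icc hx hy

theorem wt_integrable_right (a : ℝ) (u : BC) {x : ℝ} (hx : x ∈ Ioo (-1 : ℝ) 1) :
    IntervalIntegrable (wt a u) volume x 1 := by
  refine intervalIntegrable_of_le hx.2.le hx.1.le le_rfl (wt_continuousOn a u)
    (g := fun s => ‖u‖ * (1 + s) ^ a) ?_ fun s hs => abs_wt_le a u ⟨hx.1.trans hs.1, hs.2⟩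
  refine ((continuousOn_one_add_rpow a).mono ?_).intervalIntegrable.const_mul _
  rw [uIcc_of_le hx.2.le]
  exact fun s hs => hx.1.trans_le hs.1

theorem one_sub_rpow_le {t b : ℝ} (h0 : 0 ≤ t) (h1 : t ≤ 1) (hb0 : 0 < b) (hb1 : b ≤ 1) :
    1 - t ^ b ≤ 1 - t := by
  have := Real.rpow_le_rpow_of_exponent_ge' h0 h1 hb0.le hb1
  rw [Real.rpow_one] at this
  linarith

variable {ε : ℝ}

/-- With `t = (1+x)/2` this reduces to `1 - t^{1-ε} ≤ 1 - t`. The factor `1 - x` is kept because the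
integrals are later divided by powers of `1 - x`. -/
theorem integral_weight_le (h0 : 0 < ε) (h1 : ε < 1) {x : ℝ} (hx : x ∈ Icc (-1 : ℝ) 1) :
    ∫ s in x..1, (1 + s) ^ (-ε) ≤ (1 - x) / (1 - ε) := by
  rw [integral_one_add_rpow (by linarith)]
  have e : -ε + 1 = 1 - ε := by ring
  have hx1 : 0 ≤ 1 + x := by linarith [hx.1]
  rw [e]
  refine div_le_div_of_nonneg_right ?_ (by linarith)
  have h2 := one_sub_rpow_le (t := (1 + x) / 2) (b := 1 - ε) (by linarith) (by linarith [hx.2])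
    (by linarith) (by linarith)
  rw [Real.div_rpow hx1 (by norm_num)] at h2
  have h3 : (2 : ℝ) ^ (1 - ε) ≤ 2 := by
    calc (2 : ℝ) ^ (1 - ε) ≤ 2 ^ (1 : ℝ) :=
          Real.rpow_le_rpow_of_exponent_le (by norm_num) (by linarith)
      _ = 2 := by norm_num
  have h4 : (0 : ℝ) < 2 ^ (1 - ε) := by positivity
  have h5 : (2 : ℝ) ^ (1 - ε) - (1 + x) ^ (1 - ε)
      = 2 ^ (1 - ε) * (1 - (1 + x) ^ (1 - ε) / 2 ^ (1 - ε)) := by field_simp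
  rw [show (1 : ℝ) + 1 = 2 by norm_num, h5]
  calc _ ≤ 2 ^ (1 - ε) * (1 - (1 + x) / 2) := by gcongr
    _ ≤ 2 * (1 - (1 + x) / 2) := by
        gcongr
        linarith [hx.2]
    _ = 1 - x := by ring

theorem integral_weight_sub_one_le (h0 : 0 < ε) (h1 : ε < 1) {x : ℝ} (hx : x ∈ Ioo (-1 : ℝ) 1) :
    ∫ s in x..1, (1 + s) ^ (-1 - ε) ≤ (1 - x) * (1 + x) ^ (-ε) / ε := by
  rw [integral_one_add_rpow_of_ne (by linarith) hx.1 (by norm_num)]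
  have e : -1 - ε + 1 = -ε := by ring
  have hx1 : 0 < 1 + x := by linarith [hx.1]
  rw [e, div_neg, ← neg_div, neg_sub, show (1 : ℝ) + 1 = 2 by norm_num]
  refine div_le_div_of_nonneg_right ?_ h0.le
  have h2 := one_sub_rpow_le (t := (1 + x) / 2) (b := ε) (by linarith) (by linarith [hx.2])
    (by linarith) (by linarith)
  rw [Real.div_rpow hx1.le (by norm_num)] at h2
  have h4 : (0 : ℝ) < (1 + x) ^ ε := Real.rpow_pos_of_pos hx1 _
  have h6 : (0 : ℝ) < 2 ^ ε := by positivity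
  have h5 : (1 + x) ^ (-ε) - (2 : ℝ) ^ (-ε)
      = (1 + x) ^ (-ε) * (1 - (1 + x) ^ ε / 2 ^ ε) := by
    rw [Real.rpow_neg hx1.le, Real.rpow_neg (by norm_num)]
    field_simp
  rw [h5, mul_comm]
  have h7 : (0 : ℝ) < (1 + x) ^ (-ε) := Real.rpow_pos_of_pos hx1 _
  refine mul_le_mul_of_nonneg_right ?_ h7.le
  linarith [hx.2]

/-- `∫_x^1 (1 + s)^{-ε} u(s) ds`. -/
def tail (ε : ℝ) (u : BC) (x : ℝ) : ℝ := ∫ s in x..1, wt (-ε) u s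

theorem tail_hasDerivAt (h1 : ε < 1) (u : BC) {x : ℝ} (hx : x ∈ Ioo (-1 : ℝ) 1) :
    HasDerivAt (tail ε u) (-wt (-ε) u x) x :=
  hasDerivAt_integral_left (wt_continuousOn _ u) hx
    (wt_integrable (by linarith) u (Ioo_subset_Icc_self hx) (by norm_num))

theorem abs_tail_le (h0 : 0 < ε) (h1 : ε < 1) (u : BC) {x : ℝ} (hx : x ∈ Icc (-1 : ℝ) 1) :
    |tail ε u x| ≤ ‖u‖ / (1 - ε) * (1 - x) := by
  refine (abs_integral_le_of_le hx.2
    ((intervalIntegrable_one_add_rpow (by linarith) _ _).const_mul ‖u‖)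
    fun s hs => abs_wt_le (-ε) u ⟨hx.1.trans_lt hs.1, hs.2⟩).trans ?_
  rw [intervalIntegral.integral_const_mul, div_mul_eq_mul_div, mul_div_assoc]
  exact mul_le_mul_of_nonneg_left (integral_weight_le h0 h1 hx) (norm_nonneg u)

theorem tail_one (u : BC) : tail ε u 1 = 0 := intervalIntegral.integral_same

theorem tail_continuousOn (h1 : ε < 1) (u : BC) : ContinuousOn (tail ε u) (Icc (-1) 1) := by
  have h := intervalIntegral.continuousOn_primitive_interval_left (μ := volume) (f := wt (-ε) u)
    (a := -1) (b := 1) (by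
      rw [uIcc_of_le (by norm_num), integrableOn_Icc_iff_integrableOn_Ioc,
        ← intervalIntegrable_iff_integrableOn_Ioc_of_le (by norm_num)]
      exact wt_integrable (by linarith) u (by norm_num) (by norm_num))
  rwa [uIcc_of_le (by norm_num)] at h

theorem tail_add (h1 : ε < 1) (u v : BC) {x : ℝ} (hx : x ∈ Icc (-1 : ℝ) 1) :
    tail ε (u + v) x = tail ε u x + tail ε v x := by
  have hi := fun u : BC => wt_integrable (a := -ε) (by linarith) u hx (by norm_num : (1 : ℝ) ∈ _)
  rw [tail, wt_add, intervalIntegral.integral_add (hi u) (hi v), tail, tail]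

theorem tail_smul (c : ℝ) (u : BC) (x : ℝ) : tail ε (c • u) x = c * tail ε u x := by
  rw [tail, wt_smul, intervalIntegral.integral_const_mul, tail]

/-- `u ↦ (1 - x)^{-1} ∫_x^1 (1 + s)^{-ε} u(s) ds`. -/
def gOp (ε : ℝ) : BC →L[ℝ] BC := BC.opOf fun u x => tail ε u x / (1 - x)

theorem gOp_ext (h0 : 0 < ε) (h1 : ε < 1) (u : BC) {x : ℝ} (hx : x ∈ Ioo (-1 : ℝ) 1) :
    (gOp ε u).ext x = tail ε u x / (1 - x) := by
  refine BC.opOf_ext (T := fun u x => tail ε u x / (1 - x))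
    (BC.exists_clm _ (1 / (1 - ε)) ?_ ?_ ?_ ?_) u hx
  · intro u v x hx
    simp only [tail_add h1 u v (Ioo_subset_Icc_self hx), add_div]
  · intro c u x _
    simp only [tail_smul, mul_div_assoc]
  · intro u
    exact ((tail_continuousOn h1 u).mono Ioo_subset_Icc_self).div (by fun_prop)
      fun x hx => by linarith [hx.2]
  · intro u x hx
    have hx1 : 0 < 1 - x := by linarith [hx.2]
    rw [abs_div, abs_of_pos hx1, div_le_iff₀ hx1, one_div_mul_eq_div]
    exact abs_tail_le h0 h1 u (Ioo_subset_Icc_self hx)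

/-- The functional `u ↦ ∫_0^1 (1 + s)^{-ε} u(s) ds`. -/
def massOp (ε : ℝ) : BC →L[ℝ] ℝ := BC.evalZero ∘L gOp ε

theorem massOp_apply (h0 : 0 < ε) (h1 : ε < 1) (u : BC) : massOp ε u = tail ε u 0 := by
  rw [massOp, ContinuousLinearMap.comp_apply, BC.evalZero_apply, gOp_ext h0 h1 u zero_mem_Ioo,
    sub_zero, div_one]

theorem massOp_pos (h0 : 0 < ε) (h1 : ε < 1) {u : BC}
    (hu : ∀ x ∈ Ioo (-1 : ℝ) 1, 0 < u.ext x) : 0 < massOp ε u := by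
  rw [massOp_apply h0 h1]
  refine intervalIntegral.intervalIntegral_pos_of_pos_on
    (wt_integrable (by linarith) u (by norm_num) (by norm_num)) (fun s hs => ?_) one_pos
  exact mul_pos (Real.rpow_pos_of_pos (by linarith [hs.1]) _) (hu s ⟨by linarith [hs.1], hs.2⟩)

/-- `u ↦ ∫_0^x (1 + s)^{-ε} u(s) ds`. -/
def hOp (ε : ℝ) : BC →L[ℝ] BC := BC.opOf fun u x => ∫ s in (0 : ℝ)..x, wt (-ε) u s

theorem integral_zero_eq_tail (h1 : ε < 1) (u : BC) {x : ℝ} (hx : x ∈ Icc (-1 : ℝ) 1) :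
    ∫ s in (0 : ℝ)..x, wt (-ε) u s = tail ε u 0 - tail ε u x := by
  rw [tail, tail, eq_sub_iff_add_eq]
  exact intervalIntegral.integral_add_adjacent_intervals
    (wt_integrable (by linarith) u (by norm_num) hx)
    (wt_integrable (by linarith) u hx (by norm_num))

theorem hOp_ext (h0 : 0 < ε) (h1 : ε < 1) (u : BC) {x : ℝ} (hx : x ∈ Ioo (-1 : ℝ) 1) :
    (hOp ε u).ext x = ∫ s in (0 : ℝ)..x, wt (-ε) u s := by
  refine BC.opOf_ext (T := fun u x => ∫ s in (0 : ℝ)..x, wt (-ε) u s)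
    (BC.exists_clm _ (3 / (1 - ε)) ?_ ?_ ?_ ?_) u hx
  · intro u v x hx
    have h := Ioo_subset_Icc_self hx
    simp only [integral_zero_eq_tail h1 _ h, tail_add h1 u v h,
      tail_add h1 u v (by norm_num : (0 : ℝ) ∈ _)]
    ring
  · intro c u x hx
    simp only [wt_smul, intervalIntegral.integral_const_mul]
  · intro u
    refine ContinuousOn.congr (f := fun x => tail ε u 0 - tail ε u x)
      (continuousOn_const.sub ((tail_continuousOn h1 u).mono Ioo_subset_Icc_self)) fun x hx => ?_
    exact integral_zero_eq_tail h1 u (Ioo_subset_Icc_self hx)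
  · intro u x hx
    have h := Ioo_subset_Icc_self hx
    rw [integral_zero_eq_tail h1 u h]
    have ha := abs_tail_le h0 h1 u h
    have hb := abs_tail_le h0 h1 u (by norm_num : (0 : ℝ) ∈ Icc (-1 : ℝ) 1)
    have hc : 0 ≤ ‖u‖ / (1 - ε) := div_nonneg (norm_nonneg u) (by linarith)
    calc _ ≤ |tail ε u 0| + |tail ε u x| := abs_sub _ _
      _ ≤ ‖u‖ / (1 - ε) * (1 - 0) + ‖u‖ / (1 - ε) * 2 := by
          refine add_le_add hb (ha.trans ?_)
          gcongr
          linarith [hx.1]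
      _ = _ := by ring

theorem hOp_hasEuler (h0 : 0 < ε) (h1 : ε < 1) (u : BC) :
    HasEuler (hOp ε u) (pw (1 - ε) * u) := by
  refine HasEuler.of_hasDerivAt (f' := wt (-ε) u) (fun x hx => hOp_ext h0 h1 u hx)
    (fun x hx => ?_) fun x hx => hasDerivAt_integral_right (wt_continuousOn _ u) hx
      (wt_integrable (by linarith) u (by norm_num) (Ioo_subset_Icc_self hx))
  have hx1 : 0 < 1 + x := by linarith [hx.1]
  rw [BC.ext_mul, pw_ext (by linarith) hx, wt, sub_eq_add_neg, Real.rpow_add hx1, Real.rpow_one]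
  ring

/-! ### The triple integral -/

/-- `∫_t^1 (1 + s)^{-1-ε} u(s) ds`. -/
def iint1 (ε : ℝ) (u : BC) (t : ℝ) : ℝ := ∫ s in t..1, wt (-1 - ε) u s

/-- `∫_l^1 ∫_t^1 (1 + s)^{-1-ε} u(s) ds dt`. -/
def iint2 (ε : ℝ) (u : BC) (l : ℝ) : ℝ := ∫ t in l..1, iint1 ε u t

/-- `∫_x^1 ∫_l^1 ∫_t^1 (1 + s)^{-1-ε} u(s) ds dt dl`. -/
def iint3 (ε : ℝ) (u : BC) (x : ℝ) : ℝ := ∫ l in x..1, iint2 ε u l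

theorem iint1_hasDerivAt (u : BC) {x : ℝ} (hx : x ∈ Ioo (-1 : ℝ) 1) :
    HasDerivAt (iint1 ε u) (-wt (-1 - ε) u x) x :=
  hasDerivAt_integral_left (wt_continuousOn _ u) hx (wt_integrable_right _ u hx)

theorem iint1_continuousOn (u : BC) : ContinuousOn (iint1 ε u) (Ioo (-1) 1) :=
  fun _ hx => (iint1_hasDerivAt u hx).continuousAt.continuousWithinAt

/-- Each integration from `1` gains a factor `1 - x`. At `-1` the first one improves the singularity
from `(1+x)^{-1-ε}` to the integrable `(1+x)^{-ε}`, and the second removes it. -/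
theorem abs_iint1_le (h0 : 0 < ε) (h1 : ε < 1) (u : BC) {x : ℝ} (hx : x ∈ Ioo (-1 : ℝ) 1) :
    |iint1 ε u x| ≤ ‖u‖ / ε * (1 - x) * (1 + x) ^ (-ε) := by
  refine (abs_integral_le_of_le (g := fun s => ‖u‖ * (1 + s) ^ (-1 - ε)) hx.2.le ?_
    fun s hs => abs_wt_le _ u ⟨hx.1.trans hs.1, hs.2⟩).trans ?_
  · refine ((continuousOn_one_add_rpow _).mono ?_).intervalIntegrable.const_mul _
    rw [uIcc_of_le hx.2.le]
    exact fun s hs => hx.1.trans_le hs.1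
  · rw [intervalIntegral.integral_const_mul, div_mul_eq_mul_div, div_mul_eq_mul_div, mul_assoc,
      mul_div_assoc]
    exact mul_le_mul_of_nonneg_left (integral_weight_sub_one_le h0 h1 hx) (norm_nonneg u)

theorem iint1_integrable (h0 : 0 < ε) (h1 : ε < 1) (u : BC) {x : ℝ} (hx : x ∈ Icc (-1 : ℝ) 1) :
    IntervalIntegrable (iint1 ε u) volume x 1 := by
  refine intervalIntegrable_of_le hx.2 hx.1 le_rfl (iint1_continuousOn u)
    (g := fun s => ‖u‖ / ε * (1 - x) * (1 + s) ^ (-ε))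
    ((intervalIntegrable_one_add_rpow (by linarith) _ _).const_mul _) fun s hs => ?_
  have hs' : s ∈ Ioo (-1 : ℝ) 1 := ⟨hx.1.trans_lt hs.1, hs.2⟩
  have hp : 0 < 1 + s := by linarith [hs'.1]
  refine (abs_iint1_le h0 h1 u hs').trans ?_
  have := hs.1.le
  gcongr

theorem abs_iint2_le (h0 : 0 < ε) (h1 : ε < 1) (u : BC) {x : ℝ} (hx : x ∈ Icc (-1 : ℝ) 1) :
    |iint2 ε u x| ≤ ‖u‖ / ε / (1 - ε) * (1 - x) ^ 2 := by
  refine (abs_integral_le_of_le (g := fun s => ‖u‖ / ε * (1 - x) * (1 + s) ^ (-ε)) hx.2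
    ((intervalIntegrable_one_add_rpow (by linarith) _ _).const_mul _) fun s hs => ?_).trans ?_
  · have hs' : s ∈ Ioo (-1 : ℝ) 1 := ⟨hx.1.trans_lt hs.1, hs.2⟩
    have hp : 0 < 1 + s := by linarith [hs'.1]
    refine (abs_iint1_le h0 h1 u hs').trans ?_
    have := hs.1.le
    gcongr
  · rw [intervalIntegral.integral_const_mul]
    have hx1 : 0 ≤ 1 - x := by linarith [hx.2]
    calc _ ≤ ‖u‖ / ε * (1 - x) * ((1 - x) / (1 - ε)) := by
          refine mul_le_mul_of_nonneg_left (integral_weight_le h0 h1 hx) (by positivity)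
      _ = _ := by ring

theorem iint2_hasDerivAt (h0 : 0 < ε) (h1 : ε < 1) (u : BC) {x : ℝ} (hx : x ∈ Ioo (-1 : ℝ) 1) :
    HasDerivAt (iint2 ε u) (-iint1 ε u x) x :=
  hasDerivAt_integral_left (iint1_continuousOn u) hx
    (iint1_integrable h0 h1 u (Ioo_subset_Icc_self hx))

theorem iint2_continuousOn (h0 : 0 < ε) (h1 : ε < 1) (u : BC) :
    ContinuousOn (iint2 ε u) (Ioo (-1) 1) :=
  fun _ hx => (iint2_hasDerivAt h0 h1 u hx).continuousAt.continuousWithinAt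

theorem iint2_integrable (h0 : 0 < ε) (h1 : ε < 1) (u : BC) {x : ℝ} (hx : x ∈ Icc (-1 : ℝ) 1) :
    IntervalIntegrable (iint2 ε u) volume x 1 := by
  refine intervalIntegrable_of_le hx.2 hx.1 le_rfl (iint2_continuousOn h0 h1 u)
    (g := fun s => ‖u‖ / ε / (1 - ε) * (1 - s) ^ 2)
    (Continuous.intervalIntegrable (by fun_prop) _ _) fun s hs => ?_
  exact abs_iint2_le h0 h1 u ⟨hx.1.trans hs.1.le, hs.2.le⟩

theorem iint3_hasDerivAt (h0 : 0 < ε) (h1 : ε < 1) (u : BC) {x : ℝ} (hx : x ∈ Ioo (-1 : ℝ) 1) :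
    HasDerivAt (iint3 ε u) (-iint2 ε u x) x :=
  hasDerivAt_integral_left (iint2_continuousOn h0 h1 u) hx
    (iint2_integrable h0 h1 u (Ioo_subset_Icc_self hx))

theorem abs_iint3_le (h0 : 0 < ε) (h1 : ε < 1) (u : BC) {x : ℝ} (hx : x ∈ Icc (-1 : ℝ) 1) :
    |iint3 ε u x| ≤ ‖u‖ / ε / (1 - ε) * (1 - x) ^ 3 := by
  have h2 : 0 < 1 - ε := by linarith
  refine (abs_integral_le_of_le (g := fun _ => ‖u‖ / ε / (1 - ε) * (1 - x) ^ 2) hx.2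
    (by simp) fun s hs => ?_).trans ?_
  · refine (abs_iint2_le h0 h1 u ⟨hx.1.trans hs.1.le, hs.2.le⟩).trans ?_
    have := hs.1.le
    have := hs.2
    gcongr
  · rw [intervalIntegral.integral_const, smul_eq_mul]
    exact le_of_eq (by ring)

theorem iint3_continuousOn (h0 : 0 < ε) (h1 : ε < 1) (u : BC) :
    ContinuousOn (iint3 ε u) (Icc (-1) 1) := by
  have h := intervalIntegral.continuousOn_primitive_interval_left (μ := volume) (f := iint2 ε u)
    (a := -1) (b := 1) (by
      rw [uIcc_of_le (by norm_num), integrableOn_Icc_iff_integrableOn_Ioc,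
        ← intervalIntegrable_iff_integrableOn_Ioc_of_le (by norm_num)]
      exact iint2_integrable h0 h1 u (by norm_num))
  rwa [uIcc_of_le (by norm_num)] at h

theorem iint1_add (u v : BC) {x : ℝ} (hx : x ∈ Ioo (-1 : ℝ) 1) :
    iint1 ε (u + v) x = iint1 ε u x + iint1 ε v x := by
  rw [iint1, wt_add, intervalIntegral.integral_add (wt_integrable_right _ u hx)
    (wt_integrable_right _ v hx), iint1, iint1]

theorem iint2_add (h0 : 0 < ε) (h1 : ε < 1) (u v : BC) {x : ℝ} (hx : x ∈ Icc (-1 : ℝ) 1) :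
    iint2 ε (u + v) x = iint2 ε u x + iint2 ε v x := by
  rw [iint2, integral_congr_Ioo (g := fun t => iint1 ε u t + iint1 ε v t) hx.2
    fun s hs => iint1_add u v ⟨hx.1.trans_lt hs.1, hs.2⟩, intervalIntegral.integral_add
    (iint1_integrable h0 h1 u hx) (iint1_integrable h0 h1 v hx), iint2, iint2]

theorem iint3_add (h0 : 0 < ε) (h1 : ε < 1) (u v : BC) {x : ℝ} (hx : x ∈ Icc (-1 : ℝ) 1) :
    iint3 ε (u + v) x = iint3 ε u x + iint3 ε v x := by
  rw [iint3, integral_congr_Ioo (g := fun t => iint2 ε u t + iint2 ε v t) hx.2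
    fun s hs => iint2_add h0 h1 u v ⟨hx.1.trans hs.1.le, hs.2.le⟩, intervalIntegral.integral_add
    (iint2_integrable h0 h1 u hx) (iint2_integrable h0 h1 v hx), iint3, iint3]

theorem iint2_smul (c : ℝ) (u : BC) (x : ℝ) : iint2 ε (c • u) x = c * iint2 ε u x := by
  simp only [iint2, iint1, wt_smul, intervalIntegral.integral_const_mul]

theorem iint3_smul (c : ℝ) (u : BC) (x : ℝ) : iint3 ε (c • u) x = c * iint3 ε u x := by
  simp only [iint3, iint2_smul, intervalIntegral.integral_const_mul]

/-- The derivative of `(1 - x)^{-2} iint3`. -/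
def qDer (ε : ℝ) (u : BC) (x : ℝ) : ℝ :=
  2 * iint3 ε u x / (1 - x) ^ 3 - iint2 ε u x / (1 - x) ^ 2

theorem quot_hasDerivAt (h0 : 0 < ε) (h1 : ε < 1) (u : BC) {x : ℝ} (hx : x ∈ Ioo (-1 : ℝ) 1) :
    HasDerivAt (fun x => iint3 ε u x / (1 - x) ^ 2) (qDer ε u x) x := by
  have hx1 : 1 - x ≠ 0 := by linarith [hx.2]
  have h2 : HasDerivAt (fun x : ℝ => (1 - x) ^ 2) (-2 * (1 - x)) x := by
    have := ((hasDerivAt_id x).const_sub 1).pow 2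
    refine this.congr_deriv ?_
    simp
  refine ((iint3_hasDerivAt h0 h1 u hx).div h2 (pow_ne_zero 2 hx1)).congr_deriv ?_
  rw [qDer]
  field_simp
  ring

theorem qDer_continuousOn (h0 : 0 < ε) (h1 : ε < 1) (u : BC) :
    ContinuousOn (qDer ε u) (Ioo (-1) 1) := by
  refine ContinuousOn.sub ?_ ?_
  · exact (continuousOn_const.mul ((iint3_continuousOn h0 h1 u).mono Ioo_subset_Icc_self)).div
      (by fun_prop) fun x hx => pow_ne_zero 3 (by linarith [hx.2])
  · exact (iint2_continuousOn h0 h1 u).div (by fun_prop)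
      fun x hx => pow_ne_zero 2 (by linarith [hx.2])

/-- The powers of `1 - x` gained by the double and triple integrals match the denominators exactly.
-/
theorem abs_qDer_le (h0 : 0 < ε) (h1 : ε < 1) (u : BC) {x : ℝ} (hx : x ∈ Ioo (-1 : ℝ) 1) :
    |qDer ε u x| ≤ 3 / ε / (1 - ε) * ‖u‖ := by
  have hx1 : 0 < 1 - x := by linarith [hx.2]
  have h2 := abs_iint2_le h0 h1 u (Ioo_subset_Icc_self hx)
  have h3 := abs_iint3_le h0 h1 u (Ioo_subset_Icc_self hx)
  rw [← div_le_iff₀ (by positivity)] at h2 h3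
  refine (abs_sub _ _).trans ?_
  rw [abs_div, abs_div, abs_mul, abs_of_pos (pow_pos hx1 3), abs_of_pos (pow_pos hx1 2),
    abs_of_pos (by norm_num : (0 : ℝ) < 2), mul_div_assoc]
  calc _ ≤ 2 * (‖u‖ / ε / (1 - ε)) + ‖u‖ / ε / (1 - ε) := by gcongr
    _ = _ := by ring

/-- Integration of the bounded derivative from `-1` gives the factor `1 + x`; the `4` is `(1-x)²` at
`x = -1`. This is where the choice `μ̂ = μ - ψ(-1)/4` pays: after subtracting the boundary value,
the nonlocal term can be divided by `1 + x`. -/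
theorem abs_quot_sub_le (h0 : 0 < ε) (h1 : ε < 1) (u : BC) {x : ℝ} (hx : x ∈ Ioo (-1 : ℝ) 1) :
    |iint3 ε u x / (1 - x) ^ 2 - iint3 ε u (-1) / 4| ≤ 3 / ε / (1 - ε) * ‖u‖ * (1 + x) := by
  have hs : ∀ y ∈ Ioo (-1 : ℝ) x, y ∈ Ioo (-1 : ℝ) 1 := fun y hy => ⟨hy.1, hy.2.trans hx.2⟩
  have hi : IntervalIntegrable (qDer ε u) volume (-1) x :=
    intervalIntegrable_of_le hx.1.le le_rfl hx.2.le (qDer_continuousOn h0 h1 u)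
      (g := fun _ => 3 / ε / (1 - ε) * ‖u‖) (by simp)
      fun y hy => abs_qDer_le h0 h1 u (hs y hy)
  have h := intervalIntegral.integral_eq_sub_of_hasDerivAt_of_le
    (f := fun x => iint3 ε u x / (1 - x) ^ 2) hx.1.le
    (((iint3_continuousOn h0 h1 u).mono (Icc_subset_Icc_right hx.2.le)).div (by fun_prop)
      fun y hy => pow_ne_zero 2 (by linarith [hy.2, hx.2]))
    (fun y hy => quot_hasDerivAt h0 h1 u (hs y hy)) hi
  have e : (1 - (-1 : ℝ)) ^ 2 = 4 := by norm_num
  rw [e] at h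
  rw [← h]
  refine (abs_integral_le_of_le (g := fun _ => 3 / ε / (1 - ε) * ‖u‖) hx.1.le (by simp)
    fun y hy => abs_qDer_le h0 h1 u (hs y hy)).trans ?_
  rw [intervalIntegral.integral_const, smul_eq_mul]
  exact le_of_eq (by ring)

/-- `u ↦ d/dx ((1 - x)^{-2} iint3)`. -/
def dOp (ε : ℝ) : BC →L[ℝ] BC := BC.opOf (qDer ε)

theorem dOp_ext (h0 : 0 < ε) (h1 : ε < 1) (u : BC) {x : ℝ} (hx : x ∈ Ioo (-1 : ℝ) 1) :
    (dOp ε u).ext x = qDer ε u x := by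
  refine BC.opOf_ext (BC.exists_clm _ (3 / ε / (1 - ε)) ?_ ?_ (qDer_continuousOn h0 h1)
    fun u x => abs_qDer_le h0 h1 u) u hx
  · intro u v x hx
    simp only [qDer, iint2_add h0 h1 u v (Ioo_subset_Icc_self hx),
      iint3_add h0 h1 u v (Ioo_subset_Icc_self hx)]
    ring
  · intro c u x _
    simp only [qDer, iint2_smul, iint3_smul]
    ring

/-- `u ↦ (1 + x)^{-1} ((1 - x)^{-2} iint3(x) - iint3(-1) / 4)`. -/
def qOp (ε : ℝ) : BC →L[ℝ] BC :=
  BC.opOf fun u x => (iint3 ε u x / (1 - x) ^ 2 - iint3 ε u (-1) / 4) / (1 + x)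

theorem qOp_ext (h0 : 0 < ε) (h1 : ε < 1) (u : BC) {x : ℝ} (hx : x ∈ Ioo (-1 : ℝ) 1) :
    (qOp ε u).ext x = (iint3 ε u x / (1 - x) ^ 2 - iint3 ε u (-1) / 4) / (1 + x) := by
  refine BC.opOf_ext
    (T := fun u x => (iint3 ε u x / (1 - x) ^ 2 - iint3 ε u (-1) / 4) / (1 + x))
    (BC.exists_clm _ (3 / ε / (1 - ε)) ?_ ?_ ?_ ?_) u hx
  · intro u v x hx
    simp only [iint3_add h0 h1 u v (Ioo_subset_Icc_self hx),
      iint3_add h0 h1 u v (by norm_num : (-1 : ℝ) ∈ _)]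
    ring
  · intro c u x _
    simp only [iint3_smul]
    ring
  · intro u
    refine ContinuousOn.div (ContinuousOn.sub ?_ continuousOn_const) (by fun_prop)
      fun x hx => by linarith [hx.1]
    exact fun x hx => (quot_hasDerivAt h0 h1 u hx).continuousAt.continuousWithinAt
  · intro u x hx
    have hx1 : 0 < 1 + x := by linarith [hx.1]
    rw [abs_div, abs_of_pos hx1, div_le_iff₀ hx1]
    exact abs_quot_sub_le h0 h1 u hx

/-- Differentiating `(1+x) q = Q` gives `(1+x) q' = Q' - q`, so the Euler derivative of `q` is again
a bounded operator applied to `u`. -/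
theorem qOp_hasEuler (h0 : 0 < ε) (h1 : ε < 1) (u : BC) :
    HasEuler (qOp ε u) (dOp ε u - qOp ε u) := by
  refine HasEuler.of_hasDerivAt (fun x hx => qOp_ext h0 h1 u hx) (f' := fun x =>
    (qDer ε u x * (1 + x) - (iint3 ε u x / (1 - x) ^ 2 - iint3 ε u (-1) / 4) * 1) / (1 + x) ^ 2)
    (fun x hx => ?_) fun x hx => ?_
  · have hx1 : 1 + x ≠ 0 := by linarith [hx.1]
    rw [BC.ext_sub, dOp_ext h0 h1 u hx, qOp_ext h0 h1 u hx]
    field_simp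
  · have hx1 : 1 + x ≠ 0 := by linarith [hx.1]
    exact ((quot_hasDerivAt h0 h1 u hx).sub_const _).div ((hasDerivAt_id x).const_add 1) hx1

end

section

/-! ### The no-swirl solutions -/

/-- The exponent `√(1 + 2μ)`. -/
def kap (p : ℝ × ℝ) : ℝ := √(1 + 2 * p.1)

/-- `((1 + x)/2)^√(1+2μ)`. -/
def hp (p : ℝ × ℝ) (x : ℝ) : ℝ := ((1 + x) / 2) ^ kap p

/-- The denominator of the no-swirl solution, multiplied by `((1 + x)/2)^√(1+2μ)`. -/
def den (p : ℝ × ℝ) (x : ℝ) : ℝ := (p.2 + 1 + kap p) - (p.2 + 1 - kap p) * hp p x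

/-- `U_θ / (1 - x)` for the no-swirl solution. -/
def wfun (p : ℝ × ℝ) (x : ℝ) : ℝ :=
  1 - kap p - 2 * kap p * (p.2 + 1 - kap p) * (hp p x / den p x)

section

variable {p : ℝ × ℝ}

theorem kap_pos (h : p ∈ I1) : 0 < kap p := Real.sqrt_pos.2 (by linarith [h.1])

theorem kap_sq (h : p ∈ I1) : kap p ^ 2 = 1 + 2 * p.1 := Real.sq_sqrt (by linarith [h.1])

theorem coef_pos (h : p ∈ I1) : 0 < p.2 + 1 + kap p := by
  have := h.2
  unfold kap
  linarith

theorem hp_pos {x : ℝ} (hx : -1 < x) : 0 < hp p x := Real.rpow_pos_of_pos (by linarith) _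

theorem hp_le_one (h : p ∈ I1) {x : ℝ} (hx : x ∈ Ioc (-1 : ℝ) 1) : hp p x ≤ 1 :=
  Real.rpow_le_one (by linarith [hx.1]) (by linarith [hx.2]) (kap_pos h).le

/-- The denominator is affine in `hp p x ∈ (0,1]`, with value `γ + 1 + κ` at `0` and `2κ` at `1`. It
is therefore a convex combination of two numbers that are positive on `I1`. -/
theorem min_le_den (h : p ∈ I1) {x : ℝ} (hx : x ∈ Ioc (-1 : ℝ) 1) :
    min (p.2 + 1 + kap p) (2 * kap p) ≤ den p x := by
  have h0 := hp_pos (p := p) hx.1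
  have h1 := hp_le_one h hx
  have a := min_le_left (p.2 + 1 + kap p) (2 * kap p)
  have b := min_le_right (p.2 + 1 + kap p) (2 * kap p)
  unfold den
  nlinarith [mul_le_mul_of_nonneg_right b h0.le,
    mul_le_mul_of_nonneg_right a (sub_nonneg.2 h1)]

theorem den_le_max (h : p ∈ I1) {x : ℝ} (hx : x ∈ Ioc (-1 : ℝ) 1) :
    den p x ≤ max (p.2 + 1 + kap p) (2 * kap p) := by
  have h0 := hp_pos (p := p) hx.1
  have h1 := hp_le_one h hx
  have a := le_max_left (p.2 + 1 + kap p) (2 * kap p)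
  have b := le_max_right (p.2 + 1 + kap p) (2 * kap p)
  unfold den
  nlinarith [mul_le_mul_of_nonneg_right b h0.le,
    mul_le_mul_of_nonneg_right a (sub_nonneg.2 h1)]

theorem min_pos (h : p ∈ I1) : 0 < min (p.2 + 1 + kap p) (2 * kap p) :=
  lt_min (coef_pos h) (by linarith [kap_pos h])

theorem den_pos (h : p ∈ I1) {x : ℝ} (hx : x ∈ Ioc (-1 : ℝ) 1) : 0 < den p x :=
  (min_pos h).trans_le (min_le_den h hx)

theorem noSwirl_eq (h : p ∈ I1) {x : ℝ} (hx : x ∈ Ioc (-1 : ℝ) 1) :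
    noSwirl p x = (1 - x) * wfun p x := by
  have h0 := hp_pos (p := p) hx.1
  have h1 := den_pos h hx
  have e : (p.2 + 1 + kap p) * ((1 + x) / 2) ^ (-kap p) - p.2 - 1 + kap p
      = den p x / hp p x := by
    rw [Real.rpow_neg (by linarith [hx.1]), eq_div_iff h0.ne', den, ← hp]
    field_simp
    ring
  change (1 - x) * (1 - kap p - 2 * kap p * (p.2 + 1 - kap p)
    / ((p.2 + 1 + kap p) * ((1 + x) / 2) ^ (-kap p) - p.2 - 1 + kap p)) = _
  rw [e, wfun]
  field_simp

theorem hp_hasDerivAt {x : ℝ} (hx : -1 < x) :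
    HasDerivAt (hp p) (kap p * hp p x / (1 + x)) x := by
  have hx1 : 0 < 1 + x := by linarith
  have h2 : (1 + x) / 2 ≠ 0 := by positivity
  have h := (((hasDerivAt_id x).const_add 1).div_const 2).rpow_const (p := kap p) (Or.inl h2)
  refine h.congr_deriv ?_
  simp only [id, hp]
  rw [Real.rpow_sub_one h2]
  field_simp

theorem den_hasDerivAt {x : ℝ} (hx : -1 < x) :
    HasDerivAt (den p) (-((p.2 + 1 - kap p) * (kap p * hp p x / (1 + x)))) x :=
  ((hp_hasDerivAt hx).const_mul _).const_sub _

/-- The no-swirl equation in Riccati form. Its Euler derivative is polynomial in `w`, hence stays in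
`BC`. -/
theorem wfun_hasDerivAt (h : p ∈ I1) {x : ℝ} (hx : x ∈ Ioo (-1 : ℝ) 1) :
    HasDerivAt (wfun p) ((p.1 + wfun p x - wfun p x ^ 2 / 2) / (1 + x)) x := by
  have hx1 : 0 < 1 + x := by linarith [hx.1]
  have h1 := den_pos h (Ioo_subset_Ioc_self hx)
  refine ((((hp_hasDerivAt hx.1).div (den_hasDerivAt hx.1) h1.ne').const_mul
    (2 * kap p * (p.2 + 1 - kap p))).const_sub (1 - kap p)).congr_deriv ?_
  have e : p.1 = (kap p ^ 2 - 1) / 2 := by rw [kap_sq h]; ring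
  rw [wfun, e]
  field_simp
  simp only [den]
  ring

theorem wfun_continuousOn (h : p ∈ I1) : ContinuousOn (wfun p) (Ioo (-1) 1) :=
  fun _ hx => (wfun_hasDerivAt h hx).continuousAt.continuousWithinAt

theorem integrand_eq (h : p ∈ I1) {x : ℝ} (hx : x ∈ Ioo (-1 : ℝ) 1) :
    noSwirl p x / (1 - x ^ 2) = wfun p x / (1 + x) := by
  have h1 : 1 - x ≠ 0 := by linarith [hx.2]
  have h2 : 1 + x ≠ 0 := by linarith [hx.1]
  rw [noSwirl_eq h (Ioo_subset_Ioc_self hx), show 1 - x ^ 2 = (1 - x) * (1 + x) by ring]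
  field_simp

theorem integrand_continuousOn (h : p ∈ I1) :
    ContinuousOn (fun x => noSwirl p x / (1 - x ^ 2)) (Ioo (-1) 1) :=
  ((wfun_continuousOn h).div (by fun_prop) fun x hx => by linarith [hx.1]).congr
    fun _ hx => integrand_eq h hx

theorem bFun_hasDerivAt (h : p ∈ I1) {x : ℝ} (hx : x ∈ Ioo (-1 : ℝ) 1) :
    HasDerivAt (bFun p) (wfun p x / (1 + x)) x := by
  rw [← integrand_eq h hx]
  exact hasDerivAt_integral_right (integrand_continuousOn h) hx
    (intervalIntegrable_of_Ioo (integrand_continuousOn h) zero_mem_Ioo hx)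

theorem bFun_zero : bFun p 0 = 0 := intervalIntegral.integral_same

/-- Since `b' = w/(1+x)`, the product of `e^b` with the right-hand side has zero derivative and
equals `1` at `0`. The closed form exhibits the exact power of `1 + x` at `-1`. -/
theorem exp_neg_bFun (h : p ∈ I1) {x : ℝ} (hx : x ∈ Ioo (-1 : ℝ) 1) :
    Real.exp (-bFun p x) = (1 + x) ^ (kap p - 1) * (den p 0 ^ 2 / den p x ^ 2) := by
  have h3 : ∀ x ∈ Ioo (-1 : ℝ) 1, HasDerivAt
      (fun x => Real.exp (bFun p x) * ((1 + x) ^ (kap p - 1) * (den p 0 ^ 2 / den p x ^ 2)))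
      0 x := fun x hx => by
    have hx1 : 0 < 1 + x := by linarith [hx.1]
    have h1 := den_pos h (Ioo_subset_Ioc_self hx)
    refine ((bFun_hasDerivAt h hx).exp.mul ((hasDerivAt_one_add_rpow (kap p - 1) hx.1).mul
      ((hasDerivAt_const x (den p 0 ^ 2)).div ((den_hasDerivAt hx.1).pow 2)
        (pow_ne_zero 2 h1.ne')))).congr_deriv ?_
    simp only [Pi.mul_apply, Pi.div_apply, Pi.pow_apply]
    rw [Real.rpow_sub_one hx1.ne' (kap p - 1)]
    simp only [wfun]
    field_simp
    ring
  have h4 := eq_apply_zero_of_hasDerivAt_zero h3 hx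
  have h5 := (den_pos h (by norm_num : (0 : ℝ) ∈ Ioc (-1 : ℝ) 1)).ne'
  rw [bFun_zero, Real.exp_zero, add_zero, Real.one_rpow, div_self (pow_ne_zero 2 h5), one_mul,
    one_mul] at h4
  rw [Real.exp_neg]
  exact (eq_inv_of_mul_eq_one_right h4).symm

theorem exp_neg_aFun (h : p ∈ I1) {x : ℝ} (hx : x ∈ Ioo (-1 : ℝ) 1) :
    Real.exp (-aFun p x) = (1 - x ^ 2) * Real.exp (-bFun p x) := by
  have hne : ∀ x ∈ Ioo (-1 : ℝ) 1, 0 < 1 - x ^ 2 := fun x hx => by nlinarith [hx.1, hx.2]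
  have hc : ContinuousOn (fun s : ℝ => 2 * s / (1 - s ^ 2)) (Ioo (-1) 1) :=
    ContinuousOn.div (by fun_prop) (by fun_prop) fun s hs => (hne s hs).ne'
  have hi := intervalIntegrable_of_Ioo hc zero_mem_Ioo hx
  have h1 : aFun p x = (∫ s in (0 : ℝ)..x, 2 * s / (1 - s ^ 2)) + bFun p x := by
    rw [aFun, bFun, ← intervalIntegral.integral_add hi
      (intervalIntegrable_of_Ioo (integrand_continuousOn h) zero_mem_Ioo hx)]
    simp only [add_div]
  have h2 : ∫ s in (0 : ℝ)..x, 2 * s / (1 - s ^ 2) = -Real.log (1 - x ^ 2) := by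
    rw [intervalIntegral.integral_eq_sub_of_hasDerivAt (f := fun s => -Real.log (1 - s ^ 2))
      (fun s hs => ?_) hi]
    · simp
    · have hs' := Set.OrdConnected.uIcc_subset ordConnected_Ioo zero_mem_Ioo hx hs
      have h3 : HasDerivAt (fun s : ℝ => 1 - s ^ 2) (-(2 * s)) s := by
        simpa using ((hasDerivAt_id s).pow 2).const_sub 1
      refine (h3.log (hne s hs').ne').neg.congr_deriv ?_
      ring
  rw [h1, h2, neg_add, neg_neg, Real.exp_add, Real.exp_log (hne x hx)]

/-- As `x → -1` the power `hp` tends to `0`, so `w → 1 - κ`. The hypothesis on the limit of `U_θ`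
thereby becomes `1 - κ < ε`. -/
theorem noSwirlSouth_eq (h : p ∈ I1) : noSwirlSouth p = 2 * (1 - kap p) := by
  refine Tendsto.limUnder_eq ?_
  have h1 : Tendsto (hp p) (𝓝[>] (-1)) (𝓝 0) := by
    have : ContinuousAt (hp p) (-1) := by
      unfold hp
      exact ContinuousAt.rpow_const (by fun_prop) (Or.inr (kap_pos h).le)
    have h2 := this.tendsto.mono_left (nhdsWithin_le_nhds (s := Ioi (-1)))
    have h3 : hp p (-1) = 0 := by
      rw [hp, show (1 + (-1 : ℝ)) / 2 = 0 by norm_num, Real.zero_rpow (kap_pos h).ne']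
    rwa [h3] at h2
  have h2 : Tendsto (den p) (𝓝[>] (-1)) (𝓝 (p.2 + 1 + kap p)) := by
    have := (h1.const_mul (p.2 + 1 - kap p)).const_sub (p.2 + 1 + kap p)
    rwa [mul_zero, sub_zero] at this
  have h3 : Tendsto (wfun p) (𝓝[>] (-1)) (𝓝 (1 - kap p)) := by
    have := ((h1.div h2 (coef_pos h).ne').const_mul
      (2 * kap p * (p.2 + 1 - kap p))).const_sub (1 - kap p)
    rwa [zero_div, mul_zero, sub_zero] at this
  have h4 : Tendsto (fun x : ℝ => 1 - x) (𝓝[>] (-1)) (𝓝 2) := by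
    have : ContinuousAt (fun x : ℝ => 1 - x) (-1) := by fun_prop
    have h5 := this.tendsto.mono_left (nhdsWithin_le_nhds (s := Ioi (-1)))
    norm_num at h5
    exact h5
  refine (h4.mul h3).congr' ?_
  filter_upwards [Ioc_mem_nhdsGT (by norm_num : (-1 : ℝ) < 1)] with x hx
  exact (noSwirl_eq h hx).symm

theorem hp_eq {x : ℝ} (hx : -1 < x) :
    hp p x = Real.exp (-(kap p * Real.log 2)) * (1 + x) ^ kap p := by
  rw [hp, Real.div_rpow (by linarith) (by norm_num), Real.rpow_def_of_pos (by norm_num : (0:ℝ) < 2),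
    Real.exp_neg, mul_comm (Real.log 2)]
  field_simp

/-- `((1 + x)/2)^√(1+2μ)` in `BC`. -/
def hpB (p : ℝ × ℝ) : BC := Real.exp (-(kap p * Real.log 2)) • pw (kap p)

theorem hpB_ext (h : p ∈ I1) {x : ℝ} (hx : x ∈ Ioo (-1 : ℝ) 1) : (hpB p).ext x = hp p x := by
  rw [hpB, BC.ext_smul, pw_ext (kap_pos h).le hx, hp_eq hx.1]

/-- The denominator of the no-swirl solution in `BC`. -/
def denB (p : ℝ × ℝ) : BC := (p.2 + 1 + kap p) • (1 : BC) - (p.2 + 1 - kap p) • hpB p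

theorem denB_ext (h : p ∈ I1) {x : ℝ} (hx : x ∈ Ioo (-1 : ℝ) 1) : (denB p).ext x = den p x := by
  rw [denB, BC.ext_sub, BC.ext_smul, BC.ext_smul, BC.ext_one hx, hpB_ext h hx, den, mul_one]

theorem denB_isUnit (h : p ∈ I1) : IsUnit (denB p) := by
  have hc : ContinuousOn (fun x => (den p x)⁻¹) (Ioo (-1) 1) := fun x hx =>
    ((den_hasDerivAt hx.1).continuousAt.inv₀
      (den_pos h (Ioo_subset_Ioc_self hx)).ne').continuousWithinAt
  have hb : BddOn (Ioo (-1) 1) fun x => (den p x)⁻¹ :=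
    ⟨(min (p.2 + 1 + kap p) (2 * kap p))⁻¹, fun x hx => by
      have h1 := den_pos h (Ioo_subset_Ioc_self hx)
      rw [abs_of_pos (inv_pos.2 h1)]
      exact inv_anti₀ (min_pos h) (min_le_den h (Ioo_subset_Ioc_self hx))⟩
  refine IsUnit.of_mul_eq_one (BC.ofFun fun x => (den p x)⁻¹) (BC.ext_inj fun x hx => ?_)
  rw [BC.ext_mul, BC.ext_ofFun hc hb hx, denB_ext h hx, BC.ext_one hx]
  exact mul_inv_cancel₀ (den_pos h (Ioo_subset_Ioc_self hx)).ne'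

theorem denB_inverse_ext (h : p ∈ I1) {x : ℝ} (hx : x ∈ Ioo (-1 : ℝ) 1) :
    (Ring.inverse (denB p)).ext x = (den p x)⁻¹ := by
  have h1 : (denB p * Ring.inverse (denB p)).ext x = (1 : BC).ext x := by
    rw [Ring.mul_inverse_cancel _ (denB_isUnit h)]
  rw [BC.ext_mul, denB_ext h hx, BC.ext_one hx] at h1
  exact eq_inv_of_mul_eq_one_right h1

/-- `U_θ / (1 - x)` in `BC`. -/
def wB (p : ℝ × ℝ) : BC :=
  (1 - kap p) • (1 : BC)
    - (2 * kap p * (p.2 + 1 - kap p)) • (hpB p * Ring.inverse (denB p))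

theorem wB_ext (h : p ∈ I1) {x : ℝ} (hx : x ∈ Ioo (-1 : ℝ) 1) : (wB p).ext x = wfun p x := by
  rw [wB, BC.ext_sub, BC.ext_smul, BC.ext_smul, BC.ext_mul, BC.ext_one hx, hpB_ext h hx,
    denB_inverse_ext h hx, wfun, mul_one, div_eq_mul_inv]

theorem wB_hasEuler (h : p ∈ I1) :
    HasEuler (wB p) (p.1 • (1 : BC) + wB p - (1 / 2 : ℝ) • (wB p * wB p)) := by
  refine HasEuler.of_hasDerivAt (fun x hx => wB_ext h hx) (fun x hx => ?_)
    fun x hx => wfun_hasDerivAt h hx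
  have hx1 : 1 + x ≠ 0 := by linarith [hx.1]
  rw [BC.ext_sub, BC.ext_add, BC.ext_smul, BC.ext_smul, BC.ext_mul, BC.ext_one hx, wB_ext h hx]
  field_simp

theorem contDiffAt_kap (h : p ∈ I1) : ContDiffAt ℝ ω kap p := by
  unfold kap
  refine ContDiffAt.sqrt (by fun_prop) ?_
  have := h.1
  exact (by linarith : 0 < 1 + 2 * p.1).ne'

/-- The closed form of `w` uses only `pw (kap p)`, scalars and the inverse of `denB p`, and
inversion in the Banach algebra is analytic at units. -/
theorem contDiffAt_wB (h : p ∈ I1) : ContDiffAt ℝ ω wB p := by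
  have hk := contDiffAt_kap h
  have h0 : ContDiffAt ℝ ω (fun q => pw (kap q)) p := (contDiffAt_pw (kap_pos h)).comp p hk
  have h1 : ContDiffAt ℝ ω hpB p := by unfold hpB; fun_prop
  have h2 : ContDiffAt ℝ ω denB p := by unfold denB; fun_prop
  have h3 : ContDiffAt ℝ ω (fun q => Ring.inverse (denB q)) p := by
    obtain ⟨v, hv⟩ := denB_isUnit h
    have h4 : ContDiffAt ℝ ω Ring.inverse (denB p) := by
      rw [← hv]
      exact contDiffAt_ringInverse ℝ v
    exact h4.comp p h2
  unfold wB
  fun_prop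

end

/-! ### The fundamental solution -/

/-- The parameters in `I₁` with `U_θ(-1) < 2ε`. -/
def dom (ε : ℝ) : Set (ℝ × ℝ) := {p | p ∈ I1 ∧ 1 - kap p < ε}

theorem isOpen_dom (ε : ℝ) : IsOpen (dom ε) := by
  have hk : Continuous kap := by unfold kap; fun_prop
  have h1 : IsOpen {p : ℝ × ℝ | -(1 / 2) < p.1} := isOpen_lt (by fun_prop) (by fun_prop)
  have h2 : IsOpen {p : ℝ × ℝ | -1 - kap p < p.2} := isOpen_lt (by fun_prop) (by fun_prop)
  have h3 : IsOpen {p : ℝ × ℝ | 1 - kap p < ε} := isOpen_lt (by fun_prop) (by fun_prop)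
  exact (h1.inter h2).inter h3

/-- `(1 + x)^ε e^{-b}` in `BC`. -/
def fund (ε : ℝ) (p : ℝ × ℝ) : BC := BC.ofFun fun x => (1 + x) ^ ε * Real.exp (-bFun p x)

variable {ε : ℝ} {p : ℝ × ℝ}

theorem fund_aux (h : p ∈ I1) {x : ℝ} (hx : x ∈ Ioo (-1 : ℝ) 1) :
    (1 + x) ^ ε * Real.exp (-bFun p x)
      = (1 + x) ^ (ε + kap p - 1) * (den p 0 ^ 2 / den p x ^ 2) := by
  rw [exp_neg_bFun h hx, ← mul_assoc, ← Real.rpow_add (by linarith [hx.1]), add_sub_assoc]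

theorem fund_bounds (h : p ∈ I1) : ∃ m M : ℝ, 0 < m ∧ ∀ x ∈ Ioo (-1 : ℝ) 1,
    m * (1 + x) ^ (ε + kap p - 1) ≤ (1 + x) ^ ε * Real.exp (-bFun p x) ∧
    (1 + x) ^ ε * Real.exp (-bFun p x) ≤ M * (1 + x) ^ (ε + kap p - 1) := by
  have h0 := den_pos h (by norm_num : (0 : ℝ) ∈ Ioc (-1 : ℝ) 1)
  have hM : 0 < max (p.2 + 1 + kap p) (2 * kap p) := lt_max_of_lt_left (coef_pos h)
  refine ⟨den p 0 ^ 2 / max (p.2 + 1 + kap p) (2 * kap p) ^ 2,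
    den p 0 ^ 2 / min (p.2 + 1 + kap p) (2 * kap p) ^ 2, by positivity, fun x hx => ?_⟩
  have hx' := Ioo_subset_Ioc_self hx
  have h1 := den_pos h hx'
  have h2 := min_le_den h hx'
  have h3 := den_le_max h hx'
  have h4 := min_pos h
  have h5 : 0 < (1 + x) ^ (ε + kap p - 1) := Real.rpow_pos_of_pos (by linarith [hx.1]) _
  rw [fund_aux h hx, mul_comm ((1 + x) ^ (ε + kap p - 1))]
  constructor <;> gcongr

theorem fund_ext (h : p ∈ dom ε) {x : ℝ} (hx : x ∈ Ioo (-1 : ℝ) 1) :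
    (fund ε p).ext x = (1 + x) ^ ε * Real.exp (-bFun p x) := by
  refine BC.ext_ofFun ?_ ?_ hx
  · exact ((continuousOn_one_add_rpow ε).mono Ioo_subset_Ioi_self).mul fun x hx =>
      (bFun_hasDerivAt h.1 hx).neg.exp.continuousAt.continuousWithinAt
  · obtain ⟨m, M, hm, hb⟩ := fund_bounds (ε := ε) h.1
    refine ⟨M * 2 ^ (ε + kap p - 1), fun x hx => ?_⟩
    have hx1 : 0 < 1 + x := by linarith [hx.1]
    have h5 : 0 < (1 + x) ^ (ε + kap p - 1) := Real.rpow_pos_of_pos hx1 _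
    have h6 : 0 < M := by
      have := (hb x hx).1.trans (hb x hx).2
      have := le_of_mul_le_mul_right this h5
      linarith
    rw [abs_of_pos (by positivity)]
    refine (hb x hx).2.trans ?_
    have := h.2
    refine mul_le_mul_of_nonneg_left ?_ h6.le
    exact Real.rpow_le_rpow hx1.le (by linarith [hx.2]) (by linarith)

/-- The exponent `ε + κ - 1` is positive precisely because `1 - κ < ε`, that is, `U_θ(-1) < 2ε`. -/
theorem fund_isEulerWeight (h : p ∈ dom ε) : IsEulerWeight (fund ε p) := by
  obtain ⟨m, M, hm, hb⟩ := fund_bounds (ε := ε) h.1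
  refine ⟨ε + kap p - 1, m, M, by linarith [h.2], hm, fun x hx => ?_⟩
  rw [fund_ext h hx]
  exact hb x hx

theorem fund_ext_zero (h : p ∈ dom ε) : (fund ε p).ext 0 = 1 := by
  rw [fund_ext h zero_mem_Ioo, bFun_zero]
  simp

theorem fund_hasEuler (h : p ∈ dom ε) :
    HasEuler (fund ε p) ((ε • (1 : BC) - wB p) * fund ε p) := by
  refine HasEuler.of_hasDerivAt (fun x hx => fund_ext h hx) (fun x hx => ?_) fun x hx =>
    (hasDerivAt_one_add_rpow ε hx.1).mul (bFun_hasDerivAt h.1 hx).neg.exp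
  have hx1 : 0 < 1 + x := by linarith [hx.1]
  rw [BC.ext_mul, BC.ext_sub, BC.ext_smul, BC.ext_one hx, wB_ext h.1 hx, fund_ext h hx,
    Real.rpow_sub_one hx1.ne']
  simp only [Pi.neg_apply]
  field_simp
  ring

theorem contDiffAt_fund (h : p ∈ dom ε) :
    ContDiffAt ℝ ω (fund ε) p ∧ ContDiffAt ℝ ω (fun q => eulerSolver (fund ε q)) p :=
  contDiffAt_euler_family (isOpen_dom ε) (fun _ hq => fund_isEulerWeight hq)
    (fun _ hq => fund_ext_zero hq) (fun _ hq => fund_hasEuler hq)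
    (fun _ hq => contDiffAt_const.sub (contDiffAt_wB hq.1)) h

end

section

/-! ### Elements of `X₁(ε)` from their second derivatives -/

variable {ε : ℝ}

theorem iint1_continuousOn_Ioc (u : BC) : ContinuousOn (iint1 ε u) (Ioc (-1) 1) := by
  intro x hx
  have hm : (x - 1) / 2 ∈ Ioo (-1 : ℝ) 1 := ⟨by linarith [hx.1], by linarith [hx.2]⟩
  have h := intervalIntegral.continuousOn_primitive_interval_left (μ := volume)
    (f := wt (-1 - ε) u) (a := (x - 1) / 2) (b := 1) (by
      rw [uIcc_of_le hm.2.le, integrableOn_Icc_iff_integrableOn_Ioc,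
        ← intervalIntegrable_iff_integrableOn_Ioc_of_le hm.2.le]
      exact wt_integrable_right _ u hm)
  rw [uIcc_of_le hm.2.le] at h
  have h2 : (x - 1) / 2 < x := by linarith [hx.1]
  refine (h x ⟨h2.le, hx.2⟩).mono_of_mem_nhdsWithin ?_
  filter_upwards [self_mem_nhdsWithin, mem_nhdsWithin_of_mem_nhds (Ioi_mem_nhds h2)] with y hy hy2
  exact ⟨le_of_lt hy2, hy.2⟩

/-- The function with value `v.1` at `0` and derivative `(1 + x)^{-1-ε} v.2`. -/
def dPrim (ε : ℝ) (v : ℝ × BC) (x : ℝ) : ℝ := v.1 + iint1 ε v.2 0 - iint1 ε v.2 (min x 1)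

/-- The primitive of `dPrim` that vanishes at `0`. -/
def prim (ε : ℝ) (v : ℝ × BC) (x : ℝ) : ℝ := ∫ s in (0 : ℝ)..x, dPrim ε v s

/-- The truncation `min x 1` makes the derivative constant beyond `1`, so the primitive is `C¹`
across `1` and its restriction is `C¹` up to that endpoint. -/
theorem dPrim_continuousOn (v : ℝ × BC) : ContinuousOn (dPrim ε v) (Ioi (-1)) := by
  refine continuousOn_const.sub ((iint1_continuousOn_Ioc v.2).comp (by fun_prop) ?_)
  intro x hx
  exact ⟨lt_min hx (by norm_num), min_le_right _ _⟩

theorem dPrim_zero (v : ℝ × BC) : dPrim ε v 0 = v.1 := by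
  simp [dPrim]

theorem dPrim_hasDerivAt (v : ℝ × BC) {x : ℝ} (hx : x ∈ Ioo (-1 : ℝ) 1) :
    HasDerivAt (dPrim ε v) (wt (-1 - ε) v.2 x) x := by
  have h := (iint1_hasDerivAt (ε := ε) v.2 hx).const_sub (v.1 + iint1 ε v.2 0)
  rw [neg_neg] at h
  refine h.congr_of_eventuallyEq ?_
  filter_upwards [Iio_mem_nhds hx.2] with y hy
  rw [dPrim, min_eq_left (le_of_lt hy)]

theorem dPrim_add (v w : ℝ × BC) {x : ℝ} (hx : x ∈ Ioo (-1 : ℝ) 1) :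
    dPrim ε (v + w) x = dPrim ε v x + dPrim ε w x := by
  simp only [dPrim, min_eq_left hx.2.le, Prod.fst_add, Prod.snd_add, iint1_add _ _ hx,
    iint1_add _ _ zero_mem_Ioo]
  ring

theorem dPrim_smul (c : ℝ) (v : ℝ × BC) (x : ℝ) : dPrim ε (c • v) x = c * dPrim ε v x := by
  simp only [dPrim, Prod.smul_fst, Prod.smul_snd, iint1, wt_smul,
    intervalIntegral.integral_const_mul, smul_eq_mul]
  ring

theorem one_le_weight (h0 : 0 < ε) (h1 : ε < 1) {x : ℝ} (hx : x ∈ Ioc (-1 : ℝ) 1) :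
    1 ≤ 2 * (1 + x) ^ (-ε) := by
  have hx1 : 0 < 1 + x := by linarith [hx.1]
  have h2 : (1 + x) ^ ε ≤ 2 := by
    calc (1 + x) ^ ε ≤ 2 ^ ε := Real.rpow_le_rpow hx1.le (by linarith [hx.2]) h0.le
      _ ≤ 2 ^ (1 : ℝ) := Real.rpow_le_rpow_of_exponent_le (by norm_num) h1.le
      _ = 2 := by norm_num
  rw [Real.rpow_neg hx1.le, ← div_eq_mul_inv, le_div_iff₀ (Real.rpow_pos_of_pos hx1 _)]
  linarith

/-- A constant in the estimates of `dPrim`. -/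
def cst (ε : ℝ) : ℝ := 2 + 4 / ε

theorem cst_pos (h0 : 0 < ε) : 0 < cst ε := by unfold cst; positivity

theorem abs_dPrim_le (h0 : 0 < ε) (h1 : ε < 1) (v : ℝ × BC) {x : ℝ} (hx : x ∈ Ioo (-1 : ℝ) 1) :
    |dPrim ε v x| ≤ cst ε * ‖v‖ * (1 + x) ^ (-ε) := by
  have hx1 : 0 < 1 + x := by linarith [hx.1]
  have hw := one_le_weight h0 h1 (Ioo_subset_Ioc_self hx)
  have hp := Real.rpow_pos_of_pos hx1 (-ε)
  have a1 := abs_iint1_le h0 h1 v.2 zero_mem_Ioo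
  have a2 := abs_iint1_le h0 h1 v.2 hx
  have n1 : |v.1| ≤ ‖v‖ := norm_fst_le v
  have n2 : ‖v.2‖ ≤ ‖v‖ := norm_snd_le v
  rw [add_zero, Real.one_rpow, sub_zero, mul_one, mul_one] at a1
  rw [dPrim, min_eq_left hx.2.le]
  have hd : ‖v.2‖ / ε ≤ ‖v‖ / ε := by gcongr
  have hd0 : 0 ≤ ‖v.2‖ / ε := by positivity
  calc |v.1 + iint1 ε v.2 0 - iint1 ε v.2 x|
      ≤ |v.1| + |iint1 ε v.2 0| + |iint1 ε v.2 x| :=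
        (abs_sub _ _).trans (add_le_add (abs_add_le _ _) le_rfl)
    _ ≤ ‖v‖ * (2 * (1 + x) ^ (-ε)) + ‖v‖ / ε * (2 * (1 + x) ^ (-ε))
        + ‖v‖ / ε * (2 * (1 + x) ^ (-ε)) := by
        refine add_le_add (add_le_add ?_ ?_) ?_
        · exact n1.trans (le_mul_of_one_le_right (norm_nonneg v) hw)
        · exact (a1.trans hd).trans (le_mul_of_one_le_right (by positivity) hw)
        · refine a2.trans ?_
          rw [mul_assoc]
          have h2 : (1 - x) * (1 + x) ^ (-ε) ≤ 2 * (1 + x) ^ (-ε) :=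
            mul_le_mul_of_nonneg_right (by linarith [hx.1]) hp.le
          exact mul_le_mul hd h2 (mul_nonneg (by linarith [hx.2]) hp.le) (by positivity)
    _ = _ := by rw [cst]; ring

theorem dPrim_integrable (h0 : 0 < ε) (h1 : ε < 1) (v : ℝ × BC) {x y : ℝ}
    (hx : x ∈ Icc (-1 : ℝ) 1) (hy : y ∈ Icc (-1 : ℝ) 1) :
    IntervalIntegrable (dPrim ε v) volume x y := by
  have h : IntervalIntegrable (dPrim ε v) volume (-1) 1 :=
    intervalIntegrable_of_le (by norm_num) le_rfl le_rfl
      ((dPrim_continuousOn v).mono Ioo_subset_Ioi_self)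
      ((intervalIntegrable_one_add_rpow (by linarith) _ _).const_mul (cst ε * ‖v‖))
      fun s hs => abs_dPrim_le h0 h1 v hs
  refine h.mono_set ?_
  rw [uIcc_of_le (by norm_num : (-1 : ℝ) ≤ 1)]
  exact Set.OrdConnected.uIcc_subset ordConnected_Icc hx hy

theorem prim_hasDerivAt (v : ℝ × BC) {x : ℝ} (hx : -1 < x) :
    HasDerivAt (prim ε v) (dPrim ε v x) x :=
  intervalIntegral.integral_hasDerivAt_right
    ((dPrim_continuousOn v).mono (Set.OrdConnected.uIcc_subset ordConnected_Ioi
      (mem_Ioi.2 (by norm_num)) hx)).intervalIntegrable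
    ((dPrim_continuousOn v).stronglyMeasurableAtFilter isOpen_Ioi x hx)
    ((dPrim_continuousOn v).continuousAt (Ioi_mem_nhds hx))

theorem prim_zero (v : ℝ × BC) : prim ε v 0 = 0 := intervalIntegral.integral_same

theorem prim_continuousOn (h0 : 0 < ε) (h1 : ε < 1) (v : ℝ × BC) :
    ContinuousOn (prim ε v) (Icc (-1) 1) := by
  have h := intervalIntegral.continuousOn_primitive_interval' (μ := volume) (f := dPrim ε v)
    (b₁ := -1) (b₂ := 1) (a := 0) (dPrim_integrable h0 h1 v (by norm_num) (by norm_num))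
    (by rw [uIcc_of_le (by norm_num)]; norm_num)
  rwa [uIcc_of_le (by norm_num)] at h

theorem prim_contDiffOn (v : ℝ × BC) : ContDiffOn ℝ 1 (prim ε v) (Ioi (-1)) := by
  rw [contDiffOn_one_iff_derivWithin (uniqueDiffOn_Ioi _)]
  refine ⟨fun x hx => (prim_hasDerivAt v hx).differentiableAt.differentiableWithinAt, ?_⟩
  refine (dPrim_continuousOn (ε := ε) v).congr fun x hx => ?_
  exact (prim_hasDerivAt v hx).hasDerivWithinAt.derivWithin (uniqueDiffOn_Ioi _ x hx)

theorem prim_contDiffOn_two (v : ℝ × BC) : ContDiffOn ℝ 2 (prim ε v) (Ioo (-1) 1) := by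
  have h1 : ContDiffOn ℝ 1 (dPrim ε v) (Ioo (-1) 1) := by
    rw [contDiffOn_one_iff_derivWithin (uniqueDiffOn_Ioo _ _)]
    refine ⟨fun x hx => (dPrim_hasDerivAt v hx).differentiableAt.differentiableWithinAt, ?_⟩
    refine (wt_continuousOn (-1 - ε) v.2).congr fun x hx => ?_
    exact (dPrim_hasDerivAt v hx).hasDerivWithinAt.derivWithin (uniqueDiffOn_Ioo _ _ x hx)
  rw [show (2 : WithTop ℕ∞) = 1 + 1 from rfl,
    contDiffOn_succ_iff_derivWithin (uniqueDiffOn_Ioo _ _)]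
  refine ⟨fun x hx => (prim_hasDerivAt v hx.1).differentiableAt.differentiableWithinAt,
    by simp, h1.congr fun x hx => ?_⟩
  exact (prim_hasDerivAt v hx.1).hasDerivWithinAt.derivWithin (uniqueDiffOn_Ioo _ _ x hx)

theorem abs_prim_le (h0 : 0 < ε) (h1 : ε < 1) (v : ℝ × BC) {x : ℝ} (hx : x ∈ Icc (-1 : ℝ) 1) :
    |prim ε v x - prim ε v (-1)| ≤ cst ε / (1 - ε) * ‖v‖ * (1 + x) ^ (1 - ε) := by
  have e : prim ε v x - prim ε v (-1) = ∫ s in (-1)..x, dPrim ε v s := by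
    rw [prim, prim, intervalIntegral.integral_interval_sub_left
      (dPrim_integrable h0 h1 v (by norm_num) hx)
      (dPrim_integrable h0 h1 v (by norm_num) (by norm_num))]
  rw [e]
  refine (abs_integral_le_of_le hx.1
    ((intervalIntegrable_one_add_rpow (by linarith) _ _).const_mul (cst ε * ‖v‖))
    fun s hs => abs_dPrim_le h0 h1 v ⟨hs.1, hs.2.trans_le hx.2⟩).trans ?_
  rw [intervalIntegral.integral_const_mul, integral_one_add_rpow (by linarith)]
  have h2 : -ε + 1 = 1 - ε := by ring
  have h3 : (1 : ℝ) + -1 = 0 := by norm_num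
  rw [h2, h3, Real.zero_rpow (by linarith), sub_zero]
  exact le_of_eq (by ring)

/-- A bound for `prim`. -/
def cst' (ε : ℝ) : ℝ := 4 * (cst ε / (1 - ε))

theorem cst'_pos (h0 : 0 < ε) (h1 : ε < 1) : 0 < cst' ε := by
  have := cst_pos h0
  have : 0 < 1 - ε := by linarith
  unfold cst'; positivity

theorem rpow_one_sub_le (h0 : 0 < ε) (h1 : ε < 1) {x : ℝ} (hx : x ∈ Icc (-1 : ℝ) 1) :
    (1 + x) ^ (1 - ε) ≤ 2 := by
  calc (1 + x) ^ (1 - ε) ≤ 2 ^ (1 - ε) :=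
        Real.rpow_le_rpow (by linarith [hx.1]) (by linarith [hx.2]) (by linarith)
    _ ≤ 2 ^ (1 : ℝ) := Real.rpow_le_rpow_of_exponent_le (by norm_num) (by linarith)
    _ = 2 := by norm_num

theorem abs_prim_le' (h0 : 0 < ε) (h1 : ε < 1) (v : ℝ × BC) {x : ℝ} (hx : x ∈ Icc (-1 : ℝ) 1) :
    |prim ε v x| ≤ cst' ε * ‖v‖ := by
  have hc := cst_pos h0
  have h2 : 0 < 1 - ε := by linarith
  have a := abs_prim_le h0 h1 v hx
  have b := abs_prim_le h0 h1 v (by norm_num : (0 : ℝ) ∈ Icc (-1 : ℝ) 1)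
  rw [prim_zero, zero_sub, abs_neg, add_zero, Real.one_rpow, mul_one] at b
  have h3 := rpow_one_sub_le h0 h1 hx
  have h4 : cst ε / (1 - ε) * ‖v‖ * (1 + x) ^ (1 - ε) ≤ cst ε / (1 - ε) * ‖v‖ * 2 := by gcongr
  have h5 : |prim ε v x| ≤ |prim ε v x - prim ε v (-1)| + |prim ε v (-1)| := by
    have := abs_add_le (prim ε v x - prim ε v (-1)) (prim ε v (-1))
    rwa [sub_add_cancel] at this
  have h6 : 0 ≤ cst ε / (1 - ε) * ‖v‖ := by positivity
  unfold cst'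
  linarith

theorem prim_add (h0 : 0 < ε) (h1 : ε < 1) (v w : ℝ × BC) {x : ℝ} (hx : x ∈ Icc (-1 : ℝ) 1) :
    prim ε (v + w) x = prim ε v x + prim ε w x := by
  have hz : (0 : ℝ) ∈ Icc (-1 : ℝ) 1 := by norm_num
  rw [prim, prim, prim, ← intervalIntegral.integral_add (dPrim_integrable h0 h1 v hz hx)
    (dPrim_integrable h0 h1 w hz hx)]
  rcases le_total 0 x with h | h
  · exact integral_congr_Ioo h fun s hs =>
      dPrim_add v w ⟨by linarith [hs.1], hs.2.trans_le hx.2⟩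
  · rw [intervalIntegral.integral_symm, intervalIntegral.integral_symm x]
    exact congrArg Neg.neg (integral_congr_Ioo h fun s hs =>
      dPrim_add v w ⟨hx.1.trans_lt hs.1, by linarith [hs.2]⟩)

theorem prim_smul (c : ℝ) (v : ℝ × BC) (x : ℝ) : prim ε (c • v) x = c * prim ε v x := by
  simp only [prim, dPrim_smul, intervalIntegral.integral_const_mul]

/-- Identifies an explicit function with the one rebuilt from its data, by comparing first the
derivatives and then the functions, each with matching value at `0`. -/
theorem eq_prim {f f' : ℝ → ℝ} {r : BC} (hf : ∀ x ∈ Ioo (-1 : ℝ) 1, HasDerivAt f (f' x) x)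
    (hf' : ∀ x ∈ Ioo (-1 : ℝ) 1, HasDerivAt f' (wt (-1 - ε) r x) x) (h0 : f 0 = 0) {x : ℝ}
    (hx : x ∈ Ioo (-1 : ℝ) 1) : f x = prim ε (f' 0, r) x := by
  have a : ∀ x ∈ Ioo (-1 : ℝ) 1, f' x = dPrim ε (f' 0, r) x := fun x hx => by
    have h := eq_apply_zero_of_hasDerivAt_zero (f := fun x => f' x - dPrim ε (f' 0, r) x)
      (fun y hy => ((hf' y hy).sub (dPrim_hasDerivAt (f' 0, r) hy)).congr_deriv (sub_self _)) hx
    simp only [dPrim_zero, sub_self] at h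
    exact sub_eq_zero.1 h
  have h := eq_apply_zero_of_hasDerivAt_zero (f := fun x => f x - prim ε (f' 0, r) x)
    (fun y hy => ((hf y hy).sub (prim_hasDerivAt (f' 0, r) hy.1)).congr_deriv
      (by rw [a y hy, sub_self])) hx
  simp only [prim_zero, h0, sub_self] at h
  exact sub_eq_zero.1 h

theorem eqOn_prim (h0 : 0 < ε) (h1 : ε < 1) {f f' : ℝ → ℝ} {r : BC} {J : Set ℝ}
    (hJ : Ioo (-1) 1 ⊆ J) (hJ' : J ⊆ Icc (-1) 1) (hc : ContinuousOn f J)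
    (hf : ∀ x ∈ Ioo (-1 : ℝ) 1, HasDerivAt f (f' x) x)
    (hf' : ∀ x ∈ Ioo (-1 : ℝ) 1, HasDerivAt f' (wt (-1 - ε) r x) x) (hz : f 0 = 0) :
    EqOn f (prim ε (f' 0, r)) J :=
  EqOn.of_subset_closure (s := Ioo (-1) 1) (fun _ hx => eq_prim hf hf' hz hx) hc
    ((prim_continuousOn h0 h1 _).mono hJ') hJ (by
      rwa [closure_Ioo (by norm_num)])

open Classical in
/-- `prim`, corrected to vanish at `±1`, as a function on `[-1,1]`. -/
def fun1 (ε : ℝ) (v : ℝ × BC) (x : ℝ) : ℝ :=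
  if x ∈ Icc (-1 : ℝ) 1 then
    -- The quadratics are the Lagrange polynomials for the nodes `-1, 0, 1`, so the value `0` at `0`
    -- is kept. The correction makes the map linear on all data with values in `M₁`.
    prim ε v x - prim ε v 1 * (x * (1 + x) / 2) - prim ε v (-1) * (x * (x - 1) / 2)
  else 0

open Classical in
/-- `prim`, corrected to vanish at `1`, as a function on `(-1,1]`. -/
def fun2 (ε : ℝ) (v : ℝ × BC) (x : ℝ) : ℝ :=
  if x ∈ Ioc (-1 : ℝ) 1 then prim ε v x - prim ε v 1 * x else 0

theorem fun1_eqOn (v : ℝ × BC) : EqOn (fun1 ε v)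
    (fun x => prim ε v x - prim ε v 1 * (x * (1 + x) / 2) - prim ε v (-1) * (x * (x - 1) / 2))
    (Icc (-1) 1) := fun _ hx => if_pos hx

theorem fun2_eqOn (v : ℝ × BC) : EqOn (fun2 ε v) (fun x => prim ε v x - prim ε v 1 * x)
    (Ioc (-1) 1) := fun _ hx => if_pos hx

theorem fun1_hasDerivAt (v : ℝ × BC) {x : ℝ} (hx : x ∈ Ioo (-1 : ℝ) 1) :
    HasDerivAt (fun1 ε v) (dPrim ε v x - prim ε v 1 * ((1 + 2 * x) / 2)
      - prim ε v (-1) * ((2 * x - 1) / 2)) x := by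
  have h1 : HasDerivAt (fun x : ℝ => x * (1 + x) / 2) ((1 + 2 * x) / 2) x := by
    refine (((hasDerivAt_id x).mul ((hasDerivAt_id x).const_add 1)).div_const 2).congr_deriv ?_
    simp only [id]; ring
  have h2 : HasDerivAt (fun x : ℝ => x * (x - 1) / 2) ((2 * x - 1) / 2) x := by
    refine (((hasDerivAt_id x).mul ((hasDerivAt_id x).sub_const 1)).div_const 2).congr_deriv ?_
    simp only [id]; ring
  refine (((prim_hasDerivAt v hx.1).sub (h1.const_mul _)).sub
    (h2.const_mul _)).congr_of_eventuallyEq ?_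
  filter_upwards [Icc_mem_nhds hx.1 hx.2] with y hy using fun1_eqOn v hy

theorem fun1_deriv_hasDerivAt (v : ℝ × BC) {x : ℝ} (hx : x ∈ Ioo (-1 : ℝ) 1) :
    HasDerivAt (deriv (fun1 ε v)) (wt (-1 - ε) v.2 x - prim ε v 1 - prim ε v (-1)) x := by
  have h1 : HasDerivAt (fun x : ℝ => (1 + 2 * x) / 2) 1 x := by
    refine ((((hasDerivAt_id x).const_mul 2).const_add 1).div_const 2).congr_deriv ?_
    norm_num
  have h2 : HasDerivAt (fun x : ℝ => (2 * x - 1) / 2) 1 x := by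
    refine ((((hasDerivAt_id x).const_mul 2).sub_const 1).div_const 2).congr_deriv ?_
    norm_num
  have h := ((dPrim_hasDerivAt (ε := ε) v hx).sub (h1.const_mul (prim ε v 1))).sub
    (h2.const_mul (prim ε v (-1)))
  rw [mul_one, mul_one] at h
  refine h.congr_of_eventuallyEq ?_
  filter_upwards [isOpen_Ioo.mem_nhds hx] with y hy using (fun1_hasDerivAt v hy).deriv

theorem fun2_hasDerivAt (v : ℝ × BC) {x : ℝ} (hx : x ∈ Ioo (-1 : ℝ) 1) :
    HasDerivAt (fun2 ε v) (dPrim ε v x - prim ε v 1) x := by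
  have h := (prim_hasDerivAt (ε := ε) v hx.1).sub ((hasDerivAt_id x).const_mul (prim ε v 1))
  rw [mul_one] at h
  refine h.congr_of_eventuallyEq ?_
  filter_upwards [Ioc_mem_nhds hx.1 hx.2] with y hy using fun2_eqOn v hy

theorem fun2_deriv_hasDerivAt (v : ℝ × BC) {x : ℝ} (hx : x ∈ Ioo (-1 : ℝ) 1) :
    HasDerivAt (deriv (fun2 ε v)) (wt (-1 - ε) v.2 x) x := by
  refine ((dPrim_hasDerivAt (ε := ε) v hx).sub_const (prim ε v 1)).congr_of_eventuallyEq ?_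
  filter_upwards [isOpen_Ioo.mem_nhds hx] with y hy using (fun2_hasDerivAt v hy).deriv

theorem fun1_bound0 (h0 : 0 < ε) (h1 : ε < 1) (v : ℝ × BC) {x : ℝ} (hx : x ∈ Ioo (-1 : ℝ) 1) :
    |(1 + x) ^ (-1 + ε) * fun1 ε v x| ≤ 5 * cst' ε * ‖v‖ := by
  have hx' := Ioo_subset_Icc_self hx
  have hx1 : 0 < 1 + x := by linarith [hx.1]
  have hc := cst'_pos h0 h1
  have a := abs_prim_le h0 h1 v hx'
  have b := abs_prim_le' h0 h1 v (by norm_num : (1 : ℝ) ∈ Icc (-1 : ℝ) 1)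
  have c := abs_prim_le' h0 h1 v (by norm_num : (-1 : ℝ) ∈ Icc (-1 : ℝ) 1)
  have hp : 0 < (1 + x) ^ (1 - ε) := Real.rpow_pos_of_pos hx1 _
  have hw : 1 + x ≤ 2 * (1 + x) ^ (1 - ε) := by
    have := one_le_weight h0 h1 (Ioo_subset_Ioc_self hx)
    rw [sub_eq_add_neg, Real.rpow_add hx1, Real.rpow_one]
    nlinarith
  -- Using `x(x-1)/2 = 1 - (2-x)(1+x)/2`, the value at `-1` is split off, and each remaining term is
  -- `O((1+x)^{1-ε})`.
  have e : fun1 ε v x = (prim ε v x - prim ε v (-1)) - prim ε v 1 * (x / 2 * (1 + x))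
      + prim ε v (-1) * ((2 - x) / 2 * (1 + x)) := by
    rw [fun1_eqOn v hx']; ring
  have hxa : |x / 2 * (1 + x)| ≤ (1 + x) ^ (1 - ε) := by
    rw [abs_mul, abs_of_pos hx1]
    have : |x / 2| ≤ 1 / 2 := by rw [abs_le]; constructor <;> linarith [hx.1, hx.2]
    calc |x / 2| * (1 + x) ≤ 1 / 2 * (2 * (1 + x) ^ (1 - ε)) := by gcongr
      _ = _ := by ring
  have hxb : |(2 - x) / 2 * (1 + x)| ≤ 3 * (1 + x) ^ (1 - ε) := by
    rw [abs_mul, abs_of_pos hx1]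
    have : |(2 - x) / 2| ≤ 3 / 2 := by rw [abs_le]; constructor <;> linarith [hx.1, hx.2]
    calc |(2 - x) / 2| * (1 + x) ≤ 3 / 2 * (2 * (1 + x) ^ (1 - ε)) := by gcongr
      _ = _ := by ring
  have hq : 0 < (1 + x) ^ (-1 + ε) := Real.rpow_pos_of_pos hx1 _
  have e2 : (1 + x) ^ (-1 + ε) = ((1 + x) ^ (1 - ε))⁻¹ := by
    rw [← Real.rpow_neg hx1.le]; congr 1; ring
  rw [abs_mul, abs_of_pos hq, e2, inv_mul_le_iff₀ hp, e]
  have hk : cst ε / (1 - ε) ≤ cst' ε := by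
    have : 0 ≤ cst ε / (1 - ε) := div_nonneg (cst_pos h0).le (by linarith)
    unfold cst'; linarith
  calc _ ≤ |prim ε v x - prim ε v (-1)| + |prim ε v 1| * |x / 2 * (1 + x)|
        + |prim ε v (-1)| * |(2 - x) / 2 * (1 + x)| := by
        rw [← abs_mul, ← abs_mul]
        exact (abs_add_le _ _).trans (add_le_add (abs_sub _ _) le_rfl)
    _ ≤ cst' ε * ‖v‖ * (1 + x) ^ (1 - ε) + cst' ε * ‖v‖ * (1 + x) ^ (1 - ε)
        + cst' ε * ‖v‖ * (3 * (1 + x) ^ (1 - ε)) := by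
        refine add_le_add (add_le_add (a.trans ?_) ?_) ?_ <;> gcongr
    _ = _ := by ring

theorem rpow_le_two (h0 : 0 < ε) (h1 : ε < 1) {x : ℝ} (hx : x ∈ Ioo (-1 : ℝ) 1) :
    (1 + x) ^ ε ≤ 2 := by
  have hx1 : 0 < 1 + x := by linarith [hx.1]
  have := one_le_weight h0 h1 (Ioo_subset_Ioc_self hx)
  rw [Real.rpow_neg hx1.le, ← div_eq_mul_inv, le_div_iff₀ (Real.rpow_pos_of_pos hx1 _)] at this
  linarith

theorem weight_mul_le (h0 : 0 < ε) (h1 : ε < 1) {x a A B : ℝ} (hx : x ∈ Ioo (-1 : ℝ) 1)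
    (hB : 0 ≤ B) (h : |a| ≤ A * (1 + x) ^ (-ε) + B) : |(1 + x) ^ ε * a| ≤ A + 2 * B := by
  have hx1 : 0 < 1 + x := by linarith [hx.1]
  have hp := Real.rpow_pos_of_pos hx1 ε
  rw [abs_mul, abs_of_pos hp]
  calc _ ≤ (1 + x) ^ ε * (A * (1 + x) ^ (-ε) + B) := by gcongr
    _ = A + (1 + x) ^ ε * B := by rw [Real.rpow_neg hx1.le]; field_simp
    _ ≤ _ := by
        have := rpow_le_two h0 h1 hx
        gcongr

theorem fun1_bound1 (h0 : 0 < ε) (h1 : ε < 1) (v : ℝ × BC) {x : ℝ} (hx : x ∈ Ioo (-1 : ℝ) 1) :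
    |(1 + x) ^ ε * deriv (fun1 ε v) x| ≤ (cst ε + 6 * cst' ε) * ‖v‖ := by
  have hc := cst'_pos h0 h1
  have a := abs_dPrim_le h0 h1 v hx
  have b := abs_prim_le' h0 h1 v (by norm_num : (1 : ℝ) ∈ Icc (-1 : ℝ) 1)
  have c := abs_prim_le' h0 h1 v (by norm_num : (-1 : ℝ) ∈ Icc (-1 : ℝ) 1)
  have ha : |(1 + 2 * x) / 2| ≤ 3 / 2 := by rw [abs_le]; constructor <;> linarith [hx.1, hx.2]
  have hb : |(2 * x - 1) / 2| ≤ 3 / 2 := by rw [abs_le]; constructor <;> linarith [hx.1, hx.2]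
  rw [(fun1_hasDerivAt v hx).deriv]
  refine (weight_mul_le h0 h1 hx (A := cst ε * ‖v‖) (B := 3 * (cst' ε * ‖v‖)) (by positivity)
    ?_).trans (le_of_eq (by ring))
  calc _ ≤ |dPrim ε v x| + |prim ε v 1| * |(1 + 2 * x) / 2|
        + |prim ε v (-1)| * |(2 * x - 1) / 2| := by
        rw [← abs_mul, ← abs_mul]
        exact (abs_sub _ _).trans (add_le_add (abs_sub _ _) le_rfl)
    _ ≤ cst ε * ‖v‖ * (1 + x) ^ (-ε) + cst' ε * ‖v‖ * (3 / 2) + cst' ε * ‖v‖ * (3 / 2) := by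
        gcongr
    _ = _ := by ring

theorem fun1_bound2 (h0 : 0 < ε) (h1 : ε < 1) (v : ℝ × BC) {x : ℝ} (hx : x ∈ Ioo (0 : ℝ) 1) :
    |deriv (deriv (fun1 ε v)) x| ≤ (1 + 2 * cst' ε) * ‖v‖ := by
  have hx' : x ∈ Ioo (-1 : ℝ) 1 := ⟨by linarith [hx.1], hx.2⟩
  have b := abs_prim_le' h0 h1 v (by norm_num : (1 : ℝ) ∈ Icc (-1 : ℝ) 1)
  have c := abs_prim_le' h0 h1 v (by norm_num : (-1 : ℝ) ∈ Icc (-1 : ℝ) 1)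
  have a := abs_wt_le (-1 - ε) v.2 hx'
  have hp : (1 + x) ^ (-1 - ε) ≤ 1 :=
    Real.rpow_le_one_of_one_le_of_nonpos (by linarith [hx.1]) (by linarith)
  have a' : |wt (-1 - ε) v.2 x| ≤ ‖v‖ :=
    a.trans ((mul_le_of_le_one_right (norm_nonneg _) hp).trans (norm_snd_le v))
  rw [(fun1_deriv_hasDerivAt v hx').deriv]
  calc _ ≤ |wt (-1 - ε) v.2 x| + |prim ε v 1| + |prim ε v (-1)| :=
        (abs_sub _ _).trans (add_le_add (abs_sub _ _) le_rfl)
    _ ≤ _ := by linarith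

theorem fun2_bound0 (h0 : 0 < ε) (h1 : ε < 1) (v : ℝ × BC) {x : ℝ} (hx : x ∈ Ioo (-1 : ℝ) 1) :
    |fun2 ε v x| ≤ 2 * cst' ε * ‖v‖ := by
  have hc := cst'_pos h0 h1
  have a := abs_prim_le' h0 h1 v (Ioo_subset_Icc_self hx)
  have b := abs_prim_le' h0 h1 v (by norm_num : (1 : ℝ) ∈ Icc (-1 : ℝ) 1)
  have hx1 : |x| ≤ 1 := abs_le.2 ⟨hx.1.le, hx.2.le⟩
  rw [fun2_eqOn v (Ioo_subset_Ioc_self hx)]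
  calc _ ≤ |prim ε v x| + |prim ε v 1| * |x| := by
        rw [← abs_mul]; exact abs_sub _ _
    _ ≤ cst' ε * ‖v‖ + cst' ε * ‖v‖ * 1 := by gcongr
    _ = _ := by ring

theorem fun2_bound1 (h0 : 0 < ε) (h1 : ε < 1) (v : ℝ × BC) {x : ℝ} (hx : x ∈ Ioo (-1 : ℝ) 1) :
    |(1 + x) ^ ε * deriv (fun2 ε v) x| ≤ (cst ε + 2 * cst' ε) * ‖v‖ := by
  have hc := cst'_pos h0 h1
  rw [(fun2_hasDerivAt v hx).deriv]
  refine (weight_mul_le h0 h1 hx (A := cst ε * ‖v‖) (B := cst' ε * ‖v‖) (by positivity)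
    ?_).trans (le_of_eq (by ring))
  exact (abs_sub _ _).trans (add_le_add (abs_dPrim_le h0 h1 v hx)
    (abs_prim_le' h0 h1 v (by norm_num)))

theorem fun2_bound2 (v : ℝ × BC) {x : ℝ} (hx : x ∈ Ioo (-1 : ℝ) 1) :
    |(1 + x) ^ (1 + ε) * deriv (deriv (fun2 ε v)) x| ≤ 1 * ‖v‖ := by
  have hx1 : 0 < 1 + x := by linarith [hx.1]
  rw [(fun2_deriv_hasDerivAt v hx).deriv, wt, ← mul_assoc, ← Real.rpow_add hx1,
    show 1 + ε + (-1 - ε) = 0 by ring, Real.rpow_zero, one_mul, one_mul]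
  exact (v.2.abs_ext_le x).trans (norm_snd_le v)

theorem fun1_mem (h0 : 0 < ε) (h1 : ε < 1) (v : ℝ × BC) : MemM1 ε (fun1 ε v) where
  zero_off _ hx := if_neg hx
  cont := ((prim_continuousOn h0 h1 v).sub (by fun_prop) |>.sub (by fun_prop)).congr (fun1_eqOn v)
  c1 := (((prim_contDiffOn v).mono Ioc_subset_Ioi_self).sub (by fun_prop) |>.sub
    (by fun_prop)).congr fun x hx => fun1_eqOn v (Ioc_subset_Icc_self hx)
  c2 := (((prim_contDiffOn_two v).mono (Ioo_subset_Ioo_left (by norm_num))).sub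
    (by fun_prop) |>.sub (by fun_prop)).congr fun x hx =>
      fun1_eqOn v ⟨by linarith [hx.1], hx.2.le⟩
  right := by rw [fun1_eqOn v (by norm_num)]; norm_num
  left := by rw [fun1_eqOn v (by norm_num)]; norm_num
  bdd0 := ⟨_, fun _ => fun1_bound0 h0 h1 v⟩
  bdd1 := ⟨_, fun _ => fun1_bound1 h0 h1 v⟩
  bdd2 := ⟨_, fun _ => fun1_bound2 h0 h1 v⟩

theorem fun2_mem (h0 : 0 < ε) (h1 : ε < 1) (v : ℝ × BC) : MemM2 ε (fun2 ε v) where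
  zero_off _ hx := if_neg hx
  c1 := (((prim_contDiffOn v).mono Ioc_subset_Ioi_self).sub (by fun_prop)).congr (fun2_eqOn v)
  c2 := ((prim_contDiffOn_two v).sub (by fun_prop)).congr fun x hx =>
    fun2_eqOn v (Ioo_subset_Ioc_self hx)
  right := by rw [fun2_eqOn v (by norm_num)]; norm_num
  bdd0 := ⟨_, fun _ => fun2_bound0 h0 h1 v⟩
  bdd1 := ⟨_, fun _ => fun2_bound1 h0 h1 v⟩
  bdd2 := ⟨_, fun _ => fun2_bound2 v⟩

/-- The element of `M₁(ε)` given by `fun1`. -/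
def toM1 (h0 : 0 < ε) (h1 : ε < 1) : ℝ × BC →L[ℝ] M1 ε :=
  LinearMap.mkContinuous
    { toFun := fun v => (⟨fun1 ε v, fun1_mem h0 h1 v⟩ : M1Sub ε)
      map_add' := fun v w => by
        refine Subtype.ext (funext fun x => ?_)
        change fun1 ε (v + w) x = fun1 ε v x + fun1 ε w x
        by_cases hx : x ∈ Icc (-1 : ℝ) 1
        · simp only [fun1_eqOn _ hx, prim_add h0 h1 v w hx,
            prim_add h0 h1 v w (by norm_num : (1 : ℝ) ∈ _),
            prim_add h0 h1 v w (by norm_num : (-1 : ℝ) ∈ _)]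
          ring
        · simp only [fun1, if_neg hx, add_zero]
      map_smul' := fun c v => by
        refine Subtype.ext (funext fun x => ?_)
        change fun1 ε (c • v) x = c * fun1 ε v x
        by_cases hx : x ∈ Icc (-1 : ℝ) 1
        · simp only [fun1_eqOn _ hx, prim_smul]
          ring
        · simp only [fun1, if_neg hx, mul_zero] }
    (5 * cst' ε + (cst ε + 6 * cst' ε) + (1 + 2 * cst' ε)) (fun v => by
      have a := cst_pos h0
      have b := cst'_pos h0 h1
      rw [add_mul, add_mul]
      refine add_le_add (add_le_add ?_ ?_) ?_
      · exact supOn_le (by positivity) fun x hx => fun1_bound0 h0 h1 v hx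
      · exact supOn_le (by positivity) fun x hx => fun1_bound1 h0 h1 v hx
      · exact supOn_le (by positivity) fun x hx => fun1_bound2 h0 h1 v hx)

/-- The element of `M₂(ε)` given by `fun2`. -/
def toM2 (h0 : 0 < ε) (h1 : ε < 1) : ℝ × BC →L[ℝ] M2 ε :=
  LinearMap.mkContinuous
    { toFun := fun v => (⟨fun2 ε v, fun2_mem h0 h1 v⟩ : M2Sub ε)
      map_add' := fun v w => by
        refine Subtype.ext (funext fun x => ?_)
        change fun2 ε (v + w) x = fun2 ε v x + fun2 ε w x
        by_cases hx : x ∈ Ioc (-1 : ℝ) 1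
        · simp only [fun2_eqOn _ hx, prim_add h0 h1 v w (Ioc_subset_Icc_self hx),
            prim_add h0 h1 v w (by norm_num : (1 : ℝ) ∈ _)]
          ring
        · simp only [fun2, if_neg hx, add_zero]
      map_smul' := fun c v => by
        refine Subtype.ext (funext fun x => ?_)
        change fun2 ε (c • v) x = c * fun2 ε v x
        by_cases hx : x ∈ Ioc (-1 : ℝ) 1
        · simp only [fun2_eqOn _ hx, prim_smul]
          ring
        · simp only [fun2, if_neg hx, mul_zero] }
    (2 * cst' ε + (cst ε + 2 * cst' ε) + 1) (fun v => by
      have a := cst_pos h0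
      have b := cst'_pos h0 h1
      rw [add_mul, add_mul]
      refine add_le_add (add_le_add ?_ ?_) ?_
      · exact supOn_le (by positivity) fun x hx => fun2_bound0 h0 h1 v hx
      · exact supOn_le (by positivity) fun x hx => fun2_bound1 h0 h1 v hx
      · exact supOn_le (by positivity) fun x hx => fun2_bound2 v hx)

/-- The element of `X₁(ε)` with given first derivatives at `0` and second derivatives. -/
def toX1 (h0 : 0 < ε) (h1 : ε < 1) : (ℝ × BC) × (ℝ × BC) →L[ℝ] X1 ε :=
  ContinuousLinearMap.codRestrict
    ((WithLp.prodContinuousLinearEquiv 1 ℝ (M1 ε) (M2 ε)).symm.toContinuousLinearMap ∘L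
      ((toM1 h0 h1).prodMap (toM2 h0 h1))) (X1 ε) (fun v => by
    refine ⟨?_, ?_⟩
    · change fun1 ε v.1 0 = 0
      rw [fun1_eqOn _ (by norm_num)]
      simp [prim_zero]
    · change fun2 ε v.2 0 = 0
      rw [fun2_eqOn _ (by norm_num)]
      simp [prim_zero])

theorem toX1_toFun (h0 : 0 < ε) (h1 : ε < 1) (v : (ℝ × BC) × (ℝ × BC)) (x : ℝ) :
    X.toFun (toX1 h0 h1 v : X ε) x = (fun1 ε v.1 x, fun2 ε v.2 x) := rfl

end

section

/-! ### The integral equation -/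

variable {ε : ℝ}

/-- The plane of the parameters `β`. -/
abbrev Plane : Type := EuclideanSpace ℝ (Fin 2)

/-- `(1 + x)^ε exp(-b - ∫_0^x (1 + s)^{-ε} y)`; the derivative of the swirl is a multiple of
`(1 + x)^{-ε}` times this function. -/
def swirl (ε : ℝ) (p : ℝ × ℝ) (y : BC) : BC := fund ε p * NormedSpace.exp (-hOp ε y)

/-- The multiple that makes the swirl at `0` equal to that of `t V²`. -/
def amp (ε : ℝ) (p : ℝ × ℝ) (t : ℝ) (y : BC) : ℝ :=
  t * (massOp ε (fund ε p) / massOp ε (swirl ε p y))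

/-- The product of the swirl and its derivative, up to weights and a constant. -/
def prodB (ε : ℝ) (p : ℝ × ℝ) (y : BC) : BC := gOp ε (swirl ε p y) * swirl ε p y

/-- The nonlinear part of the equation `(1 + x) y' = (ε - w) y + src`. -/
def src (ε : ℝ) (p : ℝ × ℝ) (t : ℝ) (y : BC) : BC :=
  -((1 / 2 : ℝ) • (pw (1 - ε) * (y * y)))
    - (2 * amp ε p t y ^ 2) • (pw ε * qOp ε (prodB ε p y))

/-- The map whose zeros are the solutions. -/
def eqn (ε : ℝ) (v : ((ℝ × ℝ) × Plane) × BC) : BC :=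
  v.2 - v.1.2 0 • fund ε v.1.1 - eulerSolver (fund ε v.1.1) (src ε v.1.1 (v.1.2 1) v.2)

/-- `1 - x`. -/
def om : BC := (2 : ℝ) • (1 : BC) - pw 1

/-- The Euler derivative of `w`. -/
def dw (p : ℝ × ℝ) : BC := p.1 • (1 : BC) + wB p - (1 / 2 : ℝ) • (wB p * wB p)

/-- The right hand side `(ε - w) y + z` of the equation. -/
def rhs (ε : ℝ) (p : ℝ × ℝ) (y z : BC) : BC := (ε • (1 : BC) - wB p) * y + z

/-- The Euler derivative of `src` at a solution `y`. -/
def dsrc (ε : ℝ) (p : ℝ × ℝ) (t : ℝ) (y : BC) : BC :=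
  -((1 / 2 : ℝ) • (((1 - ε) • pw (1 - ε)) * (y * y)
      + pw (1 - ε) * (rhs ε p y (src ε p t y) * y + y * rhs ε p y (src ε p t y))))
    - (2 * amp ε p t y ^ 2) • ((ε • pw ε) * qOp ε (prodB ε p y)
      + pw ε * (dOp ε (prodB ε p y) - qOp ε (prodB ε p y)))

/-- `(1 + x)^ε` times the derivative of `(1 - x)(1 + x)^{1-ε} e`, where `e` solves
`(1 + x) e' = (ε - w) e + z`. -/
def vel1 (p : ℝ × ℝ) (e z : BC) : BC := om * ((1 - wB p) * e + z) - pw 1 * e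

/-- The Euler derivative of `vel1`, where `z'` is that of `z`. -/
def dvel1 (ε : ℝ) (p : ℝ × ℝ) (e z z' : BC) : BC :=
  (-pw 1) * ((1 - wB p) * e + z) + om * ((-dw p) * e + (1 - wB p) * rhs ε p e z + z')
    - (pw 1 * e + pw 1 * rhs ε p e z)

/-- The derivatives that determine the correction `V`. -/
def corrData (ε : ℝ) (v : ((ℝ × ℝ) × Plane) × BC) : (ℝ × BC) × (ℝ × BC) :=
  let p := v.1.1
  let t := v.1.2 1
  let y := v.2
  let z := src ε p t y
  let e := eulerSolver (fund ε p) z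
  -- Data of `f = (1-x)(1+x)^{1-ε} e`, where `e` is `y` minus its `β₁ fund` part when `y` solves the
  -- equation: then `f' = (1+x)^{-ε} vel1` and `f'' = (1+x)^{-1-ε}(dvel1 - ε vel1)`.
  ((BC.evalZero (vel1 p e z), dvel1 ε p e z (dsrc ε p t y) - ε • vel1 p e z),
    -- Data of the swirl minus that of `t V²`; both weights equal `1` at `0`, which gives the first
    -- entry.
    (t - amp ε p t y, amp ε p t y • ((wB p + pw (1 - ε) * y) * swirl ε p y)
      - t • (wB p * fund ε p)))

theorem swirl_ext_pos {p : ℝ × ℝ} (hp : p ∈ dom ε) (y : BC) {x : ℝ} (hx : x ∈ Ioo (-1 : ℝ) 1) :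
    0 < (swirl ε p y).ext x := by
  rw [swirl, BC.ext_mul, BC.ext_exp _ hx]
  exact mul_pos ((fund_isEulerWeight hp).pos hx) (Real.exp_pos _)

theorem massOp_swirl_pos (h0 : 0 < ε) (h1 : ε < 1) {p : ℝ × ℝ} (hp : p ∈ dom ε) (y : BC) :
    0 < massOp ε (swirl ε p y) :=
  massOp_pos h0 h1 fun _ hx => swirl_ext_pos hp y hx

section Smooth

variable {v : ((ℝ × ℝ) × Plane) × BC}

theorem contDiffAt_fund_comp (hp : v.1.1 ∈ dom ε) :
    ContDiffAt ℝ ω (fun v : ((ℝ × ℝ) × Plane) × BC => fund ε v.1.1) v :=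
  (contDiffAt_fund hp).1.comp (f := fun v : ((ℝ × ℝ) × Plane) × BC => v.1.1) v (by fun_prop)

theorem contDiffAt_solver_comp (hp : v.1.1 ∈ dom ε) :
    ContDiffAt ℝ ω (fun v : ((ℝ × ℝ) × Plane) × BC => eulerSolver (fund ε v.1.1)) v :=
  (contDiffAt_fund hp).2.comp (f := fun v : ((ℝ × ℝ) × Plane) × BC => v.1.1) v (by fun_prop)

theorem contDiffAt_wB_comp (hp : v.1.1 ∈ dom ε) :
    ContDiffAt ℝ ω (fun v : ((ℝ × ℝ) × Plane) × BC => wB v.1.1) v :=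
  (contDiffAt_wB hp.1).comp (f := fun v : ((ℝ × ℝ) × Plane) × BC => v.1.1) v (by fun_prop)

theorem contDiffAt_swirl (hp : v.1.1 ∈ dom ε) :
    ContDiffAt ℝ ω (fun v : ((ℝ × ℝ) × Plane) × BC => swirl ε v.1.1 v.2) v := by
  have h := contDiffAt_fund_comp hp
  have he : ContDiff ℝ ω (NormedSpace.exp : BC → BC) := by
    rw [contDiff_iff_contDiffAt]
    exact fun u => (NormedSpace.exp_analytic (𝕂 := ℝ) u).contDiffAt
  have h2 : ContDiffAt ℝ ω (fun v : ((ℝ × ℝ) × Plane) × BC => NormedSpace.exp (-hOp ε v.2)) v :=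
    he.contDiffAt.comp v (by fun_prop)
  exact h.mul h2

theorem contDiffAt_amp (h0 : 0 < ε) (h1 : ε < 1) (hp : v.1.1 ∈ dom ε) :
    ContDiffAt ℝ ω (fun v : ((ℝ × ℝ) × Plane) × BC => amp ε v.1.1 (v.1.2 1) v.2) v := by
  have h := contDiffAt_fund_comp hp
  have h2 := contDiffAt_swirl hp
  have h3 : ContDiffAt ℝ ω
      (fun v : ((ℝ × ℝ) × Plane) × BC => massOp ε (swirl ε v.1.1 v.2)) v := by fun_prop
  have h4 := h3.inv (massOp_swirl_pos h0 h1 hp v.2).ne'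
  have h5 : ContDiffAt ℝ ω (fun v : ((ℝ × ℝ) × Plane) × BC => massOp ε (fund ε v.1.1)) v := by
    fun_prop
  have h6 : ContDiffAt ℝ ω (fun v : ((ℝ × ℝ) × Plane) × BC => v.1.2 1) v := by fun_prop
  simp only [amp, div_eq_mul_inv]
  exact h6.mul (h5.mul h4)

theorem contDiffAt_prodB (hp : v.1.1 ∈ dom ε) :
    ContDiffAt ℝ ω (fun v : ((ℝ × ℝ) × Plane) × BC => prodB ε v.1.1 v.2) v := by
  have h2 := contDiffAt_swirl hp
  unfold prodB
  fun_prop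

theorem contDiffAt_src (h0 : 0 < ε) (h1 : ε < 1) (hp : v.1.1 ∈ dom ε) :
    ContDiffAt ℝ ω (fun v : ((ℝ × ℝ) × Plane) × BC => src ε v.1.1 (v.1.2 1) v.2) v := by
  have h2 := contDiffAt_amp h0 h1 hp
  have h3 := contDiffAt_prodB hp
  unfold src
  fun_prop

theorem contDiffAt_eqn (h0 : 0 < ε) (h1 : ε < 1) (hp : v.1.1 ∈ dom ε) :
    ContDiffAt ℝ ω (eqn ε) v := by
  have h2 := contDiffAt_src h0 h1 hp
  have h3 := contDiffAt_fund_comp hp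
  have h4 := (contDiffAt_solver_comp hp).clm_apply h2
  unfold eqn
  fun_prop

/-- Derivatives of `y` have been replaced by `rhs`, so only bounded operators, products and the
analytic coefficients occur; no derivative is lost. -/
theorem contDiffAt_corrData (h0 : 0 < ε) (h1 : ε < 1) (hp : v.1.1 ∈ dom ε) :
    ContDiffAt ℝ ω (corrData ε) v := by
  have a1 := contDiffAt_src h0 h1 hp
  have a2 := contDiffAt_fund_comp hp
  have a3 := (contDiffAt_solver_comp hp).clm_apply a1
  have a4 := contDiffAt_wB_comp hp
  have a5 := contDiffAt_swirl hp
  have a6 := contDiffAt_amp h0 h1 hp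
  have a7 := contDiffAt_prodB hp
  have b1 : ContDiffAt ℝ ω (fun v : ((ℝ × ℝ) × Plane) × BC => vel1 v.1.1
      (eulerSolver (fund ε v.1.1) (src ε v.1.1 (v.1.2 1) v.2)) (src ε v.1.1 (v.1.2 1) v.2)) v := by
    unfold vel1
    fun_prop
  have b2 : ContDiffAt ℝ ω (fun v : ((ℝ × ℝ) × Plane) × BC =>
      dsrc ε v.1.1 (v.1.2 1) v.2) v := by
    unfold dsrc rhs
    fun_prop
  have b3 : ContDiffAt ℝ ω (fun v : ((ℝ × ℝ) × Plane) × BC => dvel1 ε v.1.1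
      (eulerSolver (fund ε v.1.1) (src ε v.1.1 (v.1.2 1) v.2)) (src ε v.1.1 (v.1.2 1) v.2)
      (dsrc ε v.1.1 (v.1.2 1) v.2)) v := by
    unfold dvel1 rhs dw
    fun_prop
  have b4 := BC.evalZero.contDiff.contDiffAt.comp v b1
  have b5 : ContDiffAt ℝ ω (fun v : ((ℝ × ℝ) × Plane) × BC => v.1.2 1) v := by fun_prop
  have b6 : ContDiffAt ℝ ω (fun v : ((ℝ × ℝ) × Plane) × BC =>
      amp ε v.1.1 (v.1.2 1) v.2 • ((wB v.1.1 + pw (1 - ε) * v.2) * swirl ε v.1.1 v.2)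
        - v.1.2 1 • (wB v.1.1 * fund ε v.1.1)) v := by fun_prop
  exact (b4.prodMk (b3.sub (b1.const_smul ε))).prodMk ((b5.sub a6).prodMk b6)

end Smooth

/-! ### The linearisation at `β = 0` -/

theorem amp_zero (p : ℝ × ℝ) (y : BC) : amp ε p 0 y = 0 := by rw [amp, zero_mul]

theorem src_zero (p : ℝ × ℝ) (y : BC) :
    src ε p 0 y = -((1 / 2 : ℝ) • (pw (1 - ε) * (y * y))) := by
  simp [src, amp_zero]

theorem eqn_zero (p : ℝ × ℝ) : eqn ε ((p, 0), 0) = 0 := by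
  simp [eqn, src_zero]

/-- At `β = 0` the amplitude vanishes and the remaining nonlinearity is quadratic in `y`. -/
theorem hasFDerivAt_eqn (p : ℝ × ℝ) :
    HasFDerivAt (fun y => eqn ε ((p, 0), y)) (ContinuousLinearMap.id ℝ BC) 0 := by
  let L : BC →L[ℝ] BC := eulerSolver (fund ε p) ∘L mulOp ((1 / 2 : ℝ) • pw (1 - ε))
  have e : (fun y => eqn ε ((p, 0), y)) = fun y => y + L (y * y) := by
    funext y
    simp [eqn, src_zero, L, mulOp_apply]
  have h1 : HasFDerivAt (fun y : BC => y * y) (0 : BC →L[ℝ] BC) 0 := by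
    have := (hasFDerivAt_id (𝕜 := ℝ) (0 : BC)).mul (hasFDerivAt_id (𝕜 := ℝ) (0 : BC))
    exact this.congr_fderiv (by ext u; simp)
  have h2 := (hasFDerivAt_id (𝕜 := ℝ) (0 : BC)).add (L.hasFDerivAt.comp (0 : BC) h1)
  rw [e]
  rw [ContinuousLinearMap.comp_zero, add_zero] at h2
  exact h2

/-- `f` vanishes at `0` together with its derivative. -/
def Flat {E F : Type*} [NormedAddCommGroup E] [NormedSpace ℝ E] [NormedAddCommGroup F]
    [NormedSpace ℝ F] (f : E → F) : Prop := f 0 = 0 ∧ HasFDerivAt f (0 : E →L[ℝ] F) 0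

namespace Flat

variable {E F G : Type*} [NormedAddCommGroup E] [NormedSpace ℝ E] [NormedAddCommGroup F]
  [NormedSpace ℝ F] [NormedAddCommGroup G] [NormedSpace ℝ G]

theorem add {f g : E → F} (hf : Flat f) (hg : Flat g) : Flat fun x => f x + g x :=
  ⟨by simp only [hf.1, hg.1, add_zero], (hf.2.add hg.2).congr_fderiv (add_zero 0)⟩

theorem neg {f : E → F} (hf : Flat f) : Flat fun x => -f x :=
  ⟨by simp only [hf.1, neg_zero], hf.2.neg.congr_fderiv neg_zero⟩

theorem sub {f g : E → F} (hf : Flat f) (hg : Flat g) : Flat fun x => f x - g x := by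
  simpa only [sub_eq_add_neg] using hf.add hg.neg

theorem clm (L : F →L[ℝ] G) {f : E → F} (hf : Flat f) : Flat fun x => L (f x) :=
  ⟨by simp only [hf.1, map_zero],
    (L.hasFDerivAt.comp (0 : E) hf.2).congr_fderiv (ContinuousLinearMap.comp_zero L)⟩

theorem const_smul (c : ℝ) {f : E → F} (hf : Flat f) : Flat fun x => c • f x :=
  hf.clm (c • ContinuousLinearMap.id ℝ F)

theorem const_mul (a : BC) {f : E → BC} (hf : Flat f) : Flat fun x => a * f x :=
  hf.clm (mulOp a)

theorem prodMk {f : E → F} {g : E → G} (hf : Flat f) (hg : Flat g) : Flat fun x => (f x, g x) :=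
  ⟨by simp only [hf.1, hg.1]; rfl, (hf.2.prodMk hg.2).congr_fderiv rfl⟩

theorem smul_right {c : E → ℝ} {f : E → F} (hc : Flat c) (hf : DifferentiableAt ℝ f 0) :
    Flat fun x => c x • f x := by
  refine ⟨by simp only [hc.1, zero_smul], (hc.2.smul hf.hasFDerivAt).congr_fderiv ?_⟩
  ext x
  simp [hc.1]

theorem smul_of_vanish {c : E → ℝ} {f : E → F} (hc : DifferentiableAt ℝ c 0)
    (hf : DifferentiableAt ℝ f 0) (hc0 : c 0 = 0) (hf0 : f 0 = 0) : Flat fun x => c x • f x := by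
  refine ⟨by simp only [hc0, zero_smul],
    (hc.hasFDerivAt.smul hf.hasFDerivAt).congr_fderiv ?_⟩
  ext x
  simp [hc0, hf0]

theorem mul_of_vanish {A : Type*} [NormedCommRing A] [NormedAlgebra ℝ A] {f g : E → A}
    (hf : DifferentiableAt ℝ f 0) (hg : DifferentiableAt ℝ g 0) (hf0 : f 0 = 0) (hg0 : g 0 = 0) :
    Flat fun x => f x * g x := by
  refine ⟨by simp only [hf0, zero_mul], (hf.hasFDerivAt.mul hg.hasFDerivAt).congr_fderiv ?_⟩
  ext x
  simp [hf0, hg0]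

end Flat

theorem massOp_fund_pos (h0 : 0 < ε) (h1 : ε < 1) {p : ℝ × ℝ} (hp : p ∈ dom ε) :
    0 < massOp ε (fund ε p) :=
  massOp_pos h0 h1 fun _ hx => (fund_isEulerWeight hp).pos hx

theorem swirl_zero (p : ℝ × ℝ) : swirl ε p 0 = fund ε p := by
  rw [swirl, map_zero, neg_zero, NormedSpace.exp_zero, mul_one]

/-- `y`, `amp` and `rhs` vanish at `β = 0`, and each entry is built linearly from products of two
vanishing factors, possibly times a differentiable one. -/
theorem flat_corrData (h0 : 0 < ε) (h1 : ε < 1) {p : ℝ × ℝ} (hp : p ∈ dom ε) {y : Plane → BC}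
    (hy : DifferentiableAt ℝ y 0) (hy0 : y 0 = 0) :
    Flat fun β : Plane => corrData ε ((p, β), y β) := by
  have hq : DifferentiableAt ℝ (fun β : Plane => (((p, β), y β) : ((ℝ × ℝ) × Plane) × BC)) 0 := by
    fun_prop
  have hcomp : ∀ {F : Type} [NormedAddCommGroup F] [NormedSpace ℝ F]
      (f : ((ℝ × ℝ) × Plane) × BC → F), ContDiffAt ℝ ω f ((p, 0), y 0) →
      DifferentiableAt ℝ (fun β : Plane => f ((p, β), y β)) 0 := fun f hf =>
    (hf.differentiableAt (by simp)).comp (0 : Plane) hq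
  have hpv : ((p, (0 : Plane)), y 0).1.1 ∈ dom ε := hp
  have d1 : DifferentiableAt ℝ (fun β : Plane => amp ε p (β 1) (y β)) 0 :=
    hcomp _ (contDiffAt_amp h0 h1 hpv)
  have d2 : DifferentiableAt ℝ (fun β : Plane => prodB ε p (y β)) 0 :=
    hcomp _ (contDiffAt_prodB hpv)
  have d3 : DifferentiableAt ℝ (fun β : Plane => src ε p (β 1) (y β)) 0 :=
    hcomp _ (contDiffAt_src h0 h1 hpv)
  have d4 : DifferentiableAt ℝ (fun β : Plane => swirl ε p (y β)) 0 :=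
    hcomp _ (contDiffAt_swirl hpv)
  have d5 : DifferentiableAt ℝ (fun β : Plane => β 1) 0 := by fun_prop
  have v1 : amp ε p ((0 : Plane) 1) (y 0) = 0 := amp_zero p _
  have fa : Flat fun β : Plane => 2 * amp ε p (β 1) (y β) ^ 2 := by
    simp only [pow_two]
    exact (Flat.mul_of_vanish d1 d1 v1 v1).const_smul 2
  have fyy : Flat fun β : Plane => y β * y β := Flat.mul_of_vanish hy hy hy0 hy0
  have fs : Flat fun β : Plane => src ε p (β 1) (y β) :=
    ((fyy.const_mul (pw (1 - ε))).const_smul (1 / 2)).neg.sub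
      (fa.smul_right (f := fun β => pw ε * qOp ε (prodB ε p (y β))) (by fun_prop))
  have fe : Flat fun β : Plane => eulerSolver (fund ε p) (src ε p (β 1) (y β)) :=
    fs.clm (eulerSolver (fund ε p))
  have dr : DifferentiableAt ℝ (fun β : Plane => rhs ε p (y β) (src ε p (β 1) (y β))) 0 := by
    unfold rhs; fun_prop
  have vr : rhs ε p (y 0) (src ε p ((0 : Plane) 1) (y 0)) = 0 := by
    have h2 : src ε p ((0 : Plane) 1) (y 0) = 0 := fs.1
    rw [rhs, h2, hy0, mul_zero, zero_add]
  have fds : Flat fun β : Plane => dsrc ε p (β 1) (y β) :=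
    (((fyy.const_mul _).add (((Flat.mul_of_vanish dr hy vr hy0).add
      (Flat.mul_of_vanish hy dr hy0 vr)).const_mul _)).const_smul (1 / 2)).neg.sub
      (fa.smul_right (f := fun β => (ε • pw ε) * qOp ε (prodB ε p (y β))
        + pw ε * (dOp ε (prodB ε p (y β)) - qOp ε (prodB ε p (y β)))) (by fun_prop))
  have fv : Flat fun β : Plane => vel1 p (eulerSolver (fund ε p) (src ε p (β 1) (y β)))
      (src ε p (β 1) (y β)) :=
    (((fe.const_mul _).add fs).const_mul _).sub (fe.const_mul _)
  have fre : Flat fun β : Plane => rhs ε p (eulerSolver (fund ε p) (src ε p (β 1) (y β)))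
      (src ε p (β 1) (y β)) := (fe.const_mul _).add fs
  have fdv : Flat fun β : Plane => dvel1 ε p (eulerSolver (fund ε p) (src ε p (β 1) (y β)))
      (src ε p (β 1) (y β)) (dsrc ε p (β 1) (y β)) :=
    ((((fe.const_mul _).add fs).const_mul _).add
      ((((fe.const_mul _).add (fre.const_mul _)).add fds).const_mul _)).sub
      ((fe.const_mul _).add (fre.const_mul _))
  have hm := (massOp_fund_pos h0 h1 hp).ne'
  have dq : DifferentiableAt ℝ
      (fun β : Plane => 1 - massOp ε (fund ε p) / massOp ε (swirl ε p (y β))) 0 := by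
    have a : DifferentiableAt ℝ (fun β : Plane => massOp ε (swirl ε p (y β))) 0 := by fun_prop
    have b := a.inv (massOp_swirl_pos h0 h1 hp (y 0)).ne'
    simp only [div_eq_mul_inv]
    exact (b.const_mul _).const_sub 1
  have vq : 1 - massOp ε (fund ε p) / massOp ε (swirl ε p (y 0)) = 0 := by
    rw [hy0, swirl_zero, div_self hm, sub_self]
  -- The difference is `β 1` times `1` minus the ratio of masses, and that ratio is `1` at `y = 0`.
  have ft : Flat fun β : Plane => β 1 - amp ε p (β 1) (y β) := by
    have := Flat.mul_of_vanish d5 dq rfl vq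
    simpa only [mul_sub, mul_one, amp] using this
  have fr2 : Flat fun β : Plane => amp ε p (β 1) (y β) •
      ((wB p + pw (1 - ε) * y β) * swirl ε p (y β)) - β 1 • (wB p * fund ε p) := by
    have a := ft.smul_right (f := fun β => (wB p + pw (1 - ε) * y β) * swirl ε p (y β))
      (by fun_prop)
    have b := Flat.smul_of_vanish (c := fun β : Plane => β 1)
      (f := fun β => (wB p + pw (1 - ε) * y β) * swirl ε p (y β) - wB p * fund ε p) d5
      (by fun_prop) rfl (by simp only [hy0, swirl_zero, mul_zero, add_zero, sub_self])
    have c := b.sub a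
    -- Here `s` is the amplitude and `t = β 1`: the change of profile is multiplied by the small
    -- `t`, and the change of amplitude `t - s` is already flat.
    have e : ∀ (s t : ℝ) (u v : BC), t • (u - v) - (t - s) • u = s • u - t • v := by
      intro s t u v
      module
    simpa only [e] using c
  exact ((fv.clm BC.evalZero).prodMk (fdv.sub (fv.const_smul ε))).prodMk (ft.prodMk fr2)

end

section

/-! ### From the integral equation to the reduced system -/

variable {ε : ℝ} {p : ℝ × ℝ}

theorem hasEuler_one : HasEuler 1 0 := fun x hx => by
  rw [BC.ext_zero, zero_div]
  refine (hasDerivAt_const x (1 : ℝ)).congr_of_eventuallyEq ?_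
  filter_upwards [isOpen_Ioo.mem_nhds hx] with y hy using BC.ext_one hy

theorem HasEuler.exp {u u' : BC} (h : HasEuler u u') :
    HasEuler (NormedSpace.exp u) (u' * NormedSpace.exp u) := fun x hx => by
  refine ((h x hx).exp.congr_of_eventuallyEq ?_).congr_deriv ?_
  · filter_upwards [isOpen_Ioo.mem_nhds hx] with y hy using BC.ext_exp u hy
  · rw [BC.ext_mul, BC.ext_exp u hx]
    ring

theorem pw_one_hasEuler : HasEuler (pw 1) (pw 1) := by
  simpa only [one_smul] using pw_hasEuler (a := 1) zero_le_one

theorem pw_one_ext {x : ℝ} (hx : x ∈ Ioo (-1 : ℝ) 1) : (pw 1).ext x = 1 + x := by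
  rw [pw_ext zero_le_one hx, Real.rpow_one]

theorem om_ext {x : ℝ} (hx : x ∈ Ioo (-1 : ℝ) 1) : om.ext x = 1 - x := by
  rw [om, BC.ext_sub, BC.ext_smul, BC.ext_one hx, pw_one_ext hx]
  ring

theorem om_hasEuler : HasEuler om (-pw 1) :=
  ((hasEuler_one.smul 2).sub pw_one_hasEuler).congr (by rw [smul_zero, zero_sub])

theorem one_sub_wB_hasEuler (hp : p ∈ I1) : HasEuler (1 - wB p) (-dw p) :=
  (hasEuler_one.sub (wB_hasEuler hp)).congr (zero_sub _)

theorem swirl_hasEuler (h0 : 0 < ε) (h1 : ε < 1) (hp : p ∈ dom ε) (y : BC) :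
    HasEuler (swirl ε p y) ((ε • (1 : BC) - wB p - pw (1 - ε) * y) * swirl ε p y) :=
  ((fund_hasEuler hp).mul (hOp_hasEuler h0 h1 y).neg.exp).congr (by rw [swirl]; ring)

theorem swirl_ext_zero (h0 : 0 < ε) (h1 : ε < 1) (hp : p ∈ dom ε) (y : BC) :
    (swirl ε p y).ext 0 = 1 := by
  rw [swirl, BC.ext_mul, BC.ext_exp _ zero_mem_Ioo, BC.ext_neg, hOp_ext h0 h1 _ zero_mem_Ioo,
    intervalIntegral.integral_same, neg_zero, Real.exp_zero, fund_ext_zero hp, mul_one]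

theorem wt_hasDerivAt (a : ℝ) {v v' : BC} (hv : HasEuler v v') {x : ℝ}
    (hx : x ∈ Ioo (-1 : ℝ) 1) : HasDerivAt (wt a v) (wt (a - 1) (v' + a • v) x) x := by
  have hx1 : 0 < 1 + x := by linarith [hx.1]
  refine ((hasDerivAt_one_add_rpow a hx.1).mul (hv x hx)).congr_deriv ?_
  rw [wt, BC.ext_add, BC.ext_smul, Real.rpow_sub_one hx1.ne']
  field_simp
  ring

theorem src_hasEuler (h0 : 0 < ε) (h1 : ε < 1) (p : ℝ × ℝ) (t : ℝ) {y : BC}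
    (hy : HasEuler y (rhs ε p y (src ε p t y))) : HasEuler (src ε p t y) (dsrc ε p t y) :=
  (((pw_hasEuler (by linarith)).mul (hy.mul hy)).smul _).neg.sub
    (((pw_hasEuler h0.le).mul (qOp_hasEuler h0 h1 _)).smul _)

theorem vel1_hasEuler (hp : p ∈ I1) {e z z' : BC} (he : HasEuler e (rhs ε p e z))
    (hz : HasEuler z z') : HasEuler (vel1 p e z) (dvel1 ε p e z z') :=
  (om_hasEuler.mul (((one_sub_wB_hasEuler hp).mul he).add hz)).sub (pw_one_hasEuler.mul he)

/-- Elements of `BC` are cut off to `0` at `±1` and need not have limits there; continuity of a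
product with a vanishing weight comes from squeezing. -/
theorem continuousOn_of_le_of_vanish {f g : ℝ → ℝ} (hf : ContinuousOn f (Ioo (-1) 1))
    (hg : ContinuousOn g (Icc (-1) 1)) (h : ∀ x ∈ Icc (-1 : ℝ) 1, |f x| ≤ g x)
    (h1 : g 1 = 0) (h2 : g (-1) = 0) : ContinuousOn f (Icc (-1) 1) := by
  have key : ∀ x ∈ Icc (-1 : ℝ) 1, g x = 0 → ContinuousWithinAt f (Icc (-1) 1) x := by
    intro x hx h0
    have hfx : f x = 0 := abs_nonpos_iff.1 ((h x hx).trans h0.le)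
    have hgx : Tendsto g (𝓝[Icc (-1) 1] x) (𝓝 0) := h0 ▸ hg x hx
    rw [ContinuousWithinAt, hfx]
    refine squeeze_zero_norm' ?_ hgx
    filter_upwards [self_mem_nhdsWithin] with y hy using h y hy
  intro x hx
  rcases eq_or_lt_of_le hx.1 with e | e
  · exact key x hx (by rw [← e, h2])
  · rcases eq_or_lt_of_le hx.2 with e' | e'
    · exact key x hx (by rw [e', h1])
    · exact (hf.continuousAt (isOpen_Ioo.mem_nhds ⟨e, e'⟩)).continuousWithinAt

/-- The function on the right vanishes at `-1`, `0` and `1`, so it is the double primitive of its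
data and the interpolation corrections are zero. -/
theorem fun1_eq (h0 : 0 < ε) (h1 : ε < 1) (hp : p ∈ I1) {e z z' : BC}
    (he : HasEuler e (rhs ε p e z)) (hz : HasEuler z z') (he0 : e.ext 0 = 0) {x : ℝ}
    (hx : x ∈ Icc (-1 : ℝ) 1) :
    fun1 ε (BC.evalZero (vel1 p e z), dvel1 ε p e z z' - ε • vel1 p e z) x
      = (1 - x) * (1 + x) ^ (1 - ε) * e.ext x := by
  set f : ℝ → ℝ := fun x => (1 - x) * (1 + x) ^ (1 - ε) * e.ext x with hf
  have hd : ∀ x ∈ Ioo (-1 : ℝ) 1, HasDerivAt f (wt (-ε) (vel1 p e z) x) x := fun x hx => by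
    have hx1 : 0 < 1 + x := by linarith [hx.1]
    refine ((((hasDerivAt_id x).const_sub 1).mul (hasDerivAt_one_add_rpow (1 - ε) hx.1)).mul
      (he x hx)).congr_deriv ?_
    have e1 : (1 + x) ^ (1 - ε) = (1 + x) * (1 + x) ^ (-ε) := by
      rw [sub_eq_add_neg, Real.rpow_add hx1, Real.rpow_one]
    have e2 : (1 + x) ^ (1 - ε - 1) = (1 + x) ^ (-ε) := by congr 1; ring
    simp only [Pi.mul_apply, id, wt, vel1, rhs, BC.ext_sub, BC.ext_mul, BC.ext_add, BC.ext_smul,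
      BC.ext_one hx, om_ext hx, pw_one_ext hx]
    rw [e2, e1]
    field_simp
    ring
  have hd2 : ∀ x ∈ Ioo (-1 : ℝ) 1, HasDerivAt (wt (-ε) (vel1 p e z))
      (wt (-1 - ε) (dvel1 ε p e z z' - ε • vel1 p e z) x) x := fun x hx => by
    refine (wt_hasDerivAt (-ε) (vel1_hasEuler hp he hz) hx).congr_deriv ?_
    rw [neg_smul, ← sub_eq_add_neg, show -ε - 1 = -1 - ε by ring]
  have hc : ContinuousOn f (Icc (-1) 1) := by
    refine continuousOn_of_le_of_vanish (g := fun x => (1 - x) * (1 + x) ^ (1 - ε) * ‖e‖)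
      (fun x hx => (hd x hx).continuousAt.continuousWithinAt) ?_ ?_ ?_ ?_
    · refine ContinuousOn.mul (ContinuousOn.mul (by fun_prop) ?_) continuousOn_const
      exact ContinuousOn.rpow_const (by fun_prop) fun x _ => Or.inr (by linarith)
    · intro x hx
      have a : 0 ≤ (1 - x) * (1 + x) ^ (1 - ε) :=
        mul_nonneg (by linarith [hx.2]) (Real.rpow_nonneg (by linarith [hx.1]) _)
      rw [hf]
      simp only
      rw [abs_mul, abs_of_nonneg a]
      exact mul_le_mul_of_nonneg_left (e.abs_ext_le x) a
    · norm_num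
    · rw [show (1 : ℝ) + -1 = 0 by norm_num, Real.zero_rpow (by linarith)]
      ring
  have hm := eqOn_prim h0 h1 Ioo_subset_Icc_self Subset.rfl hc hd hd2 (by simp [hf, he0])
  have e0 : wt (-ε) (vel1 p e z) 0 = BC.evalZero (vel1 p e z) := by
    rw [wt, add_zero, Real.one_rpow, one_mul, BC.evalZero_apply]
  rw [e0] at hm
  have hm1 := hm (by norm_num : (1 : ℝ) ∈ Icc (-1 : ℝ) 1)
  have hm2 := hm (by norm_num : (-1 : ℝ) ∈ Icc (-1 : ℝ) 1)
  have f1 : f 1 = 0 := by rw [hf]; norm_num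
  have f2 : f (-1) = 0 := by
    rw [hf]
    simp only
    rw [show (1 : ℝ) + -1 = 0 by norm_num, Real.zero_rpow (by linarith)]
    ring
  rw [fun1_eqOn _ hx]
  simp only
  rw [← hm hx, ← hm1, ← hm2, f1, f2]
  ring

/-- The normalisation that makes the swirl correction vanish at `0`, as membership in `X₁` requires.
-/
theorem amp_mul (h0 : 0 < ε) (h1 : ε < 1) (hp : p ∈ dom ε) (t : ℝ) (y : BC) :
    amp ε p t y * tail ε (swirl ε p y) 0 = t * tail ε (fund ε p) 0 := by
  have h := (massOp_swirl_pos h0 h1 hp y).ne'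
  rw [amp, ← massOp_apply h0 h1, ← massOp_apply h0 h1]
  field_simp

theorem fun2_eq (h0 : 0 < ε) (h1 : ε < 1) (hp : p ∈ dom ε) (t : ℝ) (y : BC) {x : ℝ}
    (hx : x ∈ Ioc (-1 : ℝ) 1) :
    fun2 ε (t - amp ε p t y, amp ε p t y • ((wB p + pw (1 - ε) * y) * swirl ε p y)
      - t • (wB p * fund ε p)) x
      = amp ε p t y * tail ε (swirl ε p y) x - t * tail ε (fund ε p) x := by
  set k := amp ε p t y with hk
  set f : ℝ → ℝ := fun x => k * tail ε (swirl ε p y) x - t * tail ε (fund ε p) x with hf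
  have hd : ∀ x ∈ Ioo (-1 : ℝ) 1,
      HasDerivAt f (wt (-ε) (t • fund ε p - k • swirl ε p y) x) x := fun x hx => by
    refine (((tail_hasDerivAt h1 (swirl ε p y) hx).const_mul k).sub
      ((tail_hasDerivAt h1 (fund ε p) hx).const_mul t)).congr_deriv ?_
    simp only [wt, BC.ext_sub, BC.ext_smul]
    ring
  have hd2 : ∀ x ∈ Ioo (-1 : ℝ) 1, HasDerivAt (wt (-ε) (t • fund ε p - k • swirl ε p y))
      (wt (-1 - ε) (k • ((wB p + pw (1 - ε) * y) * swirl ε p y) - t • (wB p * fund ε p)) x) x :=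
      fun x hx => by
    refine (wt_hasDerivAt (-ε) (((fund_hasEuler hp).smul t).sub
      ((swirl_hasEuler h0 h1 hp y).smul k)) hx).congr_deriv ?_
    rw [show -ε - 1 = -1 - ε by ring]
    simp only [wt, BC.ext_sub, BC.ext_smul, BC.ext_add, BC.ext_mul, BC.ext_one hx]
    ring
  have hc : ContinuousOn f (Ioc (-1) 1) :=
    ((continuousOn_const.mul (tail_continuousOn h1 _)).sub
      (continuousOn_const.mul (tail_continuousOn h1 _))).mono Ioc_subset_Icc_self
  have hz : f 0 = 0 := by
    rw [hf]
    simp only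
    rw [hk, amp_mul h0 h1 hp, sub_self]
  have hm := eqOn_prim h0 h1 Ioo_subset_Ioc_self Ioc_subset_Icc_self hc hd hd2 hz
  have e0 : wt (-ε) (t • fund ε p - k • swirl ε p y) 0 = t - k := by
    rw [wt, BC.ext_sub, BC.ext_smul, BC.ext_smul, swirl_ext_zero h0 h1 hp, fund_ext_zero hp,
      add_zero, Real.one_rpow]
    ring
  rw [e0] at hm
  have hm1 := hm (by norm_num : (1 : ℝ) ∈ Ioc (-1 : ℝ) 1)
  have f1 : f 1 = 0 := by simp only [hf, tail_one]; ring
  rw [fun2_eqOn _ hx]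
  simp only
  rw [← hm hx, ← hm1, f1]
  ring

theorem V2_eq (hp : p ∈ dom ε) {x : ℝ} (hx : x ∈ Ioc (-1 : ℝ) 1) :
    (V2 p x).2 = tail ε (fund ε p) x := by
  refine integral_congr_Ioo hx.2 fun s hs => ?_
  have hs' : s ∈ Ioo (-1 : ℝ) 1 := ⟨hx.1.trans hs.1, hs.2⟩
  have hs1 : 0 < 1 + s := by linarith [hs'.1]
  rw [wt, fund_ext hp hs', ← mul_assoc, ← Real.rpow_add hs1, neg_add_cancel, Real.rpow_zero,
    one_mul]

theorem V1_eq (hp : p ∈ dom ε) (x : ℝ) :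
    (V1 p x).1 = (1 - x) * (1 + x) ^ (1 - ε) * (fund ε p).ext x := by
  by_cases h : x ∈ Ioo (-1 : ℝ) 1
  · have hx1 : 0 < 1 + x := by linarith [h.1]
    simp only [V1, if_pos h]
    rw [exp_neg_aFun hp.1 h, fund_ext hp h, mul_assoc, ← mul_assoc _ _ (Real.exp _),
      ← Real.rpow_add hx1, sub_add_cancel, Real.rpow_one]
    ring
  · simp only [V1, if_neg h, BC.ext_of_notMem _ h, mul_zero]

/-! ### The triple integral of the swirl -/

section Psi

variable {u : ℝ → ℝ} {W : BC} {k : ℝ}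

theorem deriv_of_eq_tail (h1 : ε < 1) (hu : ∀ x ∈ Ioo (-1 : ℝ) 1, u x = k * tail ε W x) {x : ℝ}
    (hx : x ∈ Ioo (-1 : ℝ) 1) : HasDerivAt u (-(k * wt (-ε) W x)) x := by
  refine (((tail_hasDerivAt h1 W hx).const_mul k).congr_of_eventuallyEq ?_).congr_deriv (by ring)
  filter_upwards [isOpen_Ioo.mem_nhds hx] with y hy using hu y hy

/-- In `1 - x² = (1-x)(1+x)` the first factor is absorbed by the quotient `gOp` of the swirl, and
the second lowers the exponent of the weight to `-1 - ε`. -/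
theorem psiIntegrand_eq (h0 : 0 < ε) (h1 : ε < 1)
    (hu : ∀ x ∈ Ioo (-1 : ℝ) 1, u x = k * tail ε W x) {x : ℝ} (hx : x ∈ Ioo (-1 : ℝ) 1) :
    psiIntegrand u x = -(2 * k ^ 2) * wt (-1 - ε) (gOp ε W * W) x := by
  have hx1 : 0 < 1 + x := by linarith [hx.1]
  have hx2 : 1 - x ≠ 0 := by linarith [hx.2]
  rw [psiIntegrand, hu x hx, (deriv_of_eq_tail h1 hu hx).deriv, wt, wt, BC.ext_mul,
    gOp_ext h0 h1 W hx, show -1 - ε = -ε - 1 by ring, Real.rpow_sub_one hx1.ne',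
    show 1 - x ^ 2 = (1 - x) * (1 + x) by ring]
  field_simp

theorem integral_psiIntegrand (h0 : 0 < ε) (h1 : ε < 1)
    (hu : ∀ x ∈ Ioo (-1 : ℝ) 1, u x = k * tail ε W x) {x : ℝ} (hx : x ∈ Ioo (-1 : ℝ) 1) :
    ∫ s in x..1, psiIntegrand u s = -(2 * k ^ 2) * iint1 ε (gOp ε W * W) x := by
  rw [iint1, ← intervalIntegral.integral_const_mul]
  exact integral_congr_Ioo hx.2.le fun s hs =>
    psiIntegrand_eq h0 h1 hu ⟨hx.1.trans hs.1, hs.2⟩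

theorem psi_eq (h0 : 0 < ε) (h1 : ε < 1)
    (hu : ∀ x ∈ Ioo (-1 : ℝ) 1, u x = k * tail ε W x) {x : ℝ} (hx : x ∈ Icc (-1 : ℝ) 1) :
    psi u x = -(2 * k ^ 2) * iint3 ε (gOp ε W * W) x := by
  rw [iint3, ← intervalIntegral.integral_const_mul]
  refine integral_congr_Ioo hx.2 fun l hl => ?_
  rw [iint2, ← intervalIntegral.integral_const_mul]
  exact integral_congr_Ioo hl.2.le fun t ht =>
    integral_psiIntegrand h0 h1 hu ⟨hx.1.trans_lt (hl.1.trans ht.1), ht.2⟩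

theorem intervalIntegrable_congr_Ioo {f g : ℝ → ℝ} {a b : ℝ} (hab : a ≤ b)
    (hf : IntervalIntegrable f volume a b) (h : ∀ x ∈ Ioo a b, f x = g x) :
    IntervalIntegrable g volume a b := by
  rw [intervalIntegrable_iff_integrableOn_Ioo_of_le hab] at hf ⊢
  exact hf.congr_fun h measurableSet_Ioo

theorem psiConverges (h0 : 0 < ε) (h1 : ε < 1)
    (hu : ∀ x ∈ Ioo (-1 : ℝ) 1, u x = k * tail ε W x) : PsiConverges u := by
  refine ⟨fun t ht => ?_, ?_⟩
  · exact intervalIntegrable_congr_Ioo ht.2.le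
      ((wt_integrable_right (-1 - ε) (gOp ε W * W) ht).const_mul (-(2 * k ^ 2)))
      fun s hs => (psiIntegrand_eq h0 h1 hu ⟨ht.1.trans hs.1, hs.2⟩).symm
  · exact intervalIntegrable_congr_Ioo (by norm_num)
      ((iint1_integrable h0 h1 (gOp ε W * W) (by norm_num)).const_mul (-(2 * k ^ 2)))
      fun s hs => (integral_psiIntegrand h0 h1 hu hs).symm

end Psi

/-! ### The equation for the polar component -/

/-- The Riccati equation for `w` removes the terms free of `y` and of `k`, and the defect of the
polar equation is `(1-x)²(1+x)^{1-ε}`, which is nonzero, times the defect of the Euler equation. The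
equivalence is pointwise algebra in free numbers `k, a, b`, so it serves both directions of the
theorem. -/
theorem theta_identity (hp : p ∈ I1) {y : BC} {d x : ℝ} (hx : x ∈ Ioo (-1 : ℝ) 1)
    (hy : HasDerivAt y.ext d x) {U : ℝ → ℝ}
    (hU : ∀ x ∈ Ioo (-1 : ℝ) 1,
      U x = noSwirl p x + (1 - x) * (1 + x) ^ (1 - ε) * y.ext x) (k a b : ℝ) :
    ((1 - x ^ 2) * deriv U x + 2 * x * U x + 1 / 2 * U x ^ 2 - -(2 * k ^ 2) * a
        = (p.1 - 1 / 4 * (-(2 * k ^ 2) * b)) * (1 - x) ^ 2) ↔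
      (1 + x) * d = (ε - wfun p x) * y.ext x
        + (-(1 / 2 * ((1 + x) ^ (1 - ε) * (y.ext x * y.ext x)))
          - 2 * k ^ 2 * ((1 + x) ^ ε * ((a / (1 - x) ^ 2 - b / 4) / (1 + x)))) := by
  have hx1 : 0 < 1 + x := by linarith [hx.1]
  have hx2 : 1 - x ≠ 0 := by linarith [hx.2]
  have e : ∀ x ∈ Ioo (-1 : ℝ) 1, U x = (1 - x) * (wfun p x + (1 + x) ^ (1 - ε) * y.ext x) :=
    fun x hx => by rw [hU x hx, noSwirl_eq hp (Ioo_subset_Ioc_self hx)]; ring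
  have hd : HasDerivAt U (-1 * (wfun p x + (1 + x) ^ (1 - ε) * y.ext x)
      + (1 - x) * ((p.1 + wfun p x - wfun p x ^ 2 / 2) / (1 + x)
        + ((1 - ε) * (1 + x) ^ (1 - ε - 1) * y.ext x + (1 + x) ^ (1 - ε) * d))) x := by
    refine (((hasDerivAt_id x).const_sub 1).mul ((wfun_hasDerivAt hp hx).add
      ((hasDerivAt_one_add_rpow (1 - ε) hx.1).mul hy))).congr_of_eventuallyEq ?_
    filter_upwards [isOpen_Ioo.mem_nhds hx] with z hz using e z hz
  rw [hd.deriv, e x hx, Real.rpow_sub_one hx1.ne']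
  have hm : (1 + x) ^ (1 - ε) * (1 + x) ^ ε = 1 + x := by
    rw [← Real.rpow_add hx1, sub_add_cancel, Real.rpow_one]
  have hp1 := Real.rpow_pos_of_pos hx1 (1 - ε)
  have hp2 := Real.rpow_pos_of_pos hx1 ε
  set A := (1 + x) ^ (1 - ε) with hA
  set B := (1 + x) ^ ε with hB
  set w := wfun p x
  set Y := y.ext x
  have hne : (1 - x) ^ 2 * A ≠ 0 := mul_ne_zero (pow_ne_zero 2 hx2) hp1.ne'
  rw [← sub_eq_zero, ← sub_eq_zero (a := (1 + x) * d)]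
  have key : (1 - x ^ 2) * (-1 * (w + A * Y) + (1 - x) * ((p.1 + w - w ^ 2 / 2) / (1 + x)
        + ((1 - ε) * (A / (1 + x)) * Y + A * d))) + 2 * x * ((1 - x) * (w + A * Y))
        + 1 / 2 * ((1 - x) * (w + A * Y)) ^ 2 - -(2 * k ^ 2) * a
        - (p.1 - 1 / 4 * (-(2 * k ^ 2) * b)) * (1 - x) ^ 2
      = (1 - x) ^ 2 * A * ((1 + x) * d - ((ε - w) * Y + (-(1 / 2 * (A * (Y * Y)))
          - 2 * k ^ 2 * (B * ((a / (1 - x) ^ 2 - b / 4) / (1 + x)))))) := by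
    -- Eliminating one of the two real powers leaves a rational identity.
    have hB' : B = (1 + x) / A := by rw [eq_div_iff hp1.ne', mul_comm]; exact hm
    rw [hB']
    field_simp
    ring
  rw [key, mul_eq_zero]
  exact ⟨fun h => h.resolve_left hne, Or.inr⟩

theorem src_ext (h0 : 0 < ε) (h1 : ε < 1) (p : ℝ × ℝ) (t : ℝ) (y : BC) {x : ℝ}
    (hx : x ∈ Ioo (-1 : ℝ) 1) : (src ε p t y).ext x
      = -(1 / 2 * ((1 + x) ^ (1 - ε) * (y.ext x * y.ext x)))
        - 2 * amp ε p t y ^ 2 * ((1 + x) ^ ε * ((iint3 ε (prodB ε p y) x / (1 - x) ^ 2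
          - iint3 ε (prodB ε p y) (-1) / 4) / (1 + x))) := by
  simp only [src, BC.ext_sub, BC.ext_neg, BC.ext_smul, BC.ext_mul, pw_ext h0.le hx,
    pw_ext (by linarith : 0 ≤ 1 - ε) hx, qOp_ext h0 h1 _ hx]

/-! ### The solutions given by the zeros of `eqn` -/

theorem solution_of_eqn (hp : p ∈ dom ε) {β : Plane} {y : BC}
    (h : eqn ε ((p, β), y) = 0) :
    y = β 0 • fund ε p + eulerSolver (fund ε p) (src ε p (β 1) y) ∧
      HasEuler y (rhs ε p y (src ε p (β 1) y)) := by
  have e : y = β 0 • fund ε p + eulerSolver (fund ε p) (src ε p (β 1) y) := by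
    rw [eqn, sub_sub, sub_eq_zero] at h
    exact h
  refine ⟨e, ?_⟩
  have h2 := ((fund_hasEuler hp).smul (β 0)).add
    (eulerSolver_hasEuler (fund_isEulerWeight hp) (fund_hasEuler hp) (src ε p (β 1) y))
  rw [← e] at h2
  refine h2.congr ?_
  rw [rhs]
  nth_rw 3 [e]
  rw [mul_add, mul_smul_comm, add_assoc]

/-- `β₁ V¹` carries the part `β₁ fund` of `y`, and the polar correction carries the solver part. In
the swirl, `β₂ V²` cancels against the term subtracted in the correction. -/
theorem ansatz_eq (h0 : 0 < ε) (h1 : ε < 1) (hp : p ∈ dom ε) {β : Plane} {y : BC}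
    (h : eqn ε ((p, β), y) = 0) {x : ℝ} (hx : x ∈ Ioc (-1 : ℝ) 1) :
    ansatz p β (toX1 h0 h1 (corrData ε ((p, β), y)) : X ε) x
      = (noSwirl p x + (1 - x) * (1 + x) ^ (1 - ε) * y.ext x,
        amp ε p (β 1) y * tail ε (swirl ε p y) x) := by
  obtain ⟨e, he⟩ := solution_of_eqn hp h
  have hz := src_hasEuler h0 h1 p (β 1) he
  have a1 := fun1_eq h0 h1 hp.1 (eulerSolver_hasEuler (fund_isEulerWeight hp) (fund_hasEuler hp)
    (src ε p (β 1) y)) hz (eulerSolver_ext_zero (fund_isEulerWeight hp) _)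
    (Ioc_subset_Icc_self hx)
  have a2 := fun2_eq h0 h1 hp (β 1) y hx
  rw [ansatz, toX1_toFun]
  refine Prod.ext ?_ ?_
  · change noSwirl p x + β 0 * (V1 p x).1 + β 1 * 0 + fun1 ε (corrData ε ((p, β), y)).1 x = _
    rw [V1_eq hp x, show fun1 ε (corrData ε ((p, β), y)).1 x = _ from a1]
    have : y.ext x = β 0 * (fund ε p).ext x
        + (eulerSolver (fund ε p) (src ε p (β 1) y)).ext x := by
      conv_lhs => rw [e]
      rw [BC.ext_add, BC.ext_smul]
    rw [this]
    ring
  · change 0 + β 0 * 0 + β 1 * (V2 p x).2 + fun2 ε (corrData ε ((p, β), y)).2 x = _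
    rw [V2_eq hp hx, show fun2 ε (corrData ε ((p, β), y)).2 x = _ from a2]
    ring

theorem contDiffOn_one_of_hasDerivAt {f f' : ℝ → ℝ}
    (h : ∀ x ∈ Ioo (-1 : ℝ) 1, HasDerivAt f (f' x) x) (hc : ContinuousOn f' (Ioo (-1) 1)) :
    ContDiffOn ℝ 1 f (Ioo (-1) 1) := by
  rw [contDiffOn_one_iff_derivWithin (uniqueDiffOn_Ioo _ _)]
  refine ⟨fun x hx => (h x hx).differentiableAt.differentiableWithinAt, hc.congr fun x hx => ?_⟩
  exact (h x hx).hasDerivWithinAt.derivWithin (uniqueDiffOn_Ioo _ _ x hx)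

theorem contDiffOn_two_of_hasDerivAt {f f' f'' : ℝ → ℝ}
    (h : ∀ x ∈ Ioo (-1 : ℝ) 1, HasDerivAt f (f' x) x)
    (h' : ∀ x ∈ Ioo (-1 : ℝ) 1, HasDerivAt f' (f'' x) x) (hc : ContinuousOn f'' (Ioo (-1) 1)) :
    ContDiffOn ℝ 2 f (Ioo (-1) 1) := by
  rw [show (2 : WithTop ℕ∞) = 1 + 1 from rfl,
    contDiffOn_succ_iff_derivWithin (uniqueDiffOn_Ioo _ _)]
  refine ⟨fun x hx => (h x hx).differentiableAt.differentiableWithinAt, by simp,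
    (contDiffOn_one_of_hasDerivAt h' hc).congr fun x hx => ?_⟩
  exact (h x hx).hasDerivWithinAt.derivWithin (uniqueDiffOn_Ioo _ _ x hx)

theorem isSolution_of_eqn (h0 : 0 < ε) (h1 : ε < 1) (hp : p ∈ dom ε) {t : ℝ} {y : BC}
    (hy : HasEuler y (rhs ε p y (src ε p t y))) {U : ℝ → ℝ × ℝ}
    (hU : ∀ x ∈ Ioo (-1 : ℝ) 1, U x = (noSwirl p x + (1 - x) * (1 + x) ^ (1 - ε) * y.ext x,
      amp ε p t y * tail ε (swirl ε p y) x)) :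
    PsiConverges (fun x => (U x).2) ∧
      IsSolution U (p.1 - 1 / 4 * psi (fun x => (U x).2) (-1)) := by
  set k := amp ε p t y with hk
  have hU1 : ∀ x ∈ Ioo (-1 : ℝ) 1,
      (U x).1 = noSwirl p x + (1 - x) * (1 + x) ^ (1 - ε) * y.ext x := fun x hx => by rw [hU x hx]
  have hU2 : ∀ x ∈ Ioo (-1 : ℝ) 1, (U x).2 = k * tail ε (swirl ε p y) x :=
    fun x hx => by rw [hU x hx]
  have hpsi := fun {x : ℝ} => psi_eq (u := fun x => (U x).2) h0 h1 hU2 (x := x)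
  have hconv := psiConverges (u := fun x => (U x).2) h0 h1 hU2
  have hd := fun {x : ℝ} => deriv_of_eq_tail (u := fun x => (U x).2) h1 hU2 (x := x)
  have hd2 : ∀ x ∈ Ioo (-1 : ℝ) 1, HasDerivAt (fun x => -(k * wt (-ε) (swirl ε p y) x))
      (k * wt (-1 - ε) ((wB p + pw (1 - ε) * y) * swirl ε p y) x) x := fun x hx => by
    refine ((wt_hasDerivAt (-ε) (swirl_hasEuler h0 h1 hp y) hx).const_mul k).neg.congr_deriv ?_
    rw [show -ε - 1 = -1 - ε by ring]
    simp only [wt, BC.ext_sub, BC.ext_smul, BC.ext_add, BC.ext_mul, BC.ext_one hx]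
    ring
  refine ⟨hconv, ?_, ?_, hconv.1, ?_, ?_⟩
  · have hb : HasEuler (om * (wB p + pw (1 - ε) * y)) _ :=
      om_hasEuler.mul ((wB_hasEuler hp.1).add ((pw_hasEuler (by linarith)).mul hy))
    refine (contDiffOn_one_of_hasDerivAt (fun x hx => hb x hx)
      ((BC.continuousOn_ext _).div (by fun_prop) fun x hx => by linarith [hx.1])).congr
      fun x hx => ?_
    rw [hU1 x hx, noSwirl_eq hp.1 (Ioo_subset_Ioc_self hx), BC.ext_mul, BC.ext_add, BC.ext_mul,
      om_ext hx, wB_ext hp.1 hx, pw_ext (by linarith) hx]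
    ring
  · exact contDiffOn_two_of_hasDerivAt (fun x hx => hd hx) hd2
      (continuousOn_const.mul (wt_continuousOn _ _))
  · intro x hx
    rw [hpsi (Ioo_subset_Icc_self hx), hpsi (by norm_num : (-1 : ℝ) ∈ Icc (-1 : ℝ) 1)]
    rw [theta_identity hp.1 hx (hy x hx) hU1]
    have hx1 : 1 + x ≠ 0 := by linarith [hx.1]
    rw [mul_div_cancel₀ _ hx1, rhs, BC.ext_add, BC.ext_mul, BC.ext_sub, BC.ext_smul,
      BC.ext_one hx, wB_ext hp.1 hx, src_ext h0 h1 p t y hx, mul_one]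
    rfl
  · intro x hx
    have e : deriv (fun y => (U y).2) =ᶠ[𝓝 x] fun x => -(k * wt (-ε) (swirl ε p y) x) := by
      filter_upwards [isOpen_Ioo.mem_nhds hx] with z hz using (hd hz).deriv
    have hx1 : 0 < 1 + x := by linarith [hx.1]
    rw [e.deriv_eq, (hd2 x hx).deriv, (hd hx).deriv, hU1 x hx,
      noSwirl_eq hp.1 (Ioo_subset_Ioc_self hx), wt, wt, BC.ext_mul, BC.ext_add, BC.ext_mul,
      wB_ext hp.1 hx, pw_ext (by linarith) hx, show -1 - ε = -ε - 1 by ring,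
      Real.rpow_sub_one hx1.ne']
    field_simp
    ring

end

section

/-! ### From a solution of the reduced system to the integral equation -/

variable {ε : ℝ} {p : ℝ × ℝ}

theorem M1.weighted_le (f : M1 ε) {x : ℝ} (hx : x ∈ Ioo (-1 : ℝ) 1) :
    |(1 + x) ^ (-1 + ε) * f.toFun x| ≤ ‖f‖ := by
  refine (le_supOn f.mem.bdd0 hx).trans ?_
  rw [M1.norm_def]
  linarith [supOn_nonneg (Ioo (-1) 1) (fun x => (1 + x) ^ ε * deriv f.toFun x),
    supOn_nonneg (Ioo 0 1) (fun x => deriv (deriv f.toFun) x)]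

theorem M1.weighted_deriv_le (f : M1 ε) {x : ℝ} (hx : x ∈ Ioo (-1 : ℝ) 1) :
    |(1 + x) ^ ε * deriv f.toFun x| ≤ ‖f‖ := by
  refine (le_supOn f.mem.bdd1 hx).trans ?_
  rw [M1.norm_def]
  linarith [supOn_nonneg (Ioo (-1) 1) (fun x => (1 + x) ^ (-1 + ε) * f.toFun x),
    supOn_nonneg (Ioo 0 1) (fun x => deriv (deriv f.toFun) x)]

theorem M2.abs_le (g : M2 ε) {x : ℝ} (hx : x ∈ Ioo (-1 : ℝ) 1) : |g.toFun x| ≤ ‖g‖ := by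
  refine (le_supOn g.mem.bdd0 hx).trans ?_
  rw [M2.norm_def]
  linarith [supOn_nonneg (Ioo (-1) 1) (fun x => (1 + x) ^ ε * deriv g.toFun x),
    supOn_nonneg (Ioo (-1) 1) (fun x => (1 + x) ^ (1 + ε) * deriv (deriv g.toFun) x)]

theorem M1.abs_le_one_sub (h0 : 0 < ε) (f : M1 ε) {x : ℝ} (hx : x ∈ Ico (0 : ℝ) 1) :
    |f.toFun x| ≤ ‖f‖ * (1 - x) := by
  have hs : Icc x 1 ⊆ Ioc (-1 : ℝ) 1 := fun s hs => ⟨by linarith [hx.1, hs.1], hs.2⟩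
  have ho : ∀ s ∈ Ioo x 1, s ∈ Ioo (-1 : ℝ) 1 := fun s hs => ⟨by linarith [hx.1, hs.1], hs.2⟩
  obtain ⟨c, hc, e⟩ := exists_deriv_eq_slope f.toFun hx.2 (f.mem.c1.continuousOn.mono hs)
    fun s hs => (diffAt_of_c1 f.mem.c1 (ho s hs)).differentiableWithinAt
  rw [f.mem.right, zero_sub, eq_div_iff (by linarith [hx.2])] at e
  have h := f.weighted_deriv_le (ho c hc)
  have h2 : 1 ≤ (1 + c) ^ ε := Real.one_le_rpow (by linarith [hx.1, hc.1]) h0.le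
  have h3 : |deriv f.toFun c| ≤ ‖f‖ := by
    refine le_trans ?_ h
    rw [abs_mul, abs_of_nonneg (by linarith : 0 ≤ (1 + c) ^ ε)]
    exact le_mul_of_one_le_left (abs_nonneg _) h2
  rw [← abs_neg, ← e, abs_mul, abs_of_nonneg (by linarith [hx.2] : 0 ≤ 1 - x)]
  exact mul_le_mul_of_nonneg_right h3 (by linarith [hx.2])

/-- For `x ≤ 0` the weighted bound suffices, since `1 - x ≥ 1`. For `x ≥ 0` the zero of `f` at `1`
and the mean value theorem supply the factor `1 - x`. -/
theorem M1.abs_quot_le (h0 : 0 < ε) (h1 : ε < 1) (f : M1 ε) {x : ℝ} (hx : x ∈ Ioo (-1 : ℝ) 1) :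
    |(1 + x) ^ (-1 + ε) * f.toFun x / (1 - x)| ≤ ‖f‖ := by
  have hx1 : 0 < 1 + x := by linarith [hx.1]
  have hx2 : 0 < 1 - x := by linarith [hx.2]
  rw [abs_div, abs_of_pos hx2, div_le_iff₀ hx2]
  rcases le_total 0 x with h | h
  · rw [abs_mul, abs_of_nonneg (Real.rpow_nonneg hx1.le _)]
    refine (mul_le_of_le_one_left (abs_nonneg _) ?_).trans (f.abs_le_one_sub h0 ⟨h, hx.2⟩)
    exact Real.rpow_le_one_of_one_le_of_nonpos (by linarith) (by linarith)
  · exact (f.weighted_le hx).trans (le_mul_of_one_le_right (norm_nonneg f) (by linarith))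

/-- `(1 + x)^{-1+ε} f(x) / (1 - x)` as a bounded continuous function. -/
def M1.quot (f : M1 ε) : BC := BC.ofFun fun x => (1 + x) ^ (-1 + ε) * f.toFun x / (1 - x)

theorem M1.quot_ext (h0 : 0 < ε) (h1 : ε < 1) (f : M1 ε) {x : ℝ} (hx : x ∈ Ioo (-1 : ℝ) 1) :
    f.quot.ext x = (1 + x) ^ (-1 + ε) * f.toFun x / (1 - x) := by
  refine BC.ext_ofFun ?_ ⟨‖f‖, fun x hx => f.abs_quot_le h0 h1 hx⟩ hx
  refine ContinuousOn.div (((continuousOn_one_add_rpow _).mono Ioo_subset_Ioi_self).mul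
    (f.mem.cont.mono Ioo_subset_Icc_self)) (by fun_prop) fun x hx => by linarith [hx.2]

theorem M1.norm_quot_le (h0 : 0 < ε) (h1 : ε < 1) (f : M1 ε) : ‖f.quot‖ ≤ ‖f‖ :=
  BC.norm_le_of (norm_nonneg f) fun x hx => by
    rw [f.quot_ext h0 h1 hx]
    exact f.abs_quot_le h0 h1 hx

theorem M1.toFun_eq_quot (h0 : 0 < ε) (h1 : ε < 1) (f : M1 ε) {x : ℝ}
    (hx : x ∈ Ioc (-1 : ℝ) 1) :
    f.toFun x = (1 - x) * (1 + x) ^ (1 - ε) * f.quot.ext x := by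
  rcases eq_or_lt_of_le hx.2 with h | h
  · rw [h, f.mem.right]
    ring
  · have hx1 : 0 < 1 + x := by linarith [hx.1]
    have hx2 : 1 - x ≠ 0 := by linarith
    have e : (1 + x) ^ (1 - ε) * (1 + x) ^ (-1 + ε) = 1 := by
      rw [← Real.rpow_add hx1, show 1 - ε + (-1 + ε) = 0 by ring, Real.rpow_zero]
    rw [f.quot_ext h0 h1 ⟨hx.1, h⟩]
    field_simp
    linear_combination -f.toFun x * e

/-- The swirl component of a solution is determined by its polar component up to a factor. -/
theorem eq_tail_of_phi (h0 : 0 < ε) (h1 : ε < 1) (hp : p ∈ dom ε) {y : BC} {v u : ℝ → ℝ}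
    (hv : ∀ x ∈ Ioo (-1 : ℝ) 1, v x = noSwirl p x + (1 - x) * (1 + x) ^ (1 - ε) * y.ext x)
    (hu : ContDiffOn ℝ 2 u (Ioo (-1) 1)) (hc : ContinuousOn u (Ioc (-1) 1)) (hu1 : u 1 = 0)
    (h : ∀ x ∈ Ioo (-1 : ℝ) 1, (1 - x ^ 2) * deriv (deriv u) x + v x * deriv u x = 0) :
    ∃ k, ∀ x ∈ Ioc (-1 : ℝ) 1, u x = k * tail ε (swirl ε p y) x := by
  set S := swirl ε p y with hS
  have hpos : ∀ x ∈ Ioo (-1 : ℝ) 1, 0 < wt (-ε) S x := fun x hx =>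
    mul_pos (Real.rpow_pos_of_pos (by linarith [hx.1]) _) (swirl_ext_pos hp y hx)
  -- The weight and `u'` solve the same first order linear equation, so their quotient is constant.
  have hq : ∀ x ∈ Ioo (-1 : ℝ) 1, HasDerivAt (fun x => deriv u x / wt (-ε) S x) 0 x := by
    intro x hx
    have hx1 : 0 < 1 + x := by linarith [hx.1]
    have hx2 : 1 - x ≠ 0 := by linarith [hx.2]
    refine ((diffAt_deriv_of_c2 hu hx).hasDerivAt.div
      (wt_hasDerivAt (-ε) (swirl_hasEuler h0 h1 hp y) hx) (hpos x hx).ne').congr_deriv ?_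
    rw [div_eq_zero_iff]
    left
    have e := h x hx
    rw [hv x hx, noSwirl_eq hp.1 (Ioo_subset_Ioc_self hx)] at e
    have e2 : (1 + x) * deriv (deriv u) x
        = -(wfun p x + (1 + x) ^ (1 - ε) * y.ext x) * deriv u x := by
      apply mul_left_cancel₀ hx2
      linear_combination e
    rw [wt, wt, BC.ext_add, BC.ext_mul, BC.ext_sub, BC.ext_sub, BC.ext_smul, BC.ext_smul,
      BC.ext_one hx, BC.ext_mul, wB_ext hp.1 hx, pw_ext (by linarith) hx,
      Real.rpow_sub_one hx1.ne', ← hS]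
    field_simp
    linear_combination (1 + x) ^ (-ε) * S.ext x * e2
  have hd : ∀ x ∈ Ioo (-1 : ℝ) 1, deriv u x = deriv u 0 / wt (-ε) S 0 * wt (-ε) S x :=
    fun x hx => by
      have := eq_apply_zero_of_hasDerivAt_zero hq hx
      rw [← this, div_mul_cancel₀ _ (hpos x hx).ne']
  set c := deriv u 0 / wt (-ε) S 0
  have hz : ∀ x ∈ Ioo (-1 : ℝ) 1, HasDerivAt (fun x => u x + c * tail ε S x) 0 x := by
    intro x hx
    have a : DifferentiableAt ℝ u x :=
      (hu.differentiableOn two_ne_zero).differentiableAt (isOpen_Ioo.mem_nhds hx)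
    refine (a.hasDerivAt.add ((tail_hasDerivAt h1 S hx).const_mul c)).congr_deriv ?_
    rw [hd x hx]
    ring
  -- Continuity carries the constancy to `x = 1`, where both `u` and the tail vanish.
  have hcl : EqOn (fun x => u x + c * tail ε S x) (fun _ => u 0 + c * tail ε S 0)
      (Ioc (-1) 1) := by
    refine EqOn.of_subset_closure (s := Ioo (-1) 1)
      (fun x hx => eq_apply_zero_of_hasDerivAt_zero hz hx)
      (hc.add (continuousOn_const.mul ((tail_continuousOn h1 S).mono Ioc_subset_Icc_self)))
      continuousOn_const Ioo_subset_Ioc_self ?_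
    rw [closure_Ioo (by norm_num)]
    exact Ioc_subset_Icc_self
  have h1' := hcl (by norm_num : (1 : ℝ) ∈ Ioc (-1 : ℝ) 1)
  simp only [hu1, tail_one, mul_zero, add_zero] at h1'
  refine ⟨-c, fun x hx => ?_⟩
  have hx' := hcl hx
  simp only [← h1'] at hx'
  linarith

theorem noSwirl_hasDerivAt (hp : p ∈ I1) {x : ℝ} (hx : x ∈ Ioo (-1 : ℝ) 1) :
    HasDerivAt (noSwirl p) (-wfun p x
      + (1 - x) * ((p.1 + wfun p x - wfun p x ^ 2 / 2) / (1 + x))) x := by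
  refine ((((hasDerivAt_id x).const_sub 1).mul (wfun_hasDerivAt hp hx)).congr_of_eventuallyEq
    ?_).congr_deriv ?_
  · filter_upwards [isOpen_Ioo.mem_nhds hx] with z hz using noSwirl_eq hp (Ioo_subset_Ioc_self hz)
  · simp

/-- The contribution of a perturbation in `M₁(ε)` to the polar equation vanishes at `x = -1`. -/
theorem tendsto_perturbation (h1 : ε < 1) (hp : p ∈ I1) (f : M1 ε) :
    Tendsto (fun x => (1 - x ^ 2) * deriv f.toFun x
      + (2 * x + noSwirl p x + 1 / 2 * f.toFun x) * f.toFun x) (𝓝[>] (-1)) (𝓝 0) := by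
  have hw : Tendsto (fun x : ℝ => (1 + x) ^ (1 - ε)) (𝓝[>] (-1)) (𝓝 0) := by
    have : ContinuousAt (fun x : ℝ => (1 + x) ^ (1 - ε)) (-1) :=
      ContinuousAt.rpow_const (by fun_prop) (Or.inr (by linarith))
    have h := this.tendsto
    rw [show (1 : ℝ) + -1 = 0 by norm_num, Real.zero_rpow (by linarith)] at h
    exact h.mono_left nhdsWithin_le_nhds
  obtain ⟨B, hB⟩ := isCompact_Icc.exists_bound_of_continuousOn f.mem.cont
  have key := (hw.mul_const (2 * ‖f‖ + (2 + 2 * ‖wB p‖ + 1 / 2 * B) * ‖f‖))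
  rw [zero_mul] at key
  refine squeeze_zero_norm' ?_ key
  filter_upwards [Ioo_mem_nhdsGT (by norm_num : (-1 : ℝ) < 1)] with x hx
  have hx1 : 0 < 1 + x := by linarith [hx.1]
  -- Both terms contain the factor `(1+x)^{1-ε}`, which tends to `0`; what is left is bounded by the
  -- norm of `M₁`.
  have e1 : 1 - x ^ 2 = (1 + x) ^ (1 - ε) * ((1 - x) * (1 + x) ^ ε) := by
    have : (1 + x) ^ (1 - ε) * (1 + x) ^ ε = 1 + x := by
      rw [← Real.rpow_add hx1, sub_add_cancel, Real.rpow_one]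
    linear_combination -(1 - x) * this
  have e2 : f.toFun x = (1 + x) ^ (1 - ε) * ((1 + x) ^ (-1 + ε) * f.toFun x) := by
    rw [← mul_assoc, ← Real.rpow_add hx1, show 1 - ε + (-1 + ε) = 0 by ring, Real.rpow_zero,
      one_mul]
  have b1 := f.weighted_deriv_le hx
  have b2 := f.weighted_le hx
  have b3 : |f.toFun x| ≤ B := hB x (Ioo_subset_Icc_self hx)
  have b4 : |noSwirl p x| ≤ 2 * ‖wB p‖ := by
    rw [noSwirl_eq hp (Ioo_subset_Ioc_self hx), ← wB_ext hp hx, abs_mul]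
    refine mul_le_mul ?_ ((wB p).abs_ext_le x) (abs_nonneg _) (by norm_num)
    rw [abs_le]
    constructor <;> linarith [hx.1, hx.2]
  have e : (1 - x ^ 2) * deriv f.toFun x
      + (2 * x + noSwirl p x + 1 / 2 * f.toFun x) * f.toFun x
      = (1 + x) ^ (1 - ε) * ((1 - x) * ((1 + x) ^ ε * deriv f.toFun x)
        + (2 * x + noSwirl p x + 1 / 2 * f.toFun x) * ((1 + x) ^ (-1 + ε) * f.toFun x)) := by
    rw [e1]
    linear_combination (2 * x + noSwirl p x + 1 / 2 * f.toFun x) * e2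
  rw [e, Real.norm_eq_abs, abs_mul, abs_of_nonneg (Real.rpow_nonneg hx1.le _)]
  refine mul_le_mul_of_nonneg_left ?_ (Real.rpow_nonneg hx1.le _)
  refine (abs_add_le _ _).trans (add_le_add ?_ ?_)
  · rw [abs_mul]
    refine mul_le_mul ?_ b1 (abs_nonneg _) (by norm_num)
    rw [abs_le]
    constructor <;> linarith [hx.1, hx.2]
  · rw [abs_mul]
    have b5 : |2 * x + noSwirl p x + 1 / 2 * f.toFun x| ≤ 2 + 2 * ‖wB p‖ + 1 / 2 * B := by
      rw [abs_le] at *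
      constructor <;> linarith [hx.1, hx.2]
    exact mul_le_mul b5 b2 (abs_nonneg _) ((abs_nonneg _).trans b5)

/-- The constant in the polar equation is determined by the decay at `x = -1`. -/
theorem const_eq (h1 : ε < 1) (hp : p ∈ I1) (f : M1 ε) {v ψ : ℝ → ℝ} {m : ℝ}
    (hv : ∀ x ∈ Ioo (-1 : ℝ) 1, v x = noSwirl p x + f.toFun x)
    (hψ : ContinuousOn ψ (Icc (-1) 1))
    (h : ∀ x ∈ Ioo (-1 : ℝ) 1, (1 - x ^ 2) * deriv v x + 2 * x * v x + 1 / 2 * v x ^ 2 - ψ x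
      = m * (1 - x) ^ 2) : m = p.1 - 1 / 4 * ψ (-1) := by
  -- The no-swirl equation is subtracted. At `-1` the left side tends to `0`, which leaves `ψ(-1) +
  -- 4(m - μ) = 0`.
  have e : ∀ x ∈ Ioo (-1 : ℝ) 1, (1 - x ^ 2) * deriv f.toFun x
      + (2 * x + noSwirl p x + 1 / 2 * f.toFun x) * f.toFun x
      = ψ x + (m - p.1) * (1 - x) ^ 2 := by
    intro x hx
    have hx1 : 1 + x ≠ 0 := by linarith [hx.1]
    have hd := ((noSwirl_hasDerivAt hp hx).add
      (diffAt_of_c1 f.mem.c1 hx).hasDerivAt).congr_of_eventuallyEq (f₁ := v) (by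
        filter_upwards [isOpen_Ioo.mem_nhds hx] with z hz using hv z hz)
    have := h x hx
    rw [hd.deriv, hv x hx, noSwirl_eq hp (Ioo_subset_Ioc_self hx)] at this
    rw [noSwirl_eq hp (Ioo_subset_Ioc_self hx)]
    have hw : (1 - x ^ 2) * (-wfun p x + (1 - x) * ((p.1 + wfun p x - wfun p x ^ 2 / 2) / (1 + x)))
        = -(1 - x ^ 2) * wfun p x + (1 - x) ^ 2 * (p.1 + wfun p x - wfun p x ^ 2 / 2) := by
      field_simp
      ring
    linear_combination this - hw
  have hc : Tendsto ψ (𝓝[>] (-1)) (𝓝 (ψ (-1))) := by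
    refine (hψ (-1) (by norm_num)).mono_left ?_
    rw [← nhdsWithin_Ioo_eq_nhdsGT (by norm_num : (-1 : ℝ) < 1)]
    exact nhdsWithin_mono _ Ioo_subset_Icc_self
  have hq : Tendsto (fun x : ℝ => (m - p.1) * (1 - x) ^ 2) (𝓝[>] (-1))
      (𝓝 ((m - p.1) * (1 - -1) ^ 2)) :=
    (Continuous.tendsto (by fun_prop) _).mono_left nhdsWithin_le_nhds
  have h2 : Tendsto (fun x => (1 - x ^ 2) * deriv f.toFun x
      + (2 * x + noSwirl p x + 1 / 2 * f.toFun x) * f.toFun x) (𝓝[>] (-1))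
      (𝓝 (ψ (-1) + (m - p.1) * (1 - -1) ^ 2)) := by
    refine (hc.add hq).congr' ?_
    filter_upwards [Ioo_mem_nhdsGT (by norm_num : (-1 : ℝ) < 1)] with x hx using (e x hx).symm
  have := tendsto_nhds_unique h2 (tendsto_perturbation h1 hp f)
  linarith

/-- A solution near the no-swirl solution gives a zero of `eqn`. -/
theorem eqn_of_isSolution (h0 : 0 < ε) (h1 : ε < 1) (hp : p ∈ dom ε) {U : ℝ → ℝ × ℝ} {W : X ε}
    (hU : ∀ x ∈ Ioc (-1 : ℝ) 1, U x = baseFlow p x + W.toFun x) {m : ℝ} (hs : IsSolution U m)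
    {β : Plane} (hβ0 : β 0 = W.fst.toFun 0)
    (hβ1 : β 1 = W.snd.toFun 0 / massOp ε (fund ε p)) :
    eqn ε ((p, β), W.fst.quot) = 0 ∧ ∀ x ∈ Ioc (-1 : ℝ) 1,
      U x = (noSwirl p x + (1 - x) * (1 + x) ^ (1 - ε) * W.fst.quot.ext x,
        amp ε p (β 1) W.fst.quot * tail ε (swirl ε p W.fst.quot) x) := by
  set f := W.fst with hf
  set g := W.snd with hg
  set y := f.quot with hy
  have hU1 : ∀ x ∈ Ioc (-1 : ℝ) 1, (U x).1 = noSwirl p x + f.toFun x :=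
    fun x hx => by rw [hU x hx]; rfl
  have hU2 : ∀ x ∈ Ioc (-1 : ℝ) 1, (U x).2 = g.toFun x := fun x hx => by
    rw [hU x hx]
    exact zero_add _
  have hU1' : ∀ x ∈ Ioc (-1 : ℝ) 1,
      (U x).1 = noSwirl p x + (1 - x) * (1 + x) ^ (1 - ε) * y.ext x := fun x hx => by
    rw [hU1 x hx, f.toFun_eq_quot h0 h1 hx]
  obtain ⟨k, hk⟩ := eq_tail_of_phi (v := fun x => (U x).1) (u := fun x => (U x).2) h0 h1 hp
    (fun x hx => hU1' x (Ioo_subset_Ioc_self hx)) hs.c2 (g.mem.c1.continuousOn.congr hU2)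
    ((hU2 1 (by norm_num)).trans g.mem.right) hs.eq_phi
  -- The factor `k` is read off from the value of the swirl at `0`, which `β 1` encodes.
  have hamp : amp ε p (β 1) y = k := by
    have a := hk 0 (by norm_num)
    rw [hU2 0 (by norm_num), ← massOp_apply h0 h1] at a
    have b1 := (massOp_swirl_pos h0 h1 hp y).ne'
    have b2 := (massOp_fund_pos h0 h1 hp).ne'
    rw [amp, hβ1, a]
    field_simp
  refine ⟨?_, fun x hx => Prod.ext (hU1' x hx) (by rw [hamp]; exact hk x hx)⟩
  have hkI : ∀ x ∈ Ioo (-1 : ℝ) 1, (U x).2 = k * tail ε (swirl ε p y) x :=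
    fun x hx => hk x (Ioo_subset_Ioc_self hx)
  have hψ : ∀ x ∈ Icc (-1 : ℝ) 1,
      psi (fun x => (U x).2) x = -(2 * k ^ 2) * iint3 ε (prodB ε p y) x :=
    fun x hx => psi_eq h0 h1 hkI hx
  have hm := const_eq (v := fun x => (U x).1) (ψ := psi fun x => (U x).2) h1 hp.1 f
    (fun x hx => hU1 x (Ioo_subset_Ioc_self hx))
    ((continuousOn_const.mul (iint3_continuousOn h0 h1 _)).congr hψ) hs.eq_theta
  have hE : HasEuler y (rhs ε p y (src ε p (β 1) y)) := by
    intro x hx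
    have hx1 : 0 < 1 + x := by linarith [hx.1]
    have hx2 : 1 - x ≠ 0 := by linarith [hx.2]
    have hdiff : DifferentiableAt ℝ y.ext x := by
      have : DifferentiableAt ℝ (fun x => (1 + x) ^ (-1 + ε) * f.toFun x / (1 - x)) x :=
        ((hasDerivAt_one_add_rpow (-1 + ε) hx.1).differentiableAt.mul
          (diffAt_of_c1 f.mem.c1 hx)).div (by fun_prop) hx2
      refine this.congr_of_eventuallyEq ?_
      filter_upwards [isOpen_Ioo.mem_nhds hx] with z hz using f.quot_ext h0 h1 hz
    have e := hs.eq_theta x hx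
    rw [hm, hψ x (Ioo_subset_Icc_self hx), hψ (-1) (by norm_num)] at e
    have e' := (theta_identity (U := fun x => (U x).1) hp.1 hx hdiff.hasDerivAt
      (fun x hx => hU1' x (Ioo_subset_Ioc_self hx)) k _ _).1 e
    refine hdiff.hasDerivAt.congr_deriv ?_
    rw [eq_div_iff hx1.ne', rhs, BC.ext_add, BC.ext_mul, BC.ext_sub, BC.ext_smul,
      BC.ext_one hx, wB_ext hp.1 hx, src_ext h0 h1 p _ y hx, mul_one, hamp, mul_comm]
    exact e'
  have hsol := eq_eulerSolver (fund_isEulerWeight hp) (fund_hasEuler hp) (fund_ext_zero hp) hE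
  have hy0 : y.ext 0 = β 0 := by
    rw [hβ0, hy, f.quot_ext h0 h1 zero_mem_Ioo]
    simp
  rw [hy0] at hsol
  rw [eqn, sub_sub, sub_eq_zero]
  exact hsol

/-! ### Bounds for the parameters of a solution -/

/-- A bound for `1 / V²(0)` uniform on `K`, needed to control `β₂` by the norm of the perturbation.
-/
theorem exists_le_massOp_fund (h0 : 0 < ε) (h1 : ε < 1) {K : Set (ℝ × ℝ)} (hK : IsCompact K)
    (hKd : K ⊆ dom ε) : ∃ c > 0, ∀ p ∈ K, c ≤ massOp ε (fund ε p) := by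
  rcases K.eq_empty_or_nonempty with rfl | hne
  · exact ⟨1, one_pos, fun p hp => absurd hp (notMem_empty p)⟩
  have hc : ContinuousOn (fun p => massOp ε (fund ε p)) K := fun p hp =>
    ((massOp ε).continuous.continuousAt.comp
      (contDiffAt_fund (hKd hp)).1.continuousAt).continuousWithinAt
  obtain ⟨q, hq, hmin⟩ := hK.exists_isMinOn hne hc
  exact ⟨_, massOp_fund_pos h0 h1 (hKd hq), fun p hp => hmin hp⟩

theorem norm_parameters_le (W : X ε) {c d : ℝ} (hc : 0 < c) (hd : c ≤ d) :
    ‖(!₂[W.fst.toFun 0, W.snd.toFun 0 / d] : Plane)‖ ≤ ‖W‖ * (1 + 1 / c) := by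
  have a1 : |W.fst.toFun 0| ≤ ‖W.fst‖ := by
    have := W.fst.weighted_le zero_mem_Ioo
    rwa [add_zero, Real.one_rpow, one_mul] at this
  have a2 : |W.snd.toFun 0 / d| ≤ ‖W.snd‖ / c := by
    rw [abs_div, abs_of_pos (hc.trans_le hd)]
    exact div_le_div₀ (norm_nonneg _) (W.snd.abs_le zero_mem_Ioo) hc hd
  have hn : ‖W‖ = ‖W.fst‖ + ‖W.snd‖ := WithLp.prod_norm_eq_of_L1 W
  have b : ‖(!₂[W.fst.toFun 0, W.snd.toFun 0 / d] : Plane)‖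
      ≤ |W.fst.toFun 0| + |W.snd.toFun 0 / d| := by
    rw [EuclideanSpace.norm_eq, Fin.sum_univ_two]
    refine Real.sqrt_le_iff.2 ⟨by positivity, ?_⟩
    simp only [Real.norm_eq_abs]
    change |W.fst.toFun 0| ^ 2 + |W.snd.toFun 0 / d| ^ 2 ≤ _
    nlinarith [abs_nonneg (W.fst.toFun 0), abs_nonneg (W.snd.toFun 0 / d),
      mul_nonneg (abs_nonneg (W.fst.toFun 0)) (abs_nonneg (W.snd.toFun 0 / d))]
  refine b.trans ((add_le_add a1 a2).trans ?_)
  have e1 : 0 ≤ ‖W.fst‖ / c := by positivity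
  have e2 := norm_nonneg W.snd
  rw [hn]
  calc ‖W.fst‖ + ‖W.snd‖ / c ≤ ‖W.fst‖ + ‖W.snd‖ / c + (‖W.fst‖ / c + ‖W.snd‖) := by linarith
    _ = _ := by ring

end

end SwirlNS

end

/-! ### The theorem: application of the implicit function theorem to `eqn`. -/

open SwirlNS in
theorem theorem4p1 (K : Set (ℝ × ℝ)) (hK : IsCompact K) (hKI : K ⊆ I1)
    (ε : ℝ) (hε0 : 0 < ε) (hε1 : ε < 1) (hε : ∀ p ∈ K, noSwirlSouth p < 2 * ε) :
    ∃ δ > (0 : ℝ), ∃ V : (ℝ × ℝ) × EuclideanSpace ℝ (Fin 2) → X1 ε,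
      (∃ O : Set (ℝ × ℝ), IsOpen O ∧ K ⊆ O ∧ ContDiffOn ℝ ∞ V (O ×ˢ Metric.ball 0 δ)) ∧
      (∀ p ∈ K, V (p, 0) = 0) ∧
      (∀ p ∈ K, HasFDerivAt (fun β => V (p, β))
        (0 : EuclideanSpace ℝ (Fin 2) →L[ℝ] X1 ε) 0) ∧
      (∀ p ∈ K, ∀ β : EuclideanSpace ℝ (Fin 2), ‖β‖ < δ →
        PsiConverges (fun x => (ansatz p β (V (p, β) : X ε) x).2) ∧
        IsSolution (ansatz p β (V (p, β) : X ε))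
          (p.1 - (1 / 4) * psi (fun x => (ansatz p β (V (p, β) : X ε) x).2) (-1))) ∧
      ∃ δ' > (0 : ℝ), ∀ p ∈ K, ∀ (U : ℝ → ℝ × ℝ) (W : X ε),
        (∀ x ∈ Ioc (-1 : ℝ) 1, U x = baseFlow p x + W.toFun x) → ‖W‖ < δ' →
        ∀ m : ℝ, IsSolution U m →
          ∃ β : EuclideanSpace ℝ (Fin 2), ‖β‖ < δ ∧
            ∀ x ∈ Ioc (-1 : ℝ) 1, U x = ansatz p β (V (p, β) : X ε) x := by
  have hdom : K ⊆ dom ε := fun p hp => ⟨hKI hp, by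
    have := hε p hp
    rw [noSwirlSouth_eq (hKI hp)] at this
    linarith⟩
  obtain ⟨δ, hδ, r, hr, O, hO, hKO, F, hF, hsol, huniq⟩ := exists_implicit_of_compact hK
    (B := EuclideanSpace ℝ (Fin 2)) (eqn ε)
    (fun p hp => contDiffAt_eqn hε0 hε1 (v := ((p, 0), 0)) (hdom hp))
    (fun p _ => eqn_zero p) (fun p _ => hasFDerivAt_eqn p)
  -- `0` is a small zero over `(p, 0)`, so uniqueness applies.
  have hF0 : ∀ p ∈ K, F (p, 0) = 0 := fun p hp =>
    (huniq p (hKO hp) 0 (Metric.mem_ball_self hδ) 0 (by rwa [norm_zero]) (eqn_zero p)).symm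
  have hflat : ∀ p ∈ K, Flat fun β : EuclideanSpace ℝ (Fin 2) =>
      toX1 hε0 hε1 (corrData ε ((p, β), F (p, β))) := fun p hp => by
    have hd : DifferentiableAt ℝ F (p, 0) :=
      ((hF.contDiffAt ((hO.prod Metric.isOpen_ball).mem_nhds
        ⟨hKO hp, Metric.mem_ball_self hδ⟩)).differentiableAt (by simp))
    have hd' : DifferentiableAt ℝ (fun β : EuclideanSpace ℝ (Fin 2) => F (p, β)) 0 :=
      hd.comp (f := fun β : EuclideanSpace ℝ (Fin 2) => (p, β)) 0 (by fun_prop)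
    exact (flat_corrData hε0 hε1 (hdom hp) hd' (hF0 p hp)).clm (toX1 hε0 hε1)
  obtain ⟨c, hc, hcK⟩ := exists_le_massOp_fund hε0 hε1 hK hdom
  refine ⟨δ, hδ, fun q => toX1 hε0 hε1 (corrData ε (q, F q)),
    ⟨O ∩ dom ε, hO.inter (isOpen_dom ε), subset_inter hKO hdom, ?_⟩,
    fun p hp => (hflat p hp).1, fun p hp => (hflat p hp).2, fun p hp β hβ => ?_,
    -- The bound `r` puts `y`, whose norm is at most that of `W`, in the range of uniqueness; the
    -- other bound gives `|β| < δ` by `norm_parameters_le`.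
    min r (δ / (1 + 1 / c)), lt_min hr (by positivity), fun p hp U W hU hW m hs => ?_⟩
  · intro q hq
    have h1 : ContDiffAt ℝ ω F q := hF.contDiffAt
      ((hO.prod Metric.isOpen_ball).mem_nhds ⟨hq.1.1, hq.2⟩)
    have h2 : ContDiffAt ℝ ω (fun q => corrData ε (q, F q)) q :=
      (contDiffAt_corrData hε0 hε1 (v := (q, F q)) hq.1.2).comp (f := fun q => (q, F q)) q
        (contDiffAt_id.prodMk h1)
    exact (((toX1 hε0 hε1).contDiff.contDiffAt.comp q h2).of_le le_top).contDiffWithinAt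
  · have he := hsol p (hKO hp) β (mem_ball_zero_iff.2 hβ)
    exact isSolution_of_eqn hε0 hε1 (hdom hp) (solution_of_eqn (hdom hp) he).2
      fun x hx => ansatz_eq hε0 hε1 (hdom hp) he (Ioo_subset_Ioc_self hx)
  · have hWn : ‖W‖ = ‖W.fst‖ + ‖W.snd‖ := WithLp.prod_norm_eq_of_L1 W
    obtain ⟨he, hUx⟩ := eqn_of_isSolution hε0 hε1 (hdom hp) hU hs
      -- These values are forced: at `0` the correction vanishes, `V¹` has polar component `1`, and
      -- `V²` has swirl component `massOp ε (fund ε p)`.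
      (β := !₂[W.fst.toFun 0, W.snd.toFun 0 / massOp ε (fund ε p)]) rfl rfl
    have hβ : ‖(!₂[W.fst.toFun 0, W.snd.toFun 0 / massOp ε (fund ε p)] :
        EuclideanSpace ℝ (Fin 2))‖ < δ := by
      refine (norm_parameters_le W hc (hcK p hp)).trans_lt ?_
      have := hW.trans_le (min_le_right _ _)
      rwa [lt_div_iff₀ (by positivity)] at this
    refine ⟨_, hβ, fun x hx => ?_⟩
    have hy := huniq p (hKO hp) _ (mem_ball_zero_iff.2 hβ) _
      (((W.fst.norm_quot_le hε0 hε1).trans (by rw [hWn]; linarith [norm_nonneg W.snd])).trans_lt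
        (hW.trans_le (min_le_left _ _))) he
    beta_reduce
    rw [← hy, ansatz_eq hε0 hε1 (hdom hp) he hx]
    exact hUx x hx
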